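/- Let $P\subset\mathbb H^n$ be a convex polytope with finitely many facets, non-empty interior and finite volume. Suppose that $P$ is right-angled (any two distinct facets of $P$ that meet in $\mathbb H^n$ are orthogonal) and that $P$ has at least one ideal vertex, that is, a point of $\partial\mathbb H^n$ in the closure of $P$. Let $\Gamma<\mathrm{Isom}(\mathbb H^n)$ be the group generated by the reflections $r_F$ along the facets $F$ of $P$. A $c$-colouring of $P$ is a surjective map from the set of facets to $\{1,\dots,c\}$ such that any two distinct facets that meet in $\mathbb H^n$ have distinct colours. For every $c$-colouring of $P$ there is a homomorphism $\varphi\colon\Gamma\to(\mathbb Z/2)^c$ that sends $r_F$ to the basis vector $e_j$, where $j$ is the colour of $F$, for every facet $F$. Its kernel $\Gamma'$ acts freely on $\mathbb H^n$, and the quotient $M=\mathbb H^n/\Gamma'$, with the quotient metric, is a connected, complete, orientable hyperbolic $n$-manifold. The cusps of $M$ are the $\Gamma'$-orbits of the points of $\partial\mathbb H^n$ that are fixed by a parabolic element of $\Gamma'$. 1. Every cusp of $M$ is toric: at each such parabolic fixed point $\xi$ there is a horoball $B$ such that every element of $\Gamma'$ that does not preserve $B$ maps $B$ to a horoball disjoint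 from $B$, and the quotient of the horosphere $\partial B$, with its intrinsic flat metric, by the stabilizer of $B$ in $\Gamma'$ is isometric to a flat torus $\mathbb R^{n-1}/\Lambda$, where $\Lambda$ is a lattice. 2. For every ideal vertex $v$ of $P$, the number of cusps of $M$ lying above $v$ (that is, of the cusps whose parabolic fixed points belong to the $\Gamma$-orbit of $v$) is exactly $2^{c-c'}$, where $c'$ is the number of distinct colours on the facets of $P$ incident to $v$. -/

import Mathlib

open scoped ENNReal

noncomputable section

namespace HypCusp

/-! ## Minkowski space and hyperbolic space (hyperboloid model) -/

/-- Minkowski space of signature `(n, 1)`; the first coordinate is the time coordinate. -/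
abbrev Mink (n : ℕ) : Type := ℝ × EuclideanSpace ℝ (Fin n)

/-- The Lorentzian form `-x₀y₀ + x₁y₁ + ⋯ + xₙyₙ`. -/
def lor {n : ℕ} (x y : Mink n) : ℝ := inner ℝ x.2 y.2 - x.1 * y.1

/-- Hyperbolic space: the upper sheet of the hyperboloid `lor x x = -1`. -/
def Hyp (n : ℕ) : Type := {x : Mink n // lor x x = -1 ∧ 0 < x.1}

/-- Future-directed nonzero lightlike vectors. Each represents an ideal point together with a
horoball centred there. -/
def Light (n : ℕ) : Type := {v : Mink n // lor v v = 0 ∧ 0 < v.1}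

instance (n : ℕ) : Coe (Hyp n) (Mink n) := ⟨Subtype.val⟩
instance (n : ℕ) : Coe (Light n) (Mink n) := ⟨Subtype.val⟩

section lemmas
variable {n : ℕ}

theorem lor_comm (x y : Mink n) : lor x y = lor y x := by
  simp only [lor, real_inner_comm, mul_comm]

theorem lor_add_left (x y z : Mink n) : lor (x + y) z = lor x z + lor y z := by
  simp only [lor, Prod.fst_add, Prod.snd_add, inner_add_left]; ring

theorem lor_smul_left (a : ℝ) (x y : Mink n) : lor (a • x) y = a * lor x y := by
  simp only [lor, Prod.smul_fst, Prod.smul_snd, inner_smul_left, smul_eq_mul]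
  simp; ring

theorem lor_add_right (x y z : Mink n) : lor x (y + z) = lor x y + lor x z := by
  rw [lor_comm, lor_add_left, lor_comm y, lor_comm z]

theorem lor_smul_right (a : ℝ) (x y : Mink n) : lor x (a • y) = a * lor x y := by
  rw [lor_comm, lor_smul_left, lor_comm]

theorem lor_neg_left (x y : Mink n) : lor (-x) y = -lor x y := by
  rw [← neg_one_smul ℝ x, lor_smul_left]; ring

theorem lor_neg_right (x y : Mink n) : lor x (-y) = -lor x y := by
  rw [lor_comm, lor_neg_left, lor_comm]

theorem lor_sub_left (x y z : Mink n) : lor (x - y) z = lor x z - lor y z := by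
  rw [sub_eq_add_neg, lor_add_left, lor_neg_left]; ring

theorem lor_sub_right (x y z : Mink n) : lor x (y - z) = lor x y - lor x z := by
  rw [sub_eq_add_neg, lor_add_right, lor_neg_right]; ring

theorem Hyp.sq (x : Hyp n) : x.1.1 ^ 2 = 1 + ‖x.1.2‖ ^ 2 := by
  have h := x.2.1
  simp only [lor, real_inner_self_eq_norm_sq] at h
  nlinarith

theorem time_sq_le (y : Hyp n) (u : Mink n) (h : lor u y = 0) :
    u.1 ^ 2 * (1 + ‖y.1.2‖ ^ 2) ≤ ‖u.2‖ ^ 2 * ‖y.1.2‖ ^ 2 := by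
  have h1 : inner ℝ u.2 y.1.2 = u.1 * y.1.1 := by simp only [lor] at h; linarith
  have h2 := abs_real_inner_le_norm u.2 y.1.2
  rw [h1] at h2
  have h3 : (u.1 * y.1.1) ^ 2 ≤ (‖u.2‖ * ‖y.1.2‖) ^ 2 := by
    rw [← sq_abs]; gcongr
  rw [mul_pow, mul_pow, Hyp.sq] at h3
  exact h3

/-- The form is positive semidefinite on the orthogonal complement of a point of `Hyp n`. -/
theorem lor_self_nonneg (y : Hyp n) (u : Mink n) (h : lor u y = 0) : 0 ≤ lor u u := by
  have h3 := time_sq_le y u h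
  simp only [lor, real_inner_self_eq_norm_sq]
  by_contra hc
  push Not at hc
  nlinarith [sq_nonneg ‖y.1.2‖, sq_nonneg u.1]

theorem eq_zero_of_lor_self (y : Hyp n) (u : Mink n) (h : lor u y = 0) (h0 : lor u u = 0) :
    u = 0 := by
  have h3 := time_sq_le y u h
  simp only [lor, real_inner_self_eq_norm_sq] at h0
  have h4 : u.1 ^ 2 = 0 := by nlinarith [sq_nonneg u.1]
  have h5 : u.1 = 0 := by simpa using h4
  have h6 : ‖u.2‖ = 0 := by
    have : ‖u.2‖ ^ 2 = 0 := by nlinarith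
    simpa using this
  exact Prod.ext h5 (norm_eq_zero.1 h6)

theorem lor_sq_le (y : Hyp n) (u w : Mink n) (hu : lor u y = 0) (hw : lor w y = 0) :
    lor u w ^ 2 ≤ lor u u * lor w w := by
  have key : ∀ t : ℝ, 0 ≤ lor w w * (t * t) + (2 * lor u w) * t + lor u u := by
    intro t
    have := lor_self_nonneg y (u + t • w) (by rw [lor_add_left, lor_smul_left, hu, hw]; ring)
    simp only [lor_add_left, lor_add_right, lor_smul_left, lor_smul_right, lor_comm w u] at this
    linarith
  have := discrim_le_zero key
  simp only [discrim] at this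
  nlinarith

theorem lor_hyp_neg (x : Hyp n) (v : Mink n) (hv : lor v v ≤ 0) (ht : 0 < v.1) :
    lor x v < 0 := by
  have h1 := real_inner_le_norm x.1.2 v.2
  have hx := Hyp.sq x
  have hx0 := x.2.2
  simp only [lor, real_inner_self_eq_norm_sq] at hv
  have h2 : ‖x.1.2‖ < x.1.1 := by
    apply lt_of_pow_lt_pow_left₀ 2 hx0.le; linarith
  have h3 : ‖v.2‖ ≤ v.1 := by
    apply le_of_sq_le_sq _ ht.le; nlinarith
  simp only [lor]
  nlinarith [norm_nonneg x.1.2, norm_nonneg v.2]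

theorem time_pos_of_lor_neg (x : Hyp n) (v : Mink n) (hv : lor v v ≤ 0) (h : lor x v < 0) :
    0 < v.1 := by
  rcases lt_trichotomy v.1 0 with ht | ht | ht
  · have := lor_hyp_neg x (-v) (by rw [lor_neg_left, lor_neg_right]; linarith) (by simpa using ht)
    rw [lor_neg_right] at this
    linarith
  · simp only [lor, real_inner_self_eq_norm_sq, ht] at hv h
    have : ‖v.2‖ = 0 := by
      have h' : ‖v.2‖ ^ 2 = 0 := le_antisymm (by linarith) (sq_nonneg _)
      simpa using h'
    rw [norm_eq_zero.1 this] at h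
    simp at h
  · exact ht

theorem one_le_neg_lor (x y : Hyp n) : 1 ≤ -lor (x : Mink n) y := by
  have h0 := lor_hyp_neg x y.1 (by rw [y.2.1]; norm_num) y.2.2
  have := lor_self_nonneg y (x.1 + (lor x.1 y) • y.1)
    (by rw [lor_add_left, lor_smul_left, y.2.1]; ring)
  simp only [lor_add_left, lor_add_right, lor_smul_left, lor_smul_right, lor_comm y.1 x.1,
    x.2.1, y.2.1] at this
  nlinarith

end lemmas

/-- Hyperbolic space with the hyperbolic distance, `cosh (dist x y) = -lor x y`. -/
instance (n : ℕ) : MetricSpace (Hyp n) where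
  dist x y := Real.arcosh (-lor (x : Mink n) y)
  dist_self x := by rw [x.2.1, neg_neg, Real.arcosh_zero]
  dist_comm x y := by rw [lor_comm]
  dist_triangle x y z := by
    have hxy := one_le_neg_lor x y
    have hyz := one_le_neg_lor y z
    have hxz := one_le_neg_lor x z
    have ha := Real.arcosh_nonneg hxy
    have hb := Real.arcosh_nonneg hyz
    rw [← Real.arcosh_cosh (add_nonneg ha hb), Real.arcosh_le_arcosh (by linarith)
      (Real.cosh_pos _), Real.cosh_add, Real.cosh_arcosh hxy, Real.cosh_arcosh hyz,
      Real.sinh_arcosh hxy, Real.sinh_arcosh hyz]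
    have key := lor_sq_le y (x.1 + (lor x.1 y) • y.1) (z.1 + (lor z.1 y) • y.1)
      (by rw [lor_add_left, lor_smul_left, y.2.1]; ring)
      (by rw [lor_add_left, lor_smul_left, y.2.1]; ring)
    simp only [lor_add_left, lor_add_right, lor_smul_left, lor_smul_right, lor_comm y.1 x.1,
      lor_comm z.1 y.1, x.2.1, y.2.1, z.2.1] at key
    rw [← Real.sqrt_mul (by nlinarith)]
    have : -lor x.1 z.1 - lor x.1 y.1 * lor y.1 z.1
        ≤ √(((-lor x.1 y.1) ^ 2 - 1) * ((-lor y.1 z.1) ^ 2 - 1)) := by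
      apply Real.le_sqrt_of_sq_le
      nlinarith
    linarith
  eq_of_dist_eq_zero {x y} h := by
    rw [Real.arcosh_eq_zero_iff (one_le_neg_lor x y)] at h
    have := eq_zero_of_lor_self y (x.1 - y.1)
      (by rw [lor_sub_left, y.2.1]; linarith)
      (by simp only [lor_sub_left, lor_sub_right, x.2.1, y.2.1, lor_comm y.1 x.1]; linarith)
    exact Subtype.ext (sub_eq_zero.1 this)

/-! ## Isometries -/

/-- The isometry group of hyperbolic space: linear automorphisms of Minkowski space which preserve
the Lorentzian form and the upper sheet. -/
def isomGroup (n : ℕ) : Subgroup (Mink n ≃ₗ[ℝ] Mink n) where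
  carrier := {g | (∀ x y, lor (g x) (g y) = lor x y) ∧ ∀ x : Hyp n, 0 < (g x).1}
  one_mem' := ⟨fun _ _ => rfl, fun x => x.2.2⟩
  mul_mem' {g h} hg hh := by
    refine ⟨fun x y => ?_, fun x => ?_⟩
    · exact (hg.1 _ _).trans (hh.1 _ _)
    · exact hg.2 ⟨h x, by rw [hh.1, x.2.1], hh.2 x⟩
  inv_mem' {g} hg := by
    have hinv : ∀ x y, lor (g⁻¹ x) (g⁻¹ y) = lor x y := fun x y => by
      rw [← hg.1]
      change lor (g (g.symm x)) (g (g.symm y)) = _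
      simp
    refine ⟨hinv, fun x => ?_⟩
    by_contra hc
    have hn : lor (-(g⁻¹ x.1)) (-(g⁻¹ x.1)) = -1 := by
      rw [lor_neg_left, lor_neg_right, hinv, x.2.1]; norm_num
    have hne : (g⁻¹ x.1).1 ≠ 0 := by
      intro h0
      have h1 := hinv x x
      rw [x.2.1] at h1
      simp only [lor, real_inner_self_eq_norm_sq, h0] at h1
      nlinarith [sq_nonneg ‖(g⁻¹ x.1).2‖]
    have hpos : 0 < (-(g⁻¹ x.1)).1 := by
      rw [Prod.fst_neg]
      exact neg_pos.2 (lt_of_le_of_ne (not_lt.1 hc) hne)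
    have h2 := hg.2 ⟨_, hn, hpos⟩
    have h3 : g (-(g⁻¹ x.1)) = -x.1 := by
      rw [map_neg]
      change -(g (g.symm x.1)) = _
      simp
    simp only [h3] at h2
    have := x.2.2
    simp only [Prod.fst_neg] at h2
    linarith

/-- Isometries of hyperbolic space. -/
abbrev Isom (n : ℕ) : Type := ↥(isomGroup n)

instance (n : ℕ) : MulAction (Isom n) (Hyp n) where
  smul g x := ⟨g.1 x.1, by rw [g.2.1, x.2.1], g.2.2 x⟩
  one_smul _ := rfl
  mul_smul _ _ _ := rfl

/-- A base point of hyperbolic space. -/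
def Hyp.base (n : ℕ) : Hyp n := ⟨(1, 0), by simp [lor], by simp⟩

theorem Isom.light_time_pos {n : ℕ} (g : Isom n) (v : Light n) : 0 < (g.1 v.1).1 := by
  refine time_pos_of_lor_neg (g • Hyp.base n) _ (by rw [g.2.1, v.2.1]) ?_
  change lor (g.1 (Hyp.base n).1) (g.1 v.1) < 0
  rw [g.2.1]
  exact lor_hyp_neg _ _ v.2.1.le v.2.2

instance (n : ℕ) : MulAction (Isom n) (Light n) where
  smul g v := ⟨g.1 v.1, by rw [g.2.1, v.2.1], g.light_time_pos v⟩
  one_smul _ := rfl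
  mul_smul _ _ _ := rfl

/-- The isometry preserves the orientation of hyperbolic space. -/
def Isom.IsOrientationPreserving {n : ℕ} (g : Isom n) : Prop :=
  LinearMap.det (g.1 : Mink n →ₗ[ℝ] Mink n) = 1

/-! ## Ideal points -/

/-- Two lightlike vectors span the same ray. -/
def lightSetoid (n : ℕ) : Setoid (Light n) where
  r v w := ∃ t : ℝ, 0 < t ∧ (w : Mink n) = t • (v : Mink n)
  iseqv := by
    refine ⟨fun v => ⟨1, one_pos, by simp⟩, ?_, ?_⟩
    · rintro v w ⟨t, ht, h⟩
      exact ⟨t⁻¹, inv_pos.2 ht, by rw [h, smul_smul, inv_mul_cancel₀ ht.ne', one_smul]⟩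
    · rintro u v w ⟨t, ht, h⟩ ⟨s, hs, h'⟩
      exact ⟨s * t, mul_pos hs ht, by rw [h', h, smul_smul]⟩

/-- Points of the sphere at infinity of hyperbolic space. -/
def IdealPoint (n : ℕ) : Type := Quotient (lightSetoid n)

/-- The ideal point spanned by a lightlike vector. -/
def Light.ideal {n : ℕ} (v : Light n) : IdealPoint n := Quotient.mk (lightSetoid n) v

instance (n : ℕ) : MulAction (Isom n) (IdealPoint n) where
  smul g := Quotient.map (g • ·) (by
    rintro v w ⟨t, ht, h⟩
    refine ⟨t, ht, ?_⟩
    change g.1 w.1 = t • g.1 v.1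
    rw [h, map_smul])
  one_smul ξ := by induction ξ using Quotient.ind; rfl
  mul_smul g h ξ := by induction ξ using Quotient.ind; rfl

/-! ## Polytopes -/

/-- A convex polytope (with nonempty interior and finitely many facets) in hyperbolic space, given
by the outer unit normals of its facets. -/
structure Polytope (n : ℕ) where
  /-- the number of facets -/
  m : ℕ
  /-- the outer unit normals -/
  normal : Fin m → Mink n
  unit : ∀ i, lor (normal i) (normal i) = 1
  /-- the interior is not empty -/
  interior : ∃ x : Hyp n, ∀ i, lor x (normal i) < 0
  /-- every hyperplane does support a facet, which lies on no other hyperplane -/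
  facet : ∀ i, ∃ x : Hyp n, lor x (normal i) = 0 ∧ ∀ j, j ≠ i → lor x (normal j) < 0

/-- The reflection along the hyperplane orthogonal to the unit vector `e`. -/
def reflection {n : ℕ} (e : Mink n) (he : lor e e = 1) : Isom n :=
  ⟨LinearEquiv.ofInvolutive
    { toFun := fun x => x - (2 * lor x e) • e
      map_add' := fun x y => by rw [lor_add_left, mul_add, add_smul]; abel
      map_smul' := fun a x => by
        rw [lor_smul_left, RingHom.id_apply, smul_sub, smul_smul]; congr 2; ring }
    (fun x => by
      change (x - (2 * lor x e) • e) - (2 * lor (x - (2 * lor x e) • e) e) • e = x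
      rw [lor_sub_left, lor_smul_left, he, sub_sub, ← add_smul]
      have : 2 * lor x e + 2 * (lor x e - 2 * lor x e * 1) = 0 := by ring
      rw [this, zero_smul, sub_zero]),
    by
      have hl : ∀ x y : Mink n,
          lor (x - (2 * lor x e) • e) (y - (2 * lor y e) • e) = lor x y := fun x y => by
        simp only [lor_sub_left, lor_sub_right, lor_smul_left, lor_smul_right, he, lor_comm e y]
        ring
      refine ⟨hl, fun x => ?_⟩
      change 0 < (x.1 - (2 * lor x.1 e) • e).1
      refine time_pos_of_lor_neg x _ (by rw [hl, x.2.1]; norm_num) ?_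
      rw [lor_sub_right, lor_smul_right, x.2.1]
      nlinarith [sq_nonneg (lor x.1 e)]⟩

/-- The point of the hyperboloid with prescribed space coordinates. -/
def Hyp.lift {n : ℕ} (u : EuclideanSpace ℝ (Fin n)) : Hyp n :=
  ⟨(√(1 + ‖u‖ ^ 2), u), by
    have h : (0 : ℝ) ≤ 1 + ‖u‖ ^ 2 := by positivity
    simp only [lor, real_inner_self_eq_norm_sq, Real.mul_self_sqrt h]; ring,
    by positivity⟩

/-- The hyperbolic volume; in the space coordinates `u` of the hyperboloid model the volume form is
`du / √(1 + ‖u‖²)`. -/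
def hypVolume {n : ℕ} (S : Set (Hyp n)) : ℝ≥0∞ :=
  ∫⁻ u in {u : EuclideanSpace ℝ (Fin n) | Hyp.lift u ∈ S}, ENNReal.ofReal (1 / √(1 + ‖u‖ ^ 2))

namespace Polytope
variable {n : ℕ} (P : Polytope n)

/-- The underlying set of points. -/
def carrier : Set (Hyp n) := {x | ∀ i, lor x (P.normal i) ≤ 0}

/-- The `i`-th facet. -/
def facetSet (i : Fin P.m) : Set (Hyp n) := {x | x ∈ P.carrier ∧ lor x (P.normal i) = 0}

/-- Any two distinct facets that meet (in hyperbolic space) are orthogonal. -/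
def IsRightAngled : Prop :=
  ∀ i j, i ≠ j → (P.facetSet i ∩ P.facetSet j).Nonempty → lor (P.normal i) (P.normal j) = 0

def HasFiniteVolume : Prop := hypVolume P.carrier < ∞

/-- `ξ` is an ideal vertex: a point at infinity in the closure of `P`. (When `P` has finite volume
these are finitely many isolated points.) -/
def IsIdealVertex (ξ : IdealPoint n) : Prop :=
  ∃ v : Light n, v.ideal = ξ ∧ ∀ i, lor v (P.normal i) ≤ 0

/-- The facets incident to the ideal point `ξ`. -/
def facetsAt (ξ : IdealPoint n) : Set (Fin P.m) :=
  {i | ∃ v : Light n, v.ideal = ξ ∧ lor v (P.normal i) = 0}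

/-- A colouring with palette `Fin c`: distinct facets that meet have distinct colours, and every
colour is used. -/
structure IsColouring {c : ℕ} (col : Fin P.m → Fin c) : Prop where
  ne_of_meet : ∀ i j, i ≠ j → (P.facetSet i ∩ P.facetSet j).Nonempty → col i ≠ col j
  surjective : Function.Surjective col

/-- The group `Γ` generated by the reflections along the facets. -/
def reflectionGroup : Subgroup (Isom n) :=
  Subgroup.closure (Set.range fun i => reflection (P.normal i) (P.unit i))

/-- The reflection along the `i`-th facet, as an element of `Γ`. -/
def refl (i : Fin P.m) : P.reflectionGroup :=
  ⟨reflection (P.normal i) (P.unit i), Subgroup.subset_closure ⟨i, rfl⟩⟩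

end Polytope

/-! ## Hyperbolic manifolds -/

/-- A (connected, complete, orientable) hyperbolic `n`-manifold, as a metric
space: there is an atlas of charts which are isometries from small balls onto balls of hyperbolic
space, with orientation-preserving isometries as transition maps. The chart `φ p` is only
meaningful on the ball of radius `r p` about `p`. -/
structure IsHyperbolicManifold (n : ℕ) (M : Type) [MetricSpace M] : Prop where
  connected : ConnectedSpace M
  complete : CompleteSpace M
  atlas : ∃ (φ : M → M → Hyp n) (r : M → ℝ),
    (∀ p, 0 < r p ∧
      (∀ x ∈ Metric.ball p (r p), ∀ y ∈ Metric.ball p (r p), dist (φ p x) (φ p y) = dist x y) ∧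
      φ p '' Metric.ball p (r p) = Metric.ball (φ p p) (r p)) ∧
    ∀ p q x, x ∈ Metric.ball p (r p) → x ∈ Metric.ball q (r q) →
      ∃ g : Isom n, g.IsOrientationPreserving ∧ ∀ᶠ y in nhds x, φ q y = g • φ p y

/-- The quotient `M = ℍⁿ / G`. -/
def HypQuot {n : ℕ} (G : Subgroup (Isom n)) : Type := MulAction.orbitRel.Quotient G (Hyp n)

/-- The projection `ℍⁿ → ℍⁿ / G`. -/
def HypQuot.proj {n : ℕ} (G : Subgroup (Isom n)) (x : Hyp n) : HypQuot G :=
  Quotient.mk (MulAction.orbitRel G (Hyp n)) x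

/-- `G` acts freely and `ℍⁿ / G`, with the quotient metric (the distance between two orbits), is a
hyperbolic manifold. -/
def QuotIsHyperbolicManifold {n : ℕ} (G : Subgroup (Isom n)) : Prop :=
  (∀ g ∈ G, ∀ x : Hyp n, g • x = x → g = 1) ∧
  ∃ _ : MetricSpace (HypQuot G),
    (∀ x y : Hyp n, dist (HypQuot.proj G x) (HypQuot.proj G y) = ⨅ g : G, dist x (g • y)) ∧
    IsHyperbolicManifold n (HypQuot G)

/-! ## Cusps -/

/-- `g` is parabolic with fixed point `ξ`: it fixes no point of hyperbolic space, and `ξ` is the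
only ideal point that it fixes. -/
def IsParabolicAt {n : ℕ} (g : Isom n) (ξ : IdealPoint n) : Prop :=
  (∀ x : Hyp n, g • x ≠ x) ∧ ∀ η : IdealPoint n, g • η = η ↔ η = ξ

/-- The class of an ideal point modulo `G`. -/
def idealClass {n : ℕ} (G : Subgroup (Isom n)) (ξ : IdealPoint n) :
    MulAction.orbitRel.Quotient G (IdealPoint n) :=
  Quotient.mk (MulAction.orbitRel G (IdealPoint n)) ξ

/-- The cusps of `ℍⁿ / G`: the parabolic fixed points of `G`, modulo the action of `G`. -/
def cusps {n : ℕ} (G : Subgroup (Isom n)) : Set (MulAction.orbitRel.Quotient G (IdealPoint n)) :=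
  idealClass G '' {ξ | ∃ g ∈ G, IsParabolicAt g ξ}

/-- For `G ≤ Γ`, the cusps of `ℍⁿ / G` lying above the class of the ideal point `ξ` in the quotient
by `Γ`. -/
def cuspsAbove {n : ℕ} (Γ G : Subgroup (Isom n)) (ξ : IdealPoint n) :
    Set (MulAction.orbitRel.Quotient G (IdealPoint n)) :=
  {q | q ∈ cusps G ∧ ∃ γ ∈ Γ, q = idealClass G (γ • ξ)}

/-- The closed horoball determined by a lightlike vector. -/
def horoball {n : ℕ} (v : Light n) : Set (Hyp n) := {x | -lor (x : Mink n) v ≤ 1}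

/-- The horosphere determined by a lightlike vector. -/
def horosphere {n : ℕ} (v : Light n) : Set (Hyp n) := {x | -lor (x : Mink n) v = 1}

/-- The intrinsic flat distance between two points of a horosphere (the path distance for the
induced Riemannian metric) is their Minkowski distance in the hyperboloid model, which is
`2 sinh (dist x y / 2)`. -/
def horoDist {n : ℕ} (x y : Hyp n) : ℝ := √(lor (x.1 - y.1) (x.1 - y.1))

/-- The cusp of `ℍⁿ / G` at `ξ` has a flat torus as a section: for some horoball at `ξ`,
* the horoball is precisely invariant, so that the quotient of the horoball by the stabilizer of the
  horoball is embedded in `ℍⁿ / G`;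
* the quotient of the horosphere by this stabilizer, with the quotient of the intrinsic flat
  metric, is isometric to `ℝⁿ⁻¹ / Λ` for some lattice `Λ` (the isometry is induced by `f`). -/
def IsToricAt {n : ℕ} (G : Subgroup (Isom n)) (ξ : IdealPoint n) : Prop :=
  ∃ v : Light n, v.ideal = ξ ∧
    (∀ g ∈ G, (∃ x ∈ horoball v, g • x ∈ horoball v) → g • v = v) ∧
    ∃ Λ : Submodule ℤ (EuclideanSpace ℝ (Fin (n - 1))),
      ∃ _ : DiscreteTopology Λ, IsZLattice ℝ Λ ∧
      ∃ f : horosphere v → EuclideanSpace ℝ (Fin (n - 1)) ⧸ Λ.toAddSubgroup,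
        Function.Surjective f ∧
        (∀ x y, f x = f y ↔ ∃ g ∈ G, g • v = v ∧ g • (x : Hyp n) = y) ∧
        ∀ x y, dist (f x) (f y) =
          ⨅ g : {g : Isom n // g ∈ G ∧ g • v = v}, horoDist (x : Hyp n) (g.1 • (y : Hyp n))

/-- A cusp is toric if its section is a flat torus. -/
def IsToricCusp {n : ℕ} (G : Subgroup (Isom n))
    (q : MulAction.orbitRel.Quotient G (IdealPoint n)) : Prop :=
  ∀ ξ, idealClass G ξ = q → IsToricAt G ξ

end HypCusp

end

noncomputable section

namespace HypCusp

/-! ### Causal vectors and the Lorentzian form -/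

section causal
variable {n : ℕ}

/-! Everything is read off from the Lorentzian products of the facet normals. Projecting alternately
onto two walls of a right-angled polytope never leaves it, so walls of facets that do not meet do
not cross in hyperbolic space: distinct normals have product 0 or at most -1 (`lor_normal_cases`).
This dichotomy makes `Γ` behave like a right-angled Coxeter group without any appeal to a
presentation. By induction on word length, `g` moves `P` to the inner side of each wall whose
reflection lengthens `g` (`side`). Hence `P`, together with its ideal points, is a strict
fundamental domain whose stabilizers are generated by reflections (`eq_of_mem_cone`). Two reduced
words for the same element differ by commutations, so the sum of the colours of a reduced word is
well defined (`colSum_eq`) and gives the homomorphism `φ`.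

At a point of `P` the incident walls are orthogonal and have distinct colours, so an element of the
stabilizer is detected by its colour vector. Thus the kernel `Γ'` acts freely. It is discrete, and
it preserves orientation because the parity of the word length is the parity of the colour vector,
so the quotient is a manifold.

Finite volume forces the closed cone over `P` to contain no spacelike vector (`lor_self_nonpos`). At
an ideal vertex `v` this makes the link a compact box: the incident facets form opposite pairs with
normals `e` and `-e + a v`, and one normal from each pair gives Euclidean coordinates on the
horosphere (`exists_frame`). The stabilizer acts on each coordinate by a sign and a shift. The sign
is a function of the colour vector, so in `Γ'` only translations survive (`ker_apply_normal`), and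
the squared products `transl` supply enough of them to span.

A parabolic element displaces points by arbitrarily little. Moved into `P`, such points must run
into a cusp of `P`, so every parabolic fixed point is a `Γ`-translate of an ideal vertex
(`exists_ideal_vertex_of_parabolic`). The cusps above `v` are then the cosets of `(Z/2)^c` modulo
the vectors supported on the colours at `v`, which gives the count. -/

@[simp] theorem lor_zero_left (x : Mink n) : lor 0 x = 0 := by simp [lor]

theorem continuous_lor : Continuous fun p : Mink n × Mink n => lor p.1 p.2 := by
  unfold lor; fun_prop

@[fun_prop]
theorem _root_.Continuous.lor {X : Type*} [TopologicalSpace X] {f g : X → Mink n}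
    (hf : Continuous f) (hg : Continuous g) : Continuous fun x => lor (f x) (g x) :=
  continuous_lor.comp (hf.prodMk hg)

theorem tendsto_lor {X : Type*} {l : Filter X} {f g : X → Mink n} {a b : Mink n}
    (hf : Filter.Tendsto f l (nhds a)) (hg : Filter.Tendsto g l (nhds b)) :
    Filter.Tendsto (fun x => lor (f x) (g x)) l (nhds (lor a b)) := by
  unfold lor
  exact ((hf.snd_nhds).inner hg.snd_nhds).sub (hf.fst_nhds.mul hg.fst_nhds)

/-- Future-directed vectors which are timelike or lightlike. -/
def IsCausal (x : Mink n) : Prop := lor x x ≤ 0 ∧ 0 < x.1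

theorem IsCausal.norm_le {x : Mink n} (hx : IsCausal x) : ‖x.2‖ ≤ x.1 := by
  have h := hx.1
  simp only [lor, real_inner_self_eq_norm_sq] at h
  exact le_of_sq_le_sq (by nlinarith) hx.2.le

theorem Hyp.isCausal (x : Hyp n) : IsCausal x.1 := ⟨by rw [x.2.1]; norm_num, x.2.2⟩

theorem Light.isCausal (x : Light n) : IsCausal x.1 := ⟨x.2.1.le, x.2.2⟩

theorem IsCausal.lor_nonpos {x y : Mink n} (hx : IsCausal x) (hy : IsCausal y) :
    lor x y ≤ 0 := by
  have h1 := real_inner_le_norm x.2 y.2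
  have h2 := mul_le_mul hx.norm_le hy.norm_le (norm_nonneg _) hx.2.le
  simp only [lor]; linarith

theorem IsCausal.lor_hyp_neg {x : Mink n} (hx : IsCausal x) (y : Hyp n) : lor x y.1 < 0 := by
  rw [lor_comm]; exact HypCusp.lor_hyp_neg y x hx.1 hx.2

theorem IsCausal.smul {x : Mink n} (hx : IsCausal x) {t : ℝ} (ht : 0 < t) :
    IsCausal (t • x) := by
  refine ⟨?_, mul_pos ht hx.2⟩
  rw [lor_smul_left, lor_smul_right]
  have := hx.1
  have h2 : 0 ≤ t * t := mul_self_nonneg t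
  nlinarith

/-- A future timelike vector is a positive multiple of a point of hyperbolic space. -/
theorem exists_hyp_smul {x : Mink n} (h : lor x x < 0) (h0 : 0 < x.1) :
    ∃ t : ℝ, 0 < t ∧ ∃ y : Hyp n, y.1 = t • x := by
  have hs : 0 < √(-lor x x) := Real.sqrt_pos.2 (by linarith)
  refine ⟨(√(-lor x x))⁻¹, inv_pos.2 hs, ⟨(√(-lor x x))⁻¹ • x, ?_, mul_pos (inv_pos.2 hs) h0⟩, rfl⟩
  rw [lor_smul_left, lor_smul_right, ← mul_assoc, ← mul_inv, Real.mul_self_sqrt (by linarith)]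
  rw [inv_neg, neg_mul, inv_mul_cancel₀ h.ne]

theorem time_pos_of_timelike {x v : Mink n} (hx : lor x x < 0) (h0 : 0 < x.1)
    (hv : lor v v ≤ 0) (h : lor x v < 0) : 0 < v.1 := by
  obtain ⟨t, ht, y, hy⟩ := exists_hyp_smul hx h0
  refine time_pos_of_lor_neg y v hv ?_
  rw [hy, lor_smul_left]
  exact mul_neg_of_pos_of_neg ht h

theorem Isom.lor_map (g : Isom n) (x y : Mink n) : lor (g.1 x) (g.1 y) = lor x y := g.2.1 x y

theorem Isom.mul_apply (g h : Isom n) (x : Mink n) : (g * h).1 x = g.1 (h.1 x) := rfl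

theorem Isom.one_apply (x : Mink n) : (1 : Isom n).1 x = x := rfl

theorem Isom.inv_apply_self (g : Isom n) (x : Mink n) : (g⁻¹).1 (g.1 x) = x := by
  rw [← Isom.mul_apply, inv_mul_cancel, Isom.one_apply]

theorem Isom.apply_inv_self (g : Isom n) (x : Mink n) : g.1 ((g⁻¹).1 x) = x := by
  rw [← Isom.mul_apply, mul_inv_cancel, Isom.one_apply]

theorem Isom.lor_inv (g : Isom n) (x y : Mink n) : lor ((g⁻¹).1 x) y = lor x (g.1 y) := by
  rw [← g.lor_map, Isom.apply_inv_self]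

theorem Isom.ext_apply {g h : Isom n} (H : ∀ x, g.1 x = h.1 x) : g = h :=
  Subtype.ext (LinearEquiv.ext H)

theorem Isom.coe_smul_hyp (g : Isom n) (x : Hyp n) : (g • x).1 = g.1 x.1 := rfl

theorem Isom.coe_smul_light (g : Isom n) (x : Light n) : (g • x).1 = g.1 x.1 := rfl

theorem Isom.smul_ideal (g : Isom n) (x : Light n) : g • x.ideal = (g • x).ideal := rfl

theorem Isom.isCausal (g : Isom n) {x : Mink n} (hx : IsCausal x) : IsCausal (g.1 x) := by
  refine ⟨by rw [g.lor_map]; exact hx.1, ?_⟩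
  refine time_pos_of_lor_neg (g • Hyp.base n) _ (by rw [g.lor_map]; exact hx.1) ?_
  rw [Isom.coe_smul_hyp, g.lor_map, lor_comm]
  exact hx.lor_hyp_neg _

/-- The form restricted to the orthogonal complement of a lightlike vector is positive
semidefinite, with kernel spanned by this vector. -/
theorem lor_self_nonneg_of_light (v : Light n) {u : Mink n} (h : lor u v.1 = 0) :
    0 ≤ lor u u := by
  by_contra hc
  push Not at hc
  rcases lt_trichotomy u.1 0 with h0 | h0 | h0
  · obtain ⟨t, ht, y, hy⟩ := exists_hyp_smul (x := -u)
      (by rw [lor_neg_left, lor_neg_right]; linarith) (by simpa using h0)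
    have := v.isCausal.lor_hyp_neg y
    rw [hy, lor_smul_right, lor_neg_right, lor_comm, h] at this
    simp at this
  · simp only [lor, real_inner_self_eq_norm_sq, h0] at hc
    nlinarith [sq_nonneg ‖u.2‖]
  · obtain ⟨t, ht, y, hy⟩ := exists_hyp_smul hc h0
    have := v.isCausal.lor_hyp_neg y
    rw [hy, lor_smul_right, lor_comm, h] at this
    simp at this

theorem eq_smul_of_light (v : Light n) {u : Mink n} (h : lor u v.1 = 0) (h0 : lor u u = 0) :
    ∃ t : ℝ, u = t • v.1 := by
  have hv := Hyp.isCausal (Hyp.base n)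
  have hb := v.isCausal.lor_hyp_neg (Hyp.base n)
  refine ⟨lor u (Hyp.base n).1 / lor v.1 (Hyp.base n).1, ?_⟩
  rw [← sub_eq_zero]
  apply eq_zero_of_lor_self (Hyp.base n)
  · rw [lor_sub_left, lor_smul_left, div_mul_cancel₀ _ hb.ne, sub_self]
  · simp only [lor_sub_left, lor_sub_right, lor_smul_left, lor_smul_right, h, h0, v.2.1,
      lor_comm v.1 u]
    ring

end causal

/-! ### The Gram matrix of a right-angled polytope -/

namespace Polytope
variable {n : ℕ} (P : Polytope n)

/-- The facets `i` and `j` have a common point. -/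
def Meet (i j : Fin P.m) : Prop := (P.facetSet i ∩ P.facetSet j).Nonempty

theorem meet_of_timelike {i j : Fin P.m} {x : Mink n} (hx : lor x x < 0) (h0 : 0 < x.1)
    (hP : ∀ k, lor x (P.normal k) ≤ 0) (hi : lor x (P.normal i) = 0)
    (hj : lor x (P.normal j) = 0) : P.Meet i j := by
  obtain ⟨t, ht, y, hy⟩ := exists_hyp_smul hx h0
  have hc : y ∈ P.carrier := fun k => by
    rw [hy, lor_smul_left]; exact mul_nonpos_of_nonneg_of_nonpos ht.le (hP k)
  exact ⟨y, ⟨hc, by rw [hy, lor_smul_left, hi, mul_zero]⟩,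
    ⟨hc, by rw [hy, lor_smul_left, hj, mul_zero]⟩⟩

theorem timelike_proj {x e : Mink n} (he : lor e e = 1) (hx : lor x x < 0) (h0 : 0 < x.1) :
    lor (x - lor x e • e) (x - lor x e • e) < 0 ∧ 0 < (x - lor x e • e).1 := by
  have h1 : lor (x - lor x e • e) (x - lor x e • e) < 0 := by
    simp only [lor_sub_left, lor_sub_right, lor_smul_left, lor_smul_right, he, lor_comm e x]
    nlinarith [sq_nonneg (lor x e)]
  refine ⟨h1, time_pos_of_timelike hx h0 h1.le ?_⟩
  rw [lor_sub_right, lor_smul_right]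
  nlinarith [sq_nonneg (lor x e)]

/-- The orthogonal projection onto the hyperplane of a facet of a right-angled polytope maps the
polytope into this facet. -/
theorem proj_mem (hP : P.IsRightAngled) (i : Fin P.m) {x : Mink n} (hx : lor x x < 0)
    (h0 : 0 < x.1) (hxP : ∀ k, lor x (P.normal k) ≤ 0) (k : Fin P.m) :
    lor (x - lor x (P.normal i) • P.normal i) (P.normal k) ≤ 0 := by
  obtain ⟨hz, hz0⟩ := timelike_proj (P.unit i) hx h0
  set z := x - lor x (P.normal i) • P.normal i with hzdef
  have hzi : lor z (P.normal i) = 0 := by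
    rw [hzdef, lor_sub_left, lor_smul_left, P.unit]; ring
  -- If `z` were outside `P`, the path from the interior point `y` of facet `i` towards `z`, inside
  -- wall `i`, would have a first exit wall `j`. Facets `i` and `j` then meet, so they are
  -- orthogonal, and the projection does not change the product with normal `j`: a contradiction.
  obtain ⟨y, hyi, hy⟩ := P.facet i
  by_contra! hc
  obtain ⟨j, hj, hmin⟩ := Finset.exists_min_image
    (Finset.univ.filter fun j => 0 < lor z (P.normal j))
    (fun j => -lor y (P.normal j) / lor z (P.normal j)) ⟨k, by simpa using hc⟩
  simp only [Finset.mem_filter, Finset.mem_univ, true_and] at hj hmin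
  have hji : j ≠ i := by rintro rfl; exact hj.ne' hzi
  set r := -lor y (P.normal j) / lor z (P.normal j) with hr
  have hrpos : 0 < r := div_pos (by linarith [hy j hji]) hj
  have hyz : lor y.1 z < 0 := lor_hyp_neg y z hz.le hz0
  have hmeet : P.Meet i j := by
    refine P.meet_of_timelike (x := y.1 + r • z) ?_ ?_ ?_ ?_ ?_
    · simp only [lor_add_left, lor_add_right, lor_smul_left, lor_smul_right, y.2.1, lor_comm z y]
      have := mul_pos hrpos hrpos
      nlinarith
    · exact add_pos y.2.2 (mul_pos hrpos hz0)
    · intro l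
      rw [lor_add_left, lor_smul_left]
      by_cases hl : 0 < lor z (P.normal l)
      · have := hmin l hl
        rw [le_div_iff₀ hl] at this
        linarith
      · have h1 : lor y (P.normal l) ≤ 0 := by
          by_cases hli : l = i
          · rw [hli, hyi]
          · exact (hy l hli).le
        nlinarith
    · rw [lor_add_left, lor_smul_left, hyi, hzi]; ring
    · rw [lor_add_left, lor_smul_left, hr, div_mul_cancel₀ _ hj.ne']; ring
  have horth := hP i j hji.symm hmeet
  rw [hzdef, lor_sub_left, lor_smul_left, horth] at hj
  linarith [hxP j]

/-- Otherwise the difference of the normals is causal, so one half-space contains the other and one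
of the two walls supports no facet. -/
theorem lor_normal_lt_one {i j : Fin P.m} (hij : i ≠ j) :
    lor (P.normal i) (P.normal j) < 1 := by
  by_contra! h
  obtain ⟨y, hyi, hy⟩ := P.facet i
  obtain ⟨z, hzj, hz⟩ := P.facet j
  have hc : lor (P.normal j - P.normal i) (P.normal j - P.normal i) ≤ 0 := by
    simp only [lor_sub_left, lor_sub_right, P.unit, lor_comm (P.normal j) (P.normal i)]
    linarith
  have h1 : 0 < (P.normal j - P.normal i).1 := by
    refine time_pos_of_lor_neg y _ hc ?_
    rw [lor_sub_right, hyi, sub_zero]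
    exact hy j hij.symm
  have h2 := lor_hyp_neg z _ hc h1
  rw [lor_sub_right, hzj] at h2
  linarith [hz i hij]

/-- The Gram matrix of a right-angled polytope: the hyperplanes of two facets which do not meet
do not cross either. -/
theorem lor_normal_le (hP : P.IsRightAngled) {i j : Fin P.m} (hij : i ≠ j)
    (hm : ¬ P.Meet i j) : lor (P.normal i) (P.normal j) ≤ -1 := by
  by_contra! hlt
  have hgt := P.lor_normal_lt_one hij
  set t := lor (P.normal i) (P.normal j) with ht
  obtain ⟨x, hxj, hx⟩ := P.facet j
  set a := lor x (P.normal i) with ha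
  have ht2 : t ^ 2 < 1 := by nlinarith
  have hd : 0 < 1 - t ^ 2 := by linarith
  -- If `|t| < 1` the walls cross. Starting from `x` on wall `j`, project onto wall `i` and back
  -- onto wall `j`. Each round multiplies the product with normal `i` by `t ^ 2`, so the total
  -- correction after `m` rounds is a partial geometric sum. All iterates stay in the cone over `P`,
  -- and their limit is a timelike vector on both walls.
  have hseq : ∀ m : ℕ, ∀ z, z = x.1 - (a * (1 - (t ^ 2) ^ m) / (1 - t ^ 2)) •
      (P.normal i - t • P.normal j) → lor z z < 0 ∧ 0 < z.1 ∧ ∀ k, lor z (P.normal k) ≤ 0 := by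
    intro m
    induction m with
    | zero =>
      rintro z rfl
      have h : x.1 - (a * (1 - (t ^ 2) ^ 0) / (1 - t ^ 2)) •
        (P.normal i - t • P.normal j) = x.1 := by simp
      rw [h]
      refine ⟨by rw [x.2.1]; norm_num, x.2.2, fun k => ?_⟩
      by_cases hk : k = j
      · rw [hk, hxj]
      · exact (hx k hk).le
    | succ m ih =>
      intro z' hz'
      obtain ⟨h1, h2, h3⟩ := ih _ rfl
      set z := x.1 - (a * (1 - (t ^ 2) ^ m) / (1 - t ^ 2)) • (P.normal i - t • P.normal j) with hz
      have hzi : lor z (P.normal i) = a * (t ^ 2) ^ m := by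
        rw [hz]
        simp only [lor_sub_left, lor_smul_left, P.unit, lor_comm (P.normal j) (P.normal i), ← ht,
          ← ha]
        field_simp
        ring
      have hzj : lor z (P.normal j) = 0 := by
        rw [hz]
        simp only [lor_sub_left, lor_smul_left, P.unit, ← ht, hxj]
        ring
      have hq := timelike_proj (P.unit i) h1 h2
      have hqP := P.proj_mem hP i h1 h2 h3
      have hqq := timelike_proj (P.unit j) hq.1 hq.2
      have hqqP := P.proj_mem hP j hq.1 hq.2 hqP
      have heq : z' = (z - lor z (P.normal i) • P.normal i) -
          lor (z - lor z (P.normal i) • P.normal i) (P.normal j) • P.normal j := by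
        have hqj : lor (z - lor z (P.normal i) • P.normal i) (P.normal j) =
            -(a * (t ^ 2) ^ m * t) := by
          rw [lor_sub_left z, lor_smul_left, hzi, hzj, ← ht]; ring
        rw [hz', hqj, hzi]
        have hc : a * (1 - (t ^ 2) ^ (m + 1)) / (1 - t ^ 2) =
            a * (1 - (t ^ 2) ^ m) / (1 - t ^ 2) + a * (t ^ 2) ^ m := by
          field_simp
          ring
        rw [hc, hz]
        module
      rw [heq]
      exact ⟨hqq.1, hqq.2, hqqP⟩
  set z := x.1 - (a * (1 - 0) / (1 - t ^ 2)) • (P.normal i - t • P.normal j) with hz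
  have hlim : Filter.Tendsto (fun m : ℕ => x.1 - (a * (1 - (t ^ 2) ^ m) / (1 - t ^ 2)) •
      (P.normal i - t • P.normal j)) Filter.atTop (nhds z) := by
    have h0 := tendsto_pow_atTop_nhds_zero_of_lt_one (sq_nonneg t) ht2
    exact tendsto_const_nhds.sub ((((tendsto_const_nhds.sub h0).const_mul a).div_const _).smul
      tendsto_const_nhds)
  have hxz : ∀ y, lor y z = lor y x.1 - (a / (1 - t ^ 2)) *
      (lor y (P.normal i) - t * lor y (P.normal j)) := fun y => by
    rw [hz]; simp only [lor_sub_right, lor_smul_right]; ring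
  have hzi : lor z (P.normal i) = 0 := by
    rw [lor_comm, hxz, P.unit, ← ht, lor_comm, ← ha]
    field_simp
    ring
  have hzj : lor z (P.normal j) = 0 := by
    rw [lor_comm, hxz, P.unit, lor_comm, hxj, lor_comm, ← ht]; ring
  have hxz' : lor x.1 z < 0 := by
    rw [hxz, x.2.1, hxj, ← ha]
    have : 0 ≤ a / (1 - t ^ 2) * a := by
      rw [div_mul_eq_mul_div]; exact div_nonneg (mul_self_nonneg a) hd.le
    linarith
  have hzz : lor z z < 0 := by
    rw [hxz, hzi, hzj, lor_comm]; linarith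
  refine hm (P.meet_of_timelike hzz (time_pos_of_lor_neg x z hzz.le hxz') (fun k => ?_) hzi hzj)
  exact le_of_tendsto' (tendsto_lor hlim tendsto_const_nhds) fun m => (hseq m _ rfl).2.2 k

theorem meet_iff (hP : P.IsRightAngled) {i j : Fin P.m} (hij : i ≠ j) :
    P.Meet i j ↔ lor (P.normal i) (P.normal j) = 0 := by
  refine ⟨hP i j hij, fun h => ?_⟩
  by_contra hm
  have := P.lor_normal_le hP hij hm
  rw [h] at this
  linarith

theorem lor_normal_cases (hP : P.IsRightAngled) {i j : Fin P.m} (hij : i ≠ j) :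
    lor (P.normal i) (P.normal j) = 0 ∨ lor (P.normal i) (P.normal j) ≤ -1 := by
  by_cases hm : P.Meet i j
  · exact .inl (hP i j hij hm)
  · exact .inr (P.lor_normal_le hP hij hm)

end Polytope
-- Word length and the fundamental domain
namespace Polytope
variable {n : ℕ} (P : Polytope n)

/-- The reflection along the `i`-th facet, as an isometry. -/
def s (i : Fin P.m) : Isom n := reflection (P.normal i) (P.unit i)

theorem s_apply (i : Fin P.m) (x : Mink n) :
    (P.s i).1 x = x - (2 * lor x (P.normal i)) • P.normal i := rfl

@[simp] theorem s_mul_s (i : Fin P.m) : P.s i * P.s i = 1 := by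
  refine Isom.ext_apply fun x => ?_
  rw [Isom.mul_apply, s_apply, s_apply, lor_sub_left, lor_smul_left, P.unit, Isom.one_apply]
  module

@[simp] theorem s_mul_s_mul (i : Fin P.m) (g : Isom n) : P.s i * (P.s i * g) = g := by
  rw [← mul_assoc, s_mul_s, one_mul]

@[simp] theorem s_inv (i : Fin P.m) : (P.s i)⁻¹ = P.s i :=
  inv_eq_of_mul_eq_one_left (P.s_mul_s i)

theorem s_comm {i j : Fin P.m} (h : lor (P.normal i) (P.normal j) = 0) :
    P.s i * P.s j = P.s j * P.s i := by
  refine Isom.ext_apply fun x => ?_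
  simp only [Isom.mul_apply, s_apply, lor_sub_left, lor_smul_left, h,
    (lor_comm (P.normal j) (P.normal i)).trans h]
  module

theorem lor_s_self (i : Fin P.m) (x : Mink n) :
    lor ((P.s i).1 x) (P.normal i) = -lor x (P.normal i) := by
  rw [s_apply, lor_sub_left, lor_smul_left, P.unit]; ring

theorem lor_s_of_orth {i j : Fin P.m} (h : lor (P.normal i) (P.normal j) = 0) (x : Mink n) :
    lor ((P.s i).1 x) (P.normal j) = lor x (P.normal j) := by
  rw [s_apply, lor_sub_left, lor_smul_left, h]; ring

/-- The group generated by the reflections along some of the facets. -/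
def subRefl (I : Set (Fin P.m)) : Subgroup (Isom n) := Subgroup.closure (P.s '' I)

theorem subRefl_univ : P.subRefl Set.univ = P.reflectionGroup := by
  rw [subRefl, Set.image_univ]; rfl

theorem s_mem_subRefl {I : Set (Fin P.m)} {i : Fin P.m} (hi : i ∈ I) : P.s i ∈ P.subRefl I :=
  Subgroup.subset_closure ⟨i, hi, rfl⟩

theorem s_mem (i : Fin P.m) : P.s i ∈ P.reflectionGroup :=
  Subgroup.subset_closure ⟨i, rfl⟩

theorem subRefl_le (I : Set (Fin P.m)) : P.subRefl I ≤ P.reflectionGroup := by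
  rw [subRefl, Subgroup.closure_le]
  rintro _ ⟨i, -, rfl⟩
  exact P.s_mem i

theorem subRefl_induction {I : Set (Fin P.m)} {p : Isom n → Prop} (one : p 1)
    (mul : ∀ i ∈ I, ∀ g ∈ P.subRefl I, p g → p (P.s i * g)) {g : Isom n} (hg : g ∈ P.subRefl I) :
    p g := by
  induction hg using Subgroup.closure_induction_left with
  | one => exact one
  | mul_left x hx y hy ih => obtain ⟨i, hi, rfl⟩ := hx; exact mul i hi y hy ih
  | inv_mul_cancel x hx y hy ih =>
    obtain ⟨i, hi, rfl⟩ := hx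
    rw [s_inv]
    exact mul i hi y hy ih

/-- The product of the reflections in a list. -/
def word (l : List (Fin P.m)) : Isom n := (l.map P.s).prod

@[simp] theorem word_nil : P.word [] = 1 := rfl

@[simp] theorem word_cons (i : Fin P.m) (l : List (Fin P.m)) :
    P.word (i :: l) = P.s i * P.word l := by simp [word]

theorem word_mem (l : List (Fin P.m)) : P.word l ∈ P.reflectionGroup := by
  induction l with
  | nil => exact one_mem _
  | cons i l ih => rw [word_cons]; exact mul_mem (P.s_mem i) ih

theorem exists_word {g : Isom n} (hg : g ∈ P.reflectionGroup) : ∃ l, P.word l = g := by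
  rw [← subRefl_univ] at hg
  refine P.subRefl_induction (p := fun g => ∃ l, P.word l = g) ⟨[], rfl⟩ ?_ hg
  rintro i - g - ⟨l, rfl⟩
  exact ⟨i :: l, by simp⟩

/-- The word length with respect to the reflections along the facets. -/
def len (g : Isom n) : ℕ := sInf {k | ∃ l : List (Fin P.m), l.length = k ∧ P.word l = g}

theorem len_word_le (l : List (Fin P.m)) : P.len (P.word l) ≤ l.length :=
  Nat.sInf_le ⟨l, rfl, rfl⟩

theorem exists_reduced {g : Isom n} (hg : g ∈ P.reflectionGroup) :
    ∃ l : List (Fin P.m), l.length = P.len g ∧ P.word l = g := by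
  obtain ⟨l, hl⟩ := P.exists_word hg
  exact Nat.sInf_mem (s := {k | ∃ l : List (Fin P.m), l.length = k ∧ P.word l = g})
    ⟨l.length, l, rfl, hl⟩

theorem det_s (i : Fin P.m) : LinearMap.det ((P.s i).1 : Mink n →ₗ[ℝ] Mink n) = -1 := by
  let f : Module.Dual ℝ (Mink n) :=
    { toFun := fun x => -2 * lor x (P.normal i)
      map_add' := fun x y => by rw [lor_add_left]; ring
      map_smul' := fun a x => by rw [lor_smul_left]; simp; ring }
  have h : ((P.s i).1 : Mink n →ₗ[ℝ] Mink n) = LinearMap.transvection f (P.normal i) := by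
    refine LinearMap.ext fun x => ?_
    rw [LinearMap.transvection.apply]
    change x - (2 * lor x (P.normal i)) • P.normal i = x + (-2 * lor x (P.normal i)) • P.normal i
    module
  rw [h, LinearMap.transvection.det]
  change 1 + -2 * lor (P.normal i) (P.normal i) = -1
  rw [P.unit]; norm_num

theorem det_mul (g h : Isom n) : LinearMap.det ((g * h).1 : Mink n →ₗ[ℝ] Mink n) =
    LinearMap.det (g.1 : Mink n →ₗ[ℝ] Mink n) * LinearMap.det (h.1 : Mink n →ₗ[ℝ] Mink n) := by
  rw [← LinearMap.det_comp]; rfl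

theorem det_word (l : List (Fin P.m)) :
    LinearMap.det ((P.word l).1 : Mink n →ₗ[ℝ] Mink n) = (-1) ^ l.length := by
  induction l with
  | nil => exact LinearMap.det_id
  | cons i l ih => rw [word_cons, det_mul, det_s, ih, List.length_cons, pow_succ]; ring

theorem len_s_mul_le {g : Isom n} (hg : g ∈ P.reflectionGroup) (i : Fin P.m) :
    P.len (P.s i * g) ≤ P.len g + 1 := by
  obtain ⟨l, hl, rfl⟩ := P.exists_reduced hg
  rw [← hl, ← word_cons]
  exact P.len_word_le (i :: l)

/-- The length changes by at most one, and it does change because the determinant is the parity of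
the length. -/
theorem len_s_mul {g : Isom n} (hg : g ∈ P.reflectionGroup) (i : Fin P.m) :
    P.len (P.s i * g) = P.len g + 1 ∨ P.len (P.s i * g) + 1 = P.len g := by
  have h1 := P.len_s_mul_le hg i
  have hg' := mul_mem (P.s_mem i) hg
  have h2 := P.len_s_mul_le hg' i
  rw [s_mul_s_mul] at h2
  have h3 : P.len (P.s i * g) ≠ P.len g := by
    intro h
    obtain ⟨l, hl, hlg⟩ := P.exists_reduced hg
    obtain ⟨l', hl', hlg'⟩ := P.exists_reduced hg'
    have e1 := P.det_word l
    have e2 := P.det_word l'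
    rw [hlg', det_mul, det_s, ← hlg, e1, hl', h, ← hl] at e2
    have : ((-1 : ℝ)) ^ l.length ≠ 0 := by simp
    apply this
    linarith
  omega

theorem eq_one_of_len {g : Isom n} (hg : g ∈ P.reflectionGroup) (h : P.len g = 0) : g = 1 := by
  obtain ⟨l, hl, rfl⟩ := P.exists_reduced hg
  rw [h, List.length_eq_zero_iff] at hl
  rw [hl, word_nil]

theorem exists_descent {g : Isom n} (hg : g ∈ P.reflectionGroup) (h1 : g ≠ 1) :
    ∃ i, P.len (P.s i * g) + 1 = P.len g := by
  obtain ⟨l, hl, rfl⟩ := P.exists_reduced hg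
  cases l with
  | nil => exact absurd rfl h1
  | cons i l =>
    refine ⟨i, ?_⟩
    rcases P.len_s_mul hg i with h | h
    · rw [word_cons, s_mul_s_mul] at h
      have := P.len_word_le l
      rw [word_cons, List.length_cons] at hl
      omega
    · exact h

theorem len_induction {p : Isom n → Prop} (one : p 1)
    (mul : ∀ i, ∀ g ∈ P.reflectionGroup, P.len (P.s i * g) = P.len g + 1 → p g → p (P.s i * g))
    {g : Isom n} (hg : g ∈ P.reflectionGroup) : p g := by
  induction hk : P.len g generalizing g with
  | zero => rw [P.eq_one_of_len hg hk]; exact one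
  | succ k ih =>
    by_cases h1 : g = 1
    · rw [h1]; exact one
    obtain ⟨i, hi⟩ := P.exists_descent hg h1
    have hg' := mul_mem (P.s_mem i) hg
    have := mul i _ hg' (by rw [s_mul_s_mul]; omega) (ih hg' (by omega))
    rwa [s_mul_s_mul] at this

/-- The cone of causal vectors over the closure of the polytope. -/
def cone : Set (Mink n) := {y | IsCausal y ∧ ∀ i, lor y (P.normal i) ≤ 0}

theorem mem_cone_of_hyp {x : Hyp n} (hx : x ∈ P.carrier) : x.1 ∈ P.cone := ⟨x.isCausal, hx⟩

/-- An interior point of the polytope. -/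
def center : Hyp n := P.interior.choose

theorem center_lt (i : Fin P.m) : lor P.center (P.normal i) < 0 := P.interior.choose_spec i

/-- The sum of the two normals is future causal. Consequently the outer side of one wall lies in the
inner side of the other. -/
theorem lor_add_le {i j : Fin P.m} (h : lor (P.normal i) (P.normal j) ≤ -1) {z : Mink n}
    (hz : IsCausal z) : lor z (P.normal i) + lor z (P.normal j) ≤ 0 := by
  have hc : lor (P.normal i + P.normal j) (P.normal i + P.normal j) ≤ 0 := by
    simp only [lor_add_left, lor_add_right, P.unit, lor_comm (P.normal j) (P.normal i)]
    linarith
  have h0 : 0 < (P.normal i + P.normal j).1 := by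
    refine time_pos_of_lor_neg P.center _ hc ?_
    rw [lor_add_right]
    linarith [P.center_lt i, P.center_lt j]
  rw [← lor_add_right]
  exact hz.lor_nonpos ⟨hc, h0⟩

/-- If multiplication by the `i`-th reflection increases the length of `g`, then `g` moves the
polytope to the inner side of the `i`-th hyperplane. -/
theorem side (hP : P.IsRightAngled) {g : Isom n} (hg : g ∈ P.reflectionGroup) {i : Fin P.m}
    (hi : P.len (P.s i * g) = P.len g + 1) :
    (∀ y ∈ P.cone, lor (g.1 y) (P.normal i) ≤ 0) ∧ lor (g.1 P.center) (P.normal i) < 0 := by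
  induction hk : P.len g using Nat.strong_induction_on generalizing g i with
  | _ k ih =>
    by_cases h1 : g = 1
    · subst h1
      exact ⟨fun y hy => hy.2 i, P.center_lt i⟩
    obtain ⟨j, hj⟩ := P.exists_descent hg h1
    have hij : i ≠ j := by rintro rfl; omega
    obtain ⟨h, rfl⟩ : ∃ h, g = P.s j * h := ⟨P.s j * g, by simp⟩
    have hh : h ∈ P.reflectionGroup := by simpa using mul_mem (P.s_mem j) hg
    rw [s_mul_s_mul] at hj
    rcases P.lor_normal_cases hP hij with h0 | hle
    -- Commuting case: reflection `i` also lengthens `h`, and reflection `j` preserves the product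
    -- with normal `i`.
    · have hji := (lor_comm (P.normal j) (P.normal i)).trans h0
      have e1 := P.len_s_mul_le hh i
      have e2 := P.len_s_mul_le (mul_mem (P.s_mem i) hh) j
      rw [← mul_assoc, ← P.s_comm h0, mul_assoc] at e2
      obtain ⟨a, b⟩ := ih (P.len h) (by omega) hh (i := i) (by omega) rfl
      refine ⟨fun y hy => ?_, ?_⟩
      · rw [Isom.mul_apply, P.lor_s_of_orth hji]; exact a y hy
      · rw [Isom.mul_apply, P.lor_s_of_orth hji]; exact b
    -- Disjoint case: `g` puts `P` on the outer side of wall `j`, hence on the inner side of wall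
    -- `i`.
    · obtain ⟨a, b⟩ := ih (P.len h) (by omega) hh (i := j) (by omega) rfl
      refine ⟨fun y hy => ?_, ?_⟩
      · have := P.lor_add_le hle (Isom.isCausal (P.s j * h) hy.1)
        have e := P.lor_s_self j (h.1 y)
        rw [← Isom.mul_apply] at e
        linarith [a y hy]
      · have := P.lor_add_le hle (Isom.isCausal (P.s j * h) P.center.isCausal)
        have e := P.lor_s_self j (h.1 P.center)
        rw [← Isom.mul_apply] at e
        linarith

theorem side_of_descent (hP : P.IsRightAngled) {g : Isom n} (hg : g ∈ P.reflectionGroup)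
    {i : Fin P.m} (hi : P.len (P.s i * g) + 1 = P.len g) :
    0 < lor (g.1 P.center) (P.normal i) := by
  have h := (P.side hP (mul_mem (P.s_mem i) hg) (i := i) (by rw [s_mul_s_mul]; omega)).2
  rw [Isom.mul_apply, lor_s_self] at h
  linarith

/-- Build `g` letter by letter along a reduced word. By `side` every new reflection is applied to a
vector on the inner side of its wall, so it can only lower the product with the centre. Equality
forces each reflection to fix the vector. -/
theorem lor_center_le (hP : P.IsRightAngled) {y : Mink n} (hy : y ∈ P.cone) {g : Isom n}
    (hg : g ∈ P.reflectionGroup) : lor (g.1 y) P.center ≤ lor y P.center ∧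
      (lor (g.1 y) P.center = lor y P.center →
        g.1 y = y ∧ g ∈ P.subRefl {i | lor y (P.normal i) = 0}) := by
  refine P.len_induction (p := fun g => lor (g.1 y) P.center ≤ lor y P.center ∧
      (lor (g.1 y) P.center = lor y P.center →
        g.1 y = y ∧ g ∈ P.subRefl {i | lor y (P.normal i) = 0}))
    ⟨le_rfl, fun _ => ⟨rfl, one_mem _⟩⟩ ?_ hg
  rintro i g hg hlen ⟨h1, h2⟩
  have ha := (P.side hP hg hlen).1 y hy
  have hc := P.center_lt i
  have e : lor ((P.s i * g).1 y) P.center = lor (g.1 y) P.center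
      - 2 * (lor (g.1 y) (P.normal i) * lor P.center (P.normal i)) := by
    rw [Isom.mul_apply, s_apply, lor_sub_left, lor_smul_left, lor_comm (P.normal i)]; ring
  have hm := mul_nonneg_of_nonpos_of_nonpos ha hc.le
  refine ⟨by linarith, fun heq => ?_⟩
  obtain ⟨h3, h4⟩ := h2 (by linarith)
  have h5 : lor (g.1 y) (P.normal i) = 0 := by
    have : lor (g.1 y) (P.normal i) * lor P.center (P.normal i) = 0 := by linarith
    exact (mul_eq_zero.1 this).resolve_right hc.ne
  rw [h3] at h5
  refine ⟨?_, mul_mem (P.s_mem_subRefl h5) h4⟩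
  rw [Isom.mul_apply, h3, s_apply, h5]
  module

/-- The polytope is a strict fundamental domain, also at infinity, and the stabilizers are
generated by reflections. -/
theorem eq_of_mem_cone (hP : P.IsRightAngled) {y : Mink n} (hy : y ∈ P.cone) {g : Isom n}
    (hg : g ∈ P.reflectionGroup) (hgy : g.1 y ∈ P.cone) :
    g.1 y = y ∧ g ∈ P.subRefl {i | lor y (P.normal i) = 0} := by
  have h1 := P.lor_center_le hP hy hg
  have h2 := (P.lor_center_le hP hgy (inv_mem hg)).1
  rw [Isom.inv_apply_self] at h2
  exact h1.2 (le_antisymm h1.1 h2)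

/-! ### The colour homomorphism and its kernel -/

section colour
variable {c : ℕ} (col : Fin P.m → Fin c)

theorem two_torsion (a : Fin c → ZMod 2) : a + a = 0 :=
  funext fun _ => CharTwo.add_self_eq_zero _

/-- The sum of the basis vectors of the colours of a list of facets. -/
def colSum (l : List (Fin P.m)) : Fin c → ZMod 2 := (l.map fun i => Pi.single (col i) 1).sum

@[simp] theorem colSum_cons (i : Fin P.m) (l : List (Fin P.m)) :
    P.colSum col (i :: l) = Pi.single (col i) 1 + P.colSum col l := by simp [colSum]

/-- This replaces the Coxeter presentation. If two reduced words start with different letters, the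
translated centre lies on the outer side of both walls. The walls therefore cannot be disjoint, the
two reflections commute, and both words can be compared with words that start with the two letters
in either order. -/
theorem colSum_eq (hP : P.IsRightAngled) (l l' : List (Fin P.m)) (hl : P.len (P.word l) = l.length)
    (hl' : P.len (P.word l) = l'.length) (h : P.word l = P.word l') :
    P.colSum col l = P.colSum col l' := by
  induction hk : l.length generalizing l l' with
  | zero =>
    rw [List.length_eq_zero_iff.1 hk, List.length_eq_zero_iff.1 (by omega : l'.length = 0)]
  | succ k ih =>
    cases l with
    | nil => simp at hk
    | cons i m =>
    cases l' with
    | nil => simp only [List.length_nil] at hl'; omega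
    | cons j m' =>
    rw [List.length_cons] at hk hl hl'
    have hm := P.len_word_le m
    have hm' := P.len_word_le m'
    have hg := P.word_mem (i :: m)
    have hdi : P.len (P.s i * P.word (i :: m)) + 1 = P.len (P.word (i :: m)) := by
      have := P.len_s_mul hg i
      rw [word_cons, s_mul_s_mul] at this ⊢
      rw [word_cons] at hl
      omega
    have hdj : P.len (P.s j * P.word (i :: m)) + 1 = P.len (P.word (i :: m)) := by
      have := P.len_s_mul hg j
      rw [h, word_cons, s_mul_s_mul] at this ⊢
      rw [h, word_cons] at hl'
      omega
    have hwm : P.s i * P.word (i :: m) = P.word m := by simp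
    have hwm' : P.s j * P.word (i :: m) = P.word m' := by rw [h]; simp
    rw [colSum_cons, colSum_cons]
    by_cases hij : i = j
    · subst hij
      rw [ih m m' (by rw [← hwm]; omega) (by rw [← hwm]; omega) (hwm.symm.trans hwm') (by omega)]
    have hsi := P.side_of_descent hP hg hdi
    have hsj := P.side_of_descent hP hg hdj
    rcases P.lor_normal_cases hP hij with h0 | hle
    -- Removing the letter `i` does not affect the side of wall `j`, so `j` is still a descent of
    -- the remaining word.
    · have hsj' : 0 < lor ((P.word m).1 P.center) (P.normal j) := by
        rw [← hwm, Isom.mul_apply, P.lor_s_of_orth h0]; exact hsj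
      have hd : P.len (P.s j * P.word m) + 1 = P.len (P.word m) := by
        rcases P.len_s_mul (P.word_mem m) j with hh | hh
        · exact absurd (P.side hP (P.word_mem m) hh).2 hsj'.not_gt
        · exact hh
      obtain ⟨p, hp, hpw⟩ := P.exists_reduced (mul_mem (P.s_mem j) (P.word_mem m))
      have e1 : P.word m = P.word (j :: p) := by rw [word_cons, hpw, s_mul_s_mul]
      have e2 : P.word m' = P.word (i :: p) := by
        rw [word_cons, hpw, ← hwm', ← hwm, ← mul_assoc, P.s_comm h0, mul_assoc, s_mul_s_mul]
      rw [hwm] at hdi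
      rw [hwm'] at hdj
      rw [ih m (j :: p) (by omega) (by rw [List.length_cons]; omega) e1 (by omega),
        ih m' (i :: p) (by omega) (by rw [List.length_cons]; omega) e2 (by omega),
        colSum_cons, colSum_cons]
      abel
    · have := P.lor_add_le hle (Isom.isCausal (P.word (i :: m)) P.center.isCausal)
      linarith

/-- The colour vector of an element of the reflection group. -/
def colVec (g : Isom n) : Fin c → ZMod 2 :=
  open Classical in
  if hg : g ∈ P.reflectionGroup then P.colSum col (P.exists_reduced hg).choose else 0

theorem colVec_eq (hP : P.IsRightAngled) {l : List (Fin P.m)} (hl : P.len (P.word l) = l.length) :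
    P.colVec col (P.word l) = P.colSum col l := by
  have hg := P.word_mem l
  have h := (P.exists_reduced hg).choose_spec
  rw [colVec, dif_pos hg]
  exact (P.colSum_eq col hP l _ hl h.1.symm h.2.symm).symm

/-- If the length grows, prepend the letter to a reduced word. If it drops, apply the first case to
the shorter element and cancel the doubled basis vector. -/
theorem colVec_s_mul (hP : P.IsRightAngled) {g : Isom n} (hg : g ∈ P.reflectionGroup)
    (i : Fin P.m) : P.colVec col (P.s i * g) = Pi.single (col i) 1 + P.colVec col g := by
  have up : ∀ g ∈ P.reflectionGroup, P.len (P.s i * g) = P.len g + 1 →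
      P.colVec col (P.s i * g) = Pi.single (col i) 1 + P.colVec col g := by
    intro g hg h
    obtain ⟨l, hl, rfl⟩ := P.exists_reduced hg
    rw [← word_cons] at h ⊢
    rw [P.colVec_eq col hP hl.symm, P.colVec_eq col hP (by rw [h, List.length_cons, hl]),
      colSum_cons]
  rcases P.len_s_mul hg i with h | h
  · exact up g hg h
  · have := up _ (mul_mem (P.s_mem i) hg) (by rw [s_mul_s_mul]; omega)
    rw [s_mul_s_mul] at this
    rw [this, ← add_assoc, two_torsion, zero_add]

theorem colVec_one (hP : P.IsRightAngled) : P.colVec col 1 = 0 := by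
  have h : P.len (P.word []) = ([] : List (Fin P.m)).length := Nat.le_zero.1 (P.len_word_le [])
  exact P.colVec_eq col hP h

theorem colVec_mul (hP : P.IsRightAngled) {g h : Isom n} (hg : g ∈ P.reflectionGroup)
    (hh : h ∈ P.reflectionGroup) :
    P.colVec col (g * h) = P.colVec col g + P.colVec col h := by
  obtain ⟨l, rfl⟩ := P.exists_word hg
  induction l with
  | nil => rw [word_nil, one_mul, P.colVec_one col hP, zero_add]
  | cons i l ih =>
    rw [word_cons, mul_assoc, P.colVec_s_mul col hP (mul_mem (P.word_mem l) hh),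
      P.colVec_s_mul col hP (P.word_mem l), ih (P.word_mem l), add_assoc]

theorem colVec_s (hP : P.IsRightAngled) (i : Fin P.m) :
    P.colVec col (P.s i) = Pi.single (col i) 1 := by
  have := P.colVec_s_mul col hP (one_mem _) i
  rwa [mul_one, P.colVec_one col hP, add_zero] at this

theorem colVec_inv (hP : P.IsRightAngled) {g : Isom n} (hg : g ∈ P.reflectionGroup) :
    P.colVec col g⁻¹ = P.colVec col g := by
  have h := P.colVec_mul col hP hg (inv_mem hg)
  rw [mul_inv_cancel, P.colVec_one col hP] at h
  rw [← add_zero (P.colVec col g), h, ← add_assoc, two_torsion, zero_add]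

/-- The homomorphism defined by a colouring. -/
def colHom (hP : P.IsRightAngled) : P.reflectionGroup →* Multiplicative (Fin c → ZMod 2) where
  toFun g := Multiplicative.ofAdd (P.colVec col g.1)
  map_one' := by rw [Subgroup.coe_one, P.colVec_one col hP]; rfl
  map_mul' g h := by rw [Subgroup.coe_mul, P.colVec_mul col hP g.2 h.2]; rfl

/-- The kernel of the homomorphism defined by a colouring. -/
def colKer (hP : P.IsRightAngled) : Subgroup (Isom n) :=
  (P.colHom col hP).ker.map P.reflectionGroup.subtype

theorem mem_colKer (hP : P.IsRightAngled) {g : Isom n} :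
    g ∈ P.colKer col hP ↔ g ∈ P.reflectionGroup ∧ P.colVec col g = 0 := by
  constructor
  · rintro ⟨h, hh, rfl⟩
    exact ⟨h.2, hh⟩
  · rintro ⟨h1, h2⟩
    exact ⟨⟨g, h1⟩, h2, rfl⟩

theorem conj_mem_colKer (hP : P.IsRightAngled) {g h : Isom n} (hg : g ∈ P.colKer col hP)
    (hh : h ∈ P.reflectionGroup) : h * g * h⁻¹ ∈ P.colKer col hP := by
  rw [mem_colKer] at hg ⊢
  refine ⟨mul_mem (mul_mem hh hg.1) (inv_mem hh), ?_⟩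
  rw [P.colVec_mul col hP (mul_mem hh hg.1) (inv_mem hh), P.colVec_mul col hP hh hg.1, hg.2,
    P.colVec_inv col hP hh, add_zero, two_torsion]

/-- The coordinates of the colour vector add up to the word length modulo 2, which determines the
determinant. -/
theorem det_eq_one_of_mem_colKer (hP : P.IsRightAngled) {g : Isom n} (hg : g ∈ P.colKer col hP) :
    g.IsOrientationPreserving := by
  have key : ∀ l : List (Fin P.m), ∑ k, P.colSum col l k = l.length := by
    intro l
    induction l with
    | nil => simp [colSum]
    | cons i l ih =>
      simp only [colSum_cons, Pi.add_apply, Finset.sum_add_distrib, ih, List.length_cons,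
        Finset.sum_pi_single', Finset.mem_univ, if_true]
      push_cast
      ring
  rw [mem_colKer] at hg
  obtain ⟨l, hl, rfl⟩ := P.exists_reduced hg.1
  have h0 := hg.2
  rw [P.colVec_eq col hP hl.symm] at h0
  have := key l
  rw [h0] at this
  simp only [Pi.zero_apply, Finset.sum_const_zero] at this
  rw [Isom.IsOrientationPreserving, det_word]
  exact Even.neg_one_pow ((ZMod.natCast_eq_zero_iff_even).1 this.symm)

end colour

/-- An element of the kernel which fixes a point of the polytope is trivial. -/
theorem eq_one_of_fixed_carrier {c : ℕ} {col : Fin P.m → Fin c} (hP : P.IsRightAngled)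
    (hcol : P.IsColouring col) {x : Hyp n} {g : Isom n} (hg : g ∈ P.colKer col hP)
    (hx : x ∈ P.carrier) (hgx : g • x = x) : g = 1 := by
  by_contra h1
  rw [mem_colKer] at hg
  obtain ⟨hg, hv⟩ := hg
  obtain ⟨i, hi⟩ := P.exists_descent hg h1
  have hpos := P.side_of_descent hP hg hi
  have hgx' : g.1 x.1 = x.1 := congrArg Subtype.val hgx
  -- Since `i` is a descent, `side` applies to `s i * g` and bounds the product of `x` with normal
  -- `i` from below; so `x` lies on wall `i`.
  have hle := (P.side hP (mul_mem (P.s_mem i) hg) (i := i) (by rw [s_mul_s_mul]; omega)).1 x.1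
    (P.mem_cone_of_hyp hx)
  rw [Isom.mul_apply, hgx', lor_s_self] at hle
  have hix : lor x (P.normal i) = 0 := le_antisymm (hx i) (by linarith)
  have hstab := (P.eq_of_mem_cone hP (P.mem_cone_of_hyp hx) hg
    (by rw [hgx']; exact P.mem_cone_of_hyp hx)).2
  -- The stabilizer of `x` is generated by reflections in orthogonal walls of distinct colours. Only
  -- reflection `i` flips normal `i`, and it alone contributes to the colour of `i`. With zero
  -- colour vector the normal is fixed, so the centre stays on its inner side, against the choice of
  -- a descent.
  have key : g.1 (P.normal i) =
      (if P.colVec col g (col i) = 0 then (1 : ℝ) else -1) • P.normal i := by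
    refine P.subRefl_induction (p := fun g => g.1 (P.normal i) =
      (if P.colVec col g (col i) = 0 then (1 : ℝ) else -1) • P.normal i) ?_ ?_ hstab
    · rw [P.colVec_one col hP, Pi.zero_apply, if_pos rfl, one_smul, Isom.one_apply]
    · intro j hj g hg ih
      rw [Isom.mul_apply, ih, map_smul, P.colVec_s_mul col hP (P.subRefl_le _ hg)]
      by_cases hij : j = i
      · subst hij
        have : ∀ a : ZMod 2, (1 + a = 0) ↔ ¬ a = 0 := by decide
        rw [Pi.add_apply, Pi.single_eq_same, s_apply, P.unit]
        simp only [this]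
        by_cases h0 : P.colVec col g (col j) = 0
        · simp only [h0, not_true, if_true, if_false]; module
        · simp only [h0, not_false_iff, if_true, if_false]; module
      · have hm : P.Meet j i := ⟨x, ⟨hx, hj⟩, ⟨hx, hix⟩⟩
        have hne := hcol.ne_of_meet j i hij hm
        rw [Pi.add_apply, Pi.single_eq_of_ne hne.symm, zero_add, s_apply,
          lor_comm, hP j i hij hm]
        module
  rw [hv, Pi.zero_apply, if_pos rfl, one_smul] at key
  have := P.center_lt i
  rw [← g.lor_map, key] at this
  linarith

end Polytope

/-! ### Topology of the hyperboloid -/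

section topology
variable {n : ℕ}

theorem Hyp.cosh_dist (x y : Hyp n) : Real.cosh (dist x y) = -lor x.1 y.1 :=
  Real.cosh_arcosh (one_le_neg_lor x y)

theorem Hyp.dist_le_dist_iff {x y z w : Hyp n} :
    dist x y ≤ dist z w ↔ lor z.1 w.1 ≤ lor x.1 y.1 := by
  change Real.arcosh _ ≤ Real.arcosh _ ↔ _
  rw [Real.arcosh_le_arcosh (by linarith [one_le_neg_lor x y]) (by linarith [one_le_neg_lor z w]),
    neg_le_neg_iff]

instance : IsIsometricSMul (Isom n) (Hyp n) where
  isometry_smul g := Isometry.of_dist_eq fun x y => by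
    change Real.arcosh (-lor (g.1 x.1) (g.1 y.1)) = Real.arcosh _
    rw [g.lor_map]

theorem Hyp.dist_inv_smul (g : Isom n) (x y : Hyp n) : dist (g⁻¹ • x) y = dist x (g • y) := by
  rw [← dist_smul g, smul_inv_smul]

theorem Hyp.continuous_time : Continuous fun x : Hyp n => x.1.1 := by
  have h : (fun x : Hyp n => x.1.1) = fun x => Real.cosh (dist x (Hyp.base n)) := by
    funext x
    rw [Hyp.cosh_dist]
    simp [lor, Hyp.base]
  rw [h]
  exact Real.continuous_cosh.comp (continuous_id.dist continuous_const)

/-- The Minkowski square of a difference is `2 (cosh d - 1)`, so the Euclidean distance of the space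
parts is a function of the hyperbolic distance and the time coordinates. -/
theorem Hyp.continuous_coe : Continuous fun x : Hyp n => x.1 := by
  refine Hyp.continuous_time.prodMk ?_
  rw [continuous_iff_continuousAt]
  intro x₀
  rw [ContinuousAt, tendsto_iff_norm_sub_tendsto_zero]
  have h : ∀ x : Hyp n, ‖x.1.2 - x₀.1.2‖ =
      √(2 * (Real.cosh (dist x x₀) - 1) + (x.1.1 - x₀.1.1) ^ 2) := by
    intro x
    rw [← Real.sqrt_sq (norm_nonneg (x.1.2 - x₀.1.2)), Hyp.cosh_dist]
    congr 1
    have hx := x.2.1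
    have hx₀ := x₀.2.1
    simp only [lor] at hx hx₀ ⊢
    rw [← real_inner_self_eq_norm_sq, inner_sub_left, inner_sub_right, inner_sub_right,
      real_inner_comm x.1.2 x₀.1.2]
    nlinarith
  have hc : Continuous fun x : Hyp n =>
      √(2 * (Real.cosh (dist x x₀) - 1) + (x.1.1 - x₀.1.1) ^ 2) := by
    have := Hyp.continuous_time (n := n)
    have h2 : Continuous fun x : Hyp n => dist x x₀ := continuous_id.dist continuous_const
    have h3 := Real.continuous_cosh.comp h2
    exact (((h3.sub continuous_const).const_mul 2).add ((this.sub continuous_const).pow 2)).sqrt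
  simp only [h]
  simpa using hc.tendsto x₀

theorem Hyp.continuous_lor_left (v : Mink n) : Continuous fun x : Hyp n => lor x.1 v :=
  Hyp.continuous_coe.lor continuous_const

theorem Hyp.continuous_lift : Continuous (Hyp.lift : EuclideanSpace ℝ (Fin n) → Hyp n) := by
  have h1 : Continuous fun u : EuclideanSpace ℝ (Fin n) => (Hyp.lift u).1 := by
    refine Continuous.prodMk ?_ continuous_id
    fun_prop
  rw [continuous_iff_continuousAt]
  intro u₀
  rw [ContinuousAt, tendsto_iff_dist_tendsto_zero]
  have h2 : Continuous fun u => dist (Hyp.lift u) (Hyp.lift u₀) := by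
    refine Real.continuousOn_arcosh.comp_continuous (h1.lor continuous_const).neg fun u => ?_
    exact one_le_neg_lor _ _
  simpa using h2.tendsto u₀

theorem Hyp.lift_space (x : Hyp n) : Hyp.lift x.1.2 = x := by
  refine Subtype.ext (Prod.ext ?_ rfl)
  change √(1 + ‖x.1.2‖ ^ 2) = x.1.1
  rw [← Hyp.sq, Real.sqrt_sq x.2.2.le]

theorem Hyp.isCompact_of_time_le {S : Set (Hyp n)} (hS : IsClosed S) {R : ℝ}
    (h : ∀ x ∈ S, x.1.1 ≤ R) : IsCompact S := by
  refine ((isCompact_closedBall (0 : EuclideanSpace ℝ (Fin n)) R).image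
    Hyp.continuous_lift).of_isClosed_subset hS fun x hx => ⟨x.1.2, ?_, x.lift_space⟩
  rw [mem_closedBall_zero_iff]
  exact x.isCausal.norm_le.trans (h x hx)

instance : ProperSpace (Hyp n) := by
  refine ⟨fun x r => ?_⟩
  refine Hyp.isCompact_of_time_le (R := Real.cosh (r + dist x (Hyp.base n)))
    Metric.isClosed_closedBall fun y hy => ?_
  have h : y.1.1 = Real.cosh (dist y (Hyp.base n)) := by
    rw [Hyp.cosh_dist]; simp [lor, Hyp.base]
  rw [h, Real.cosh_le_cosh, abs_of_nonneg dist_nonneg]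
  refine le_trans ?_ (le_abs_self _)
  linarith [dist_triangle y x (Hyp.base n), Metric.mem_closedBall.1 hy]

instance : ConnectedSpace (Hyp n) :=
  Function.Surjective.connectedSpace (fun x => ⟨x.1.2, Hyp.lift_space x⟩) Hyp.continuous_lift

/-- The distance from a horosphere changes by a bounded factor. -/
theorem Hyp.neg_lor_light_le (x y : Hyp n) (v : Light n) :
    -lor x.1 v.1 ≤ 2 * (-lor x.1 y.1) * (-lor y.1 v.1) := by
  have hτ := v.isCausal.lor_hyp_neg y
  have hC := one_le_neg_lor x y
  rw [lor_comm] at hτ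
  set τ := -lor y.1 v.1 with hτd
  have hτ0 : 0 < τ := by linarith
  -- Cauchy–Schwarz for the components of `x` and `v` orthogonal to `y`, whose squares are `cosh² d
  -- - 1` and `τ ^ 2`.
  have key := lor_sq_le y (x.1 + lor x.1 y.1 • y.1) (v.1 - τ • y.1)
    (by rw [lor_add_left, lor_smul_left, y.2.1]; ring)
    (by rw [lor_sub_left, lor_smul_left, y.2.1, lor_comm v.1]; linarith)
  simp only [lor_add_left, lor_add_right, lor_smul_left, lor_smul_right, lor_sub_left,
    lor_sub_right, x.2.1, y.2.1, v.2.1, lor_comm y.1 x.1, lor_comm v.1 y.1] at key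
  have e : lor y.1 v.1 = -τ := by linarith
  rw [e] at key
  set C := -lor x.1 y.1
  have e2 : lor x.1 y.1 = -C := by simp [C]
  rw [e2] at key
  have k2 : (-lor x.1 v.1 - τ * C) ^ 2 ≤ (τ * C) ^ 2 := by nlinarith [mul_pos hτ0 hτ0]
  have k3 := abs_le_of_sq_le_sq k2 (by positivity)
  linarith [le_abs_self (-lor x.1 v.1 - τ * C)]

end topology

/-! ### Discreteness of the reflection group -/

namespace Polytope
variable {n : ℕ} (P : Polytope n)

/-- A ball about the centre lies strictly inside all walls, while a nontrivial element pushes the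
centre beyond the wall of a descent. -/
theorem exists_dist_center (hP : P.IsRightAngled) :
    ∃ r : ℝ, 0 < r ∧ ∀ g ∈ P.reflectionGroup, g ≠ 1 → r ≤ dist (g • P.center) P.center := by
  have ho : IsOpen {x : Hyp n | ∀ i, lor x.1 (P.normal i) < 0} := by
    simp only [Set.ofPred_forall]
    exact isOpen_iInter_of_finite fun i =>
      isOpen_lt (Hyp.continuous_lor_left _) continuous_const
  obtain ⟨r, hr, hb⟩ := Metric.isOpen_iff.1 ho P.center P.center_lt
  refine ⟨r, hr, fun g hg h1 => ?_⟩
  by_contra! hlt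
  obtain ⟨i, hi⟩ := P.exists_descent hg h1
  exact (hb hlt i).not_gt (P.side_of_descent hP hg hi)

/-- The orbit of the centre is uniformly separated and a ball is totally bounded: two elements that
send the centre into the same ball of radius `r / 2` coincide. -/
theorem finite_orbit (hP : P.IsRightAngled) (x y : Hyp n) (R : ℝ) :
    {g : Isom n | g ∈ P.reflectionGroup ∧ dist (g • x) y ≤ R}.Finite := by
  obtain ⟨r, hr, hsep⟩ := P.exists_dist_center hP
  obtain ⟨t, ht, hcov⟩ := Metric.totallyBounded_iff.1
    (isCompact_closedBall y (R + dist P.center x)).totallyBounded (r / 2) (by positivity)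
  have hin : ∀ g ∈ {g : Isom n | g ∈ P.reflectionGroup ∧ dist (g • x) y ≤ R},
      ∃ z ∈ t, dist (g • P.center) z < r / 2 := by
    rintro g ⟨hg, hd⟩
    have : g • P.center ∈ Metric.closedBall y (R + dist P.center x) := by
      rw [Metric.mem_closedBall]
      have := dist_triangle (g • P.center) (g • x) y
      rw [dist_smul] at this
      linarith
    simpa using hcov this
  choose! f hft hf using hin
  refine Set.Finite.of_finite_image (f := f) (ht.subset (by rintro _ ⟨g, hg, rfl⟩; exact hft g hg))
    ?_
  intro g hg h hh hgh
  by_contra hne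
  have h1 := hsep (h⁻¹ * g) (mul_mem (inv_mem hh.1) hg.1)
    (fun e => hne (inv_mul_eq_one.1 e).symm)
  rw [mul_smul, Hyp.dist_inv_smul] at h1
  have h2 := hf g hg
  have h3 := hf h hh
  rw [← hgh] at h3
  linarith [dist_triangle_right (g • P.center) (h • P.center) (f g)]

theorem exists_fixed_of_dist_lt (hP : P.IsRightAngled) (x : Hyp n) :
    ∃ ε : ℝ, 0 < ε ∧ ∀ g ∈ P.reflectionGroup, dist x (g • x) < ε → g • x = x := by
  have hfin := P.finite_orbit hP x x 1
  set S := {g : Isom n | (g ∈ P.reflectionGroup ∧ dist (g • x) x ≤ 1) ∧ g • x ≠ x} with hS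
  have hfin' : S.Finite := hfin.subset fun g hg => hg.1
  rcases S.eq_empty_or_nonempty with he | hne
  · refine ⟨1, one_pos, fun g hg hd => ?_⟩
    by_contra hc
    have : g ∈ S := ⟨⟨hg, by rw [dist_comm]; exact hd.le⟩, hc⟩
    rw [he] at this
    exact this
  · obtain ⟨g₀, hg₀, hmin⟩ := Set.exists_min_image S (fun g => dist (g • x) x) hfin' hne
    refine ⟨min 1 (dist (g₀ • x) x), lt_min one_pos (dist_pos.2 hg₀.2), fun g hg hd => ?_⟩
    rw [dist_comm, lt_min_iff] at hd
    by_contra hc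
    exact (hmin g ⟨⟨hg, hd.1.le⟩, hc⟩).not_gt hd.2

/-- Every point can be moved by reflections along some of the facets to the inner side of the
corresponding hyperplanes. -/
theorem exists_subRefl_smul (hP : P.IsRightAngled) (I : Set (Fin P.m)) (x : Hyp n) :
    ∃ h ∈ P.subRefl I, ∀ i ∈ I, lor (h • x).1 (P.normal i) ≤ 0 := by
  have hfin := P.finite_orbit hP x P.center (dist x P.center)
  set S := {g : Isom n | g ∈ P.subRefl I ∧ dist (g • x) P.center ≤ dist x P.center}
  have hfin' : S.Finite := hfin.subset fun g hg => ⟨P.subRefl_le I hg.1, hg.2⟩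
  -- Choose the translate nearest to the centre; if it were beyond a wall in `I`, reflecting it
  -- would bring it still nearer.
  obtain ⟨h, hh, hmin⟩ := Set.exists_min_image S (fun g => dist (g • x) P.center) hfin'
    ⟨1, one_mem _, by rw [one_smul]⟩
  refine ⟨h, hh.1, fun i hi => ?_⟩
  by_contra! hc
  have hlt : dist ((P.s i * h) • x) P.center < dist (h • x) P.center := by
    rw [← not_le, Hyp.dist_le_dist_iff, not_le, mul_smul, Isom.coe_smul_hyp (P.s i), s_apply,
      lor_sub_left, lor_smul_left, lor_comm (P.normal i)]
    nlinarith [mul_neg_of_pos_of_neg hc (P.center_lt i)]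
  exact (hmin _ ⟨mul_mem (P.s_mem_subRefl hi) hh.1, hlt.le.trans hh.2⟩).not_gt hlt

theorem exists_smul_mem_carrier (hP : P.IsRightAngled) (x : Hyp n) :
    ∃ h ∈ P.reflectionGroup, h • x ∈ P.carrier := by
  obtain ⟨h, hh, hx⟩ := P.exists_subRefl_smul hP Set.univ x
  exact ⟨h, P.subRefl_le _ hh, fun i => hx i trivial⟩

/-- Every point has a translate in `P`, and the kernel is normal, so the case of points of `P`
suffices. -/
theorem eq_one_of_fixed {c : ℕ} {col : Fin P.m → Fin c} (hP : P.IsRightAngled)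
    (hcol : P.IsColouring col) {x : Hyp n} {g : Isom n} (hg : g ∈ P.colKer col hP)
    (hgx : g • x = x) : g = 1 := by
  obtain ⟨h, hh, hx⟩ := P.exists_smul_mem_carrier hP x
  have := P.eq_one_of_fixed_carrier hP hcol (P.conj_mem_colKer col hP hg hh) hx
    (by rw [mul_smul, mul_smul, inv_smul_smul, hgx])
  rwa [conj_eq_one_iff] at this

end Polytope

/-! ### The quotient metric and its charts -/

section quotient
variable {n : ℕ} (G : Subgroup (Isom n))

/-- The distance between two orbits. -/
def orbitDist (x y : Hyp n) : ℝ := ⨅ g : G, dist x (g • y)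

variable {G}

theorem orbitDist_le (x y : Hyp n) (g : G) : orbitDist G x y ≤ dist x (g • y) :=
  ciInf_le ⟨0, by rintro _ ⟨g, rfl⟩; exact dist_nonneg⟩ g

theorem exists_dist_lt {x y : Hyp n} {r : ℝ} (h : orbitDist G x y < r) :
    ∃ g : G, dist x (g • y) < r := exists_lt_of_ciInf_lt h

theorem orbitDist_nonneg (x y : Hyp n) : 0 ≤ orbitDist G x y :=
  Real.iInf_nonneg fun _ => dist_nonneg

theorem subgroup_dist_smul (g : G) (x y : Hyp n) : dist (g • x) (g • y) = dist x y :=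
  dist_smul g.1 x y

theorem orbitDist_comm (x y : Hyp n) : orbitDist G x y = orbitDist G y x := by
  have h : ∀ x y : Hyp n, orbitDist G x y ≤ orbitDist G y x := fun x y =>
    le_ciInf fun g => by
      refine (orbitDist_le x y g⁻¹).trans_eq ?_
      rw [← subgroup_dist_smul g, smul_inv_smul, dist_comm]
  exact le_antisymm (h x y) (h y x)

theorem orbitDist_triangle (x y z : Hyp n) :
    orbitDist G x z ≤ orbitDist G x y + orbitDist G y z := by
  refine le_of_forall_pos_lt_add fun ε hε => ?_
  obtain ⟨g, hg⟩ := exists_dist_lt (show orbitDist G x y < orbitDist G x y + ε / 2 by linarith)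
  obtain ⟨h, hh⟩ := exists_dist_lt (show orbitDist G y z < orbitDist G y z + ε / 2 by linarith)
  have h1 := orbitDist_le x z (g * h)
  have h2 := dist_triangle x (g • y) ((g * h) • z)
  rw [mul_smul, subgroup_dist_smul] at h2
  rw [mul_smul] at h1
  linarith

theorem orbitDist_smul_right (x y : Hyp n) (g : G) : orbitDist G x (g • y) = orbitDist G x y := by
  have h : ∀ (y : Hyp n) (g : G), orbitDist G x (g • y) ≤ orbitDist G x y := fun y g =>
    le_ciInf fun k => by
      refine (orbitDist_le x (g • y) (k * g⁻¹)).trans_eq ?_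
      rw [mul_smul, inv_smul_smul]
  refine le_antisymm (h y g) ?_
  have := h (g • y) g⁻¹
  rwa [inv_smul_smul] at this

theorem orbitDist_smul_left (x y : Hyp n) (g : G) : orbitDist G (g • x) y = orbitDist G x y := by
  rw [orbitDist_comm, orbitDist_smul_right, orbitDist_comm]

theorem proj_eq_iff {x y : Hyp n} :
    HypQuot.proj G x = HypQuot.proj G y ↔ ∃ g : G, g • y = x := by
  refine ⟨fun h => ?_, fun h => ?_⟩
  · exact MulAction.orbitRel_apply.1 (Quotient.exact h)
  · exact Quotient.sound (MulAction.orbitRel_apply.2 h)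

theorem proj_surjective : Function.Surjective (HypQuot.proj G) := Quotient.mk_surjective

/-- Elements that bring `y` close to `x` differ by one that barely moves `y`, so they are all the
same element and the infimum 0 is attained. -/
theorem exists_eq_smul_of_orbitDist
    (hG : ∀ x : Hyp n, ∃ ε : ℝ, 0 < ε ∧ ∀ g : G, dist x (g • x) < ε → g = 1)
    {x y : Hyp n} (h : orbitDist G x y = 0) :
    ∃ g : G, g • y = x := by
  obtain ⟨ε, hε, hf⟩ := hG y
  obtain ⟨g, hg⟩ := exists_dist_lt (h.trans_lt (half_pos hε))
  refine ⟨g, (eq_of_forall_dist_le fun δ hδ => ?_).symm⟩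
  obtain ⟨k, hk⟩ := exists_dist_lt (h.trans_lt (lt_min hδ (half_pos hε)))
  rw [lt_min_iff] at hk
  have h1 : g⁻¹ * k = 1 := hf _ (by
    rw [← subgroup_dist_smul g, mul_smul, smul_inv_smul]
    linarith [dist_triangle_left (g • y) (k • y) x])
  rw [inv_mul_eq_one.1 h1]
  exact hk.1.le

/-- The quotient metric. -/
@[reducible] def quotMetric
    (hG : ∀ x : Hyp n, ∃ ε : ℝ, 0 < ε ∧ ∀ g : G, dist x (g • x) < ε → g = 1) :
    MetricSpace (HypQuot G) where
  dist p q := Quotient.liftOn₂ p q (orbitDist G) (by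
    intro x y x' y' hx hy
    obtain ⟨g, rfl⟩ := MulAction.orbitRel_apply.1 hx
    obtain ⟨h, rfl⟩ := MulAction.orbitRel_apply.1 hy
    rw [← orbitDist_smul_left x' y' g, ← orbitDist_smul_right _ y' h])
  dist_self p := by
    induction p using Quotient.ind with | _ x =>
    refine le_antisymm ?_ (orbitDist_nonneg x x)
    simpa using orbitDist_le (G := G) x x 1
  dist_comm p q := by
    induction p using Quotient.ind
    induction q using Quotient.ind
    exact orbitDist_comm _ _
  dist_triangle p q r := by
    induction p using Quotient.ind
    induction q using Quotient.ind
    induction r using Quotient.ind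
    exact orbitDist_triangle _ _ _
  eq_of_dist_eq_zero {p q} h := by
    induction p using Quotient.ind with | _ x =>
    induction q using Quotient.ind with | _ y =>
    exact proj_eq_iff.2 (exists_eq_smul_of_orbitDist hG h)

theorem quotMetric_dist
    (hG : ∀ x : Hyp n, ∃ ε : ℝ, 0 < ε ∧ ∀ g : G, dist x (g • x) < ε → g = 1)
    (x y : Hyp n) :
    (quotMetric hG).dist (HypQuot.proj G x) (HypQuot.proj G y) = orbitDist G x y := rfl

/-- Closed balls of the quotient lie in images of compact balls, whence completeness. The charts are
local inverses of the projection, and two of them differ locally by an element of `G`. -/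
theorem isHyperbolicManifold_quot
    (hG : ∀ x : Hyp n, ∃ ε : ℝ, 0 < ε ∧ ∀ g : G, dist x (g • x) < ε → g = 1)
    (hdet : ∀ g ∈ G, g.IsOrientationPreserving) :
    let _ := quotMetric hG
    IsHyperbolicManifold n (HypQuot G) := by
  let _ := quotMetric hG
  have hd : ∀ x y : Hyp n, dist (HypQuot.proj G x) (HypQuot.proj G y) = orbitDist G x y :=
    quotMetric_dist hG
  have hle : ∀ x y : Hyp n, dist (HypQuot.proj G x) (HypQuot.proj G y) ≤ dist x y := fun x y => by
    simpa [hd] using orbitDist_le (G := G) x y 1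
  have hcont : Continuous (HypQuot.proj G) :=
    (LipschitzWith.of_dist_le_mul (K := 1) fun x y => by simpa using hle x y).continuous
  have hproper : ProperSpace (HypQuot G) := by
    refine ⟨fun p R => ?_⟩
    obtain ⟨x, rfl⟩ := proj_surjective p
    refine ((isCompact_closedBall x (R + 1)).image hcont).of_isClosed_subset
      Metric.isClosed_closedBall fun q hq => ?_
    obtain ⟨y, rfl⟩ := proj_surjective q
    rw [Metric.mem_closedBall, dist_comm, hd] at hq
    obtain ⟨g, hg⟩ := exists_dist_lt (show orbitDist G x y < R + 1 by linarith)
    refine ⟨g • y, ?_, proj_eq_iff.2 ⟨g, rfl⟩⟩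
    rw [Metric.mem_closedBall, dist_comm]
    exact hg.le
  refine ⟨proj_surjective.connectedSpace hcont, inferInstance, ?_⟩
  have hG' := hG
  choose ε hε hf using hG'
  let lft : HypQuot G → Hyp n := Function.surjInv proj_surjective
  have hlft : ∀ p, HypQuot.proj G (lft p) = p := Function.surjInv_eq proj_surjective
  -- With a quarter of the displacement bound, points of a ball stay at least `2 r` away from its
  -- nontrivial translates, while two points of the ball are less than `2 r` apart.
  let r : HypQuot G → ℝ := fun p => ε (lft p) / 4
  have hr : ∀ p, 0 < r p := fun p => div_pos (hε _) (by norm_num)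
  have hiso : ∀ p, ∀ y ∈ Metric.ball (lft p) (r p), ∀ z ∈ Metric.ball (lft p) (r p),
      dist (HypQuot.proj G y) (HypQuot.proj G z) = dist y z := by
    intro p y hy z hz
    refine le_antisymm (hle y z) ?_
    rw [hd]
    refine le_ciInf fun g => ?_
    by_cases hg : g = 1
    · rw [hg, one_smul]
    have h1 : 4 * r p ≤ dist (lft p) (g • lft p) := by
      have : 4 * r p = ε (lft p) := by simp only [r]; ring
      rw [this]
      exact not_lt.1 fun h => hg (hf _ g h)
    have h2 := dist_triangle4 (lft p) y (g • z) (g • lft p)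
    rw [subgroup_dist_smul] at h2
    rw [Metric.mem_ball] at hy hz
    have h3 := dist_triangle_right y z (lft p)
    have h4 := dist_comm (lft p) y
    linarith
  have hex : ∀ p, ∀ q ∈ Metric.ball p (r p),
      ∃ y ∈ Metric.ball (lft p) (r p), HypQuot.proj G y = q := by
    intro p q hq
    obtain ⟨y, rfl⟩ := proj_surjective q
    nth_rw 1 [← hlft p] at hq
    rw [Metric.mem_ball, dist_comm, hd] at hq
    obtain ⟨g, hg⟩ := exists_dist_lt hq
    exact ⟨g • y, by rwa [Metric.mem_ball, dist_comm], proj_eq_iff.2 ⟨g, rfl⟩⟩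
  choose! φ hφm hφ using hex
  have huniq : ∀ p, ∀ y ∈ Metric.ball (lft p) (r p), φ p (HypQuot.proj G y) = y := by
    intro p y hy
    have hm : HypQuot.proj G y ∈ Metric.ball p (r p) := by
      nth_rw 1 [← hlft p]
      exact (hle _ _).trans_lt hy
    rw [← dist_eq_zero, ← hiso p _ (hφm p _ hm) y hy, hφ p _ hm, dist_self]
  have hφp : ∀ p, φ p p = lft p := fun p => by
    have := huniq p (lft p) (Metric.mem_ball_self (hr p))
    rwa [hlft] at this
  refine ⟨φ, r, fun p => ⟨hr p, ?_, ?_⟩, ?_⟩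
  · intro x hx y hy
    rw [← hiso p _ (hφm p x hx) _ (hφm p y hy), hφ p x hx, hφ p y hy]
  · rw [hφp]
    ext y
    constructor
    · rintro ⟨q, hq, rfl⟩
      exact hφm p q hq
    · intro hy
      refine ⟨HypQuot.proj G y, ?_, huniq p y hy⟩
      nth_rw 1 [← hlft p]
      exact (hle _ _).trans_lt hy
  · intro p q x hxp hxq
    obtain ⟨g, hg⟩ := proj_eq_iff.1 ((hφ q x hxq).trans (hφ p x hxp).symm)
    refine ⟨g.1, hdet _ g.2, ?_⟩
    have hφq := hφm q x hxq
    set δ := r q - dist (φ q x) (lft q) with hδ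
    have hδ0 : 0 < δ := sub_pos.2 hφq
    filter_upwards [Metric.ball_mem_nhds x hδ0, Metric.isOpen_ball.mem_nhds hxp] with y hy hyp
    have h1 : dist (φ p y) (φ p x) < δ := by
      rw [← hiso p _ (hφm p y hyp) _ (hφm p x hxp), hφ p y hyp, hφ p x hxp]
      exact hy
    have h2 : g • φ p y ∈ Metric.ball (lft q) (r q) := by
      rw [Metric.mem_ball]
      have := dist_triangle (g • φ p y) (g • φ p x) (lft q)
      rw [subgroup_dist_smul, hg] at this
      linarith
    have h3 : HypQuot.proj G (g • φ p y) = y := by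
      rw [← hφ p y hyp]
      rw [hφ p y hyp, proj_eq_iff.2 ⟨g, rfl⟩, hφ p y hyp]
    have := huniq q _ h2
    rwa [h3] at this

end quotient

theorem Polytope.quotIsHyperbolicManifold {n c : ℕ} (P : Polytope n) {col : Fin P.m → Fin c}
    (hP : P.IsRightAngled) (hcol : P.IsColouring col) :
    QuotIsHyperbolicManifold (P.colKer col hP) := by
  have hG : ∀ x : Hyp n, ∃ ε : ℝ, 0 < ε ∧
      ∀ g : P.colKer col hP, dist x (g • x) < ε → g = 1 := by
    intro x
    obtain ⟨ε, hε, h⟩ := P.exists_fixed_of_dist_lt hP x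
    exact ⟨ε, hε, fun g hg => Subtype.ext
      (P.eq_one_of_fixed hP hcol g.2 (h g.1 ((P.mem_colKer col hP).1 g.2).1 hg))⟩
  exact ⟨fun g hg x hgx => P.eq_one_of_fixed hP hcol hg hgx, quotMetric hG, quotMetric_dist hG,
    isHyperbolicManifold_quot hG fun g hg => P.det_eq_one_of_mem_colKer col hP hg⟩

/-! ### Finite volume and the links of ideal vertices -/

namespace Polytope
open MeasureTheory
variable {n : ℕ} (P : Polytope n)

/-- A polytope of finite volume contains no neighbourhood of an ideal point. -/
theorem exists_lor_nonneg_of_light (hvol : P.HasFiniteVolume) (w : Light n) :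
    ∃ i, 0 ≤ lor w.1 (P.normal i) := by
  by_contra! hw
  have hn : n ≠ 0 := by
    rintro rfl
    have h := w.2.1
    have h2 := w.2.2
    simp only [lor, Subsingleton.elim w.1.2 0, inner_zero_left] at h
    nlinarith
  have hwn : ‖w.1.2‖ = w.1.1 := by
    have h := w.2.1
    simp only [lor, real_inner_self_eq_norm_sq] at h
    exact (sq_eq_sq₀ (norm_nonneg _) w.2.2.le).1 (by linarith)
  have hw0 := w.2.2
  set θ := (w.1.1)⁻¹ • w.1.2 with hθ
  have hθn : ‖θ‖ = 1 := by
    rw [hθ, norm_smul, norm_inv, Real.norm_of_nonneg hw0.le, hwn, inv_mul_cancel₀ hw0.ne']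
  have ho : IsOpen {x : Mink n | ∀ i, lor x (P.normal i) < 0} := by
    simp only [Set.ofPred_forall]
    exact isOpen_iInter_of_finite fun i =>
      isOpen_lt (continuous_id.lor continuous_const) continuous_const
  have hmem : ((1, θ) : Mink n) ∈ {x : Mink n | ∀ i, lor x (P.normal i) < 0} := by
    intro i
    have h : ((1, θ) : Mink n) = (w.1.1)⁻¹ • w.1 := by
      refine Prod.ext ?_ rfl
      simp [hw0.ne']
    rw [h, lor_smul_left]
    exact mul_neg_of_pos_of_neg (inv_pos.2 hw0) (hw i)
  clear_value θ
  obtain ⟨ρ, hρ, hball⟩ := Metric.isOpen_iff.1 ho _ hmem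
  -- Beyond this radius the time coordinate of `lift u / ‖u‖` is within `ρ` of 1, so the truncated
  -- cone `C R` about `θ` lies in `P`.
  set R := max 1 (1 / ρ) with hR
  have hR1 : 1 ≤ R := le_max_left _ _
  let C : ℝ → Set (EuclideanSpace ℝ (Fin n)) := fun a =>
    {u | a < ‖u‖} ∩ {u | ‖u - ‖u‖ • θ‖ < ρ * ‖u‖}
  have hC : ∀ {a u}, u ∈ C a ↔ a < ‖u‖ ∧ ‖u - ‖u‖ • θ‖ < ρ * ‖u‖ := Iff.rfl
  have hCo : ∀ a, IsOpen (C a) := fun a => by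
    refine IsOpen.inter (isOpen_lt continuous_const continuous_norm) (isOpen_lt ?_ ?_)
    · exact (continuous_id.sub (continuous_norm.smul continuous_const)).norm
    · exact continuous_norm.const_mul ρ
  let f : EuclideanSpace ℝ (Fin n) → ℝ≥0∞ := fun u => ENNReal.ofReal (1 / √(1 + ‖u‖ ^ 2))
  have hpos : ∀ u : EuclideanSpace ℝ (Fin n), 0 < 1 / √(1 + ‖u‖ ^ 2) := fun u => by positivity
  have hfm : Measurable f := by fun_prop
  have hCP : C R ⊆ {u | Hyp.lift u ∈ P.carrier} := by
    intro u hu i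
    obtain ⟨hu1, hu2⟩ := hC.1 hu
    have hu0 : 0 < ‖u‖ := by linarith
    have hin : (‖u‖)⁻¹ • (Hyp.lift u).1 ∈ Metric.ball ((1, θ) : Mink n) ρ := by
      rw [Metric.mem_ball, Prod.dist_eq, max_lt_iff]
      constructor
      · change dist ((‖u‖)⁻¹ * √(1 + ‖u‖ ^ 2)) 1 < ρ
        have h1 : ‖u‖ ≤ √(1 + ‖u‖ ^ 2) := Real.le_sqrt_of_sq_le (by linarith)
        have h2 : √(1 + ‖u‖ ^ 2) ≤ ‖u‖ + (‖u‖)⁻¹ := by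
          rw [Real.sqrt_le_left (by positivity)]
          have e : (‖u‖ + (‖u‖)⁻¹) ^ 2 = ‖u‖ ^ 2 + 2 + (‖u‖)⁻¹ ^ 2 := by field_simp; ring
          rw [e]
          nlinarith [sq_nonneg (‖u‖)⁻¹]
        have h3 : 1 / ρ < ‖u‖ := (le_max_right _ _).trans_lt hu1
        have h4 : (‖u‖)⁻¹ < ρ := by
          rw [inv_lt_comm₀ hu0 hρ, ← one_div]; exact h3
        have h5 : (‖u‖)⁻¹ ≤ 1 := inv_le_one_of_one_le₀ (by linarith)
        have h6 : 0 < (‖u‖)⁻¹ := inv_pos.2 hu0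
        have h7 : (‖u‖)⁻¹ * ‖u‖ = 1 := inv_mul_cancel₀ hu0.ne'
        rw [Real.dist_eq, abs_lt]
        constructor <;> nlinarith
      · change dist ((‖u‖)⁻¹ • u) θ < ρ
        have h : (‖u‖)⁻¹ • u - θ = (‖u‖)⁻¹ • (u - ‖u‖ • θ) := by
          rw [smul_sub, smul_smul, inv_mul_cancel₀ hu0.ne', one_smul]
        rw [dist_eq_norm, h, norm_smul, norm_inv, norm_norm, inv_mul_lt_iff₀ hu0, mul_comm]
        exact hu2
    have h := hball hin i
    rw [lor_smul_left] at h
    exact (neg_of_mul_neg_right h (inv_pos.2 hu0).le).le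
  have hfin : ∫⁻ u in C R, f u < ∞ := (lintegral_mono_set hCP).trans_lt hvol
  have hsub : C (2 * R) ⊆ C R := fun u hu =>
    hC.2 ⟨by linarith [(hC.1 hu).1], (hC.1 hu).2⟩
  have hpre : (fun u : EuclideanSpace ℝ (Fin n) => (2 : ℝ) • u) ⁻¹' C (2 * R) = C R := by
    ext u
    simp only [C, Set.mem_preimage, Set.mem_inter_iff, Set.mem_ofPred_eq, norm_smul, Real.norm_ofNat]
    have h : (2 : ℝ) • u - (2 * ‖u‖) • θ = (2 : ℝ) • (u - ‖u‖ • θ) := by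
      rw [smul_sub, smul_smul]
    rw [h, norm_smul, Real.norm_ofNat]
    constructor
    · rintro ⟨h1, h2⟩; exact ⟨by linarith, by linarith⟩
    · rintro ⟨h1, h2⟩; exact ⟨by linarith, by linarith⟩
  have hscale : ENNReal.ofReal |(2 ^ n : ℝ)⁻¹| * ∫⁻ u in C (2 * R), f u =
      ∫⁻ u in C R, f ((2 : ℝ) • u) := by
    have h := setLIntegral_map (μ := (volume : Measure (EuclideanSpace ℝ (Fin n))))
      (hCo (2 * R)).measurableSet hfm (measurable_const_smul (2 : ℝ))
    rw [Measure.map_addHaar_smul _ two_ne_zero, Measure.restrict_smul, lintegral_smul_measure,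
      hpre, finrank_euclideanSpace_fin] at h
    exact h
  have h2 : ∀ x : ℝ, 2 * ENNReal.ofReal x = ENNReal.ofReal (2 * x) := fun x => by
    rw [ENNReal.ofReal_mul (by norm_num), ENNReal.ofReal_ofNat]
  have hcmp : ∫⁻ u in C R, f u ≤ 2 * ∫⁻ u in C R, f ((2 : ℝ) • u) := by
    rw [← lintegral_const_mul _ (f := fun u => f ((2 : ℝ) • u))
      (hfm.comp (measurable_const_smul (2 : ℝ)))]
    refine lintegral_mono fun u => ?_
    change ENNReal.ofReal _ ≤ 2 * ENNReal.ofReal _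
    rw [h2]
    refine ENNReal.ofReal_le_ofReal ?_
    rw [norm_smul, Real.norm_ofNat, mul_one_div, div_le_div_iff₀ (by positivity) (by positivity),
      one_mul, Real.sqrt_le_left (by positivity), mul_pow, mul_pow, Real.sq_sqrt (by positivity)]
    nlinarith [sq_nonneg ‖u‖]
  -- Doubling maps `C R` onto `C (2 * R)`, multiplies Lebesgue measure by `2 ^ n` and at worst
  -- halves the density. As `n ≥ 1` the volume does not decrease, so finiteness would make the open
  -- shell between the two cones null.
  have hle : ∫⁻ u in C R, f u ≤ ∫⁻ u in C (2 * R), f u := by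
    refine hcmp.trans ?_
    rw [← hscale, ← mul_assoc]
    refine mul_le_of_le_one_left' ?_
    rw [h2, ← ENNReal.ofReal_one]
    refine ENNReal.ofReal_le_ofReal ?_
    rw [abs_of_pos (by positivity), ← div_eq_mul_inv, div_le_one (by positivity)]
    exact le_self_pow₀ one_le_two hn
  have hsplit : (∫⁻ u in C (2 * R), f u) + ∫⁻ u in C R \ C (2 * R), f u = ∫⁻ u in C R, f u := by
    have h := lintegral_inter_add_sdiff (μ := volume) f (C R) (hCo (2 * R)).measurableSet
    rwa [Set.inter_eq_right.2 hsub] at h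
  have hzero : ∫⁻ u in C R \ C (2 * R), f u = 0 := by
    have h : (∫⁻ u in C (2 * R), f u) + ∫⁻ u in C R \ C (2 * R), f u ≤
        (∫⁻ u in C (2 * R), f u) + 0 := by rw [hsplit, add_zero]; exact hle
    have := (ENNReal.add_le_add_iff_left
      ((lintegral_mono_set hsub).trans_lt hfin).ne).1 h
    exact le_antisymm this zero_le
  have hO : IsOpen (C R ∩ {u | ‖u‖ < 2 * R}) :=
    (hCo R).inter (isOpen_lt continuous_norm continuous_const)
  have hne : (C R ∩ {u | ‖u‖ < 2 * R}).Nonempty := by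
    have e : ‖(3 / 2 * R) • θ‖ = 3 / 2 * R := by
      rw [norm_smul, hθn, Real.norm_of_nonneg (by positivity), mul_one]
    refine ⟨(3 / 2 * R) • θ, hC.2 ⟨?_, ?_⟩, ?_⟩
    · rw [e]; linarith
    · rw [e, sub_self, norm_zero]; positivity
    · change ‖_‖ < _
      rw [e]; linarith
  have hμ := hO.measure_pos volume hne
  have hsub' : C R ∩ {u | ‖u‖ < 2 * R} ⊆ C R \ C (2 * R) := fun u hu =>
    ⟨hu.1, fun h => lt_asymm (hC.1 h).1 hu.2⟩
  have : 0 < ∫⁻ u in C R \ C (2 * R), f u := by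
    rw [setLIntegral_pos_iff hfm]
    refine hμ.trans_le (measure_mono fun u hu => ⟨?_, hsub' hu⟩)
    exact (ENNReal.ofReal_pos.2 (hpos u)).ne'
  exact this.ne' hzero

/-- The closed cone over a polytope of finite volume contains no spacelike vectors. -/
theorem lor_self_nonpos (hvol : P.HasFiniteVolume) {x : Mink n}
    (hx : ∀ i, lor x (P.normal i) ≤ 0) : lor x x ≤ 0 := by
  by_contra! ha
  set a := lor x x
  set b := lor x P.center.1 with hb
  have hsq : √(b ^ 2 + a) ^ 2 = b ^ 2 + a := Real.sq_sqrt (by positivity)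
  have hsp : 0 < √(b ^ 2 + a) := Real.sqrt_pos.2 (by positivity)
  -- The positive root of `a + 2 s b - s ^ 2 = 0`, which makes `x + s • center` lightlike and
  -- strictly inside all walls.
  set s := b + √(b ^ 2 + a) with hs
  have hs0 : 0 < s := by
    have : |b| < √(b ^ 2 + a) := by
      rw [← Real.sqrt_sq_eq_abs]; exact Real.sqrt_lt_sqrt (sq_nonneg b) (by linarith)
    linarith [neg_abs_le b]
  have hw : lor (x + s • P.center.1) (x + s • P.center.1) = 0 := by
    simp only [lor_add_left, lor_add_right, lor_smul_left, lor_smul_right, P.center.2.1,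
      lor_comm P.center.1 x]
    rw [← hb]
    change a + s * b + s * (b + s * -1) = 0
    nlinarith
  have hw0 : 0 < (x + s • P.center.1).1 := by
    refine time_pos_of_lor_neg P.center _ hw.le ?_
    rw [lor_add_right, lor_smul_right, P.center.2.1, lor_comm, ← hb]
    linarith
  obtain ⟨i, hi⟩ := P.exists_lor_nonneg_of_light hvol ⟨_, hw, hw0⟩
  change 0 ≤ lor (x + s • P.center.1) _ at hi
  rw [lor_add_left, lor_smul_left] at hi
  nlinarith [hx i, mul_neg_of_pos_of_neg hs0 (P.center_lt i)]

/-- The facets incident to a lightlike vector. -/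
def inc (v : Light n) : Set (Fin P.m) := {i | lor v.1 (P.normal i) = 0}

variable {P}

/-- Incident walls do not see the multiple of `v`; the others are strictly negative on `v` and win
for large `T`. -/
theorem exists_add_mem {v : Light n} (hv : v.1 ∈ P.cone) {u : Mink n}
    (hu : ∀ i ∈ P.inc v, lor u (P.normal i) ≤ 0) :
    ∃ T : ℝ, 0 < T ∧ ∀ i, lor (T • v.1 + u) (P.normal i) ≤ 0 := by
  have h : ∀ᶠ T : ℝ in Filter.atTop, ∀ i, lor (T • v.1 + u) (P.normal i) ≤ 0 := by
    rw [Filter.eventually_all]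
    intro i
    simp only [lor_add_left, lor_smul_left]
    rcases (hv.2 i).eq_or_lt with h0 | h0
    · refine Filter.Eventually.of_forall fun T => ?_
      rw [h0, mul_zero, zero_add]
      exact hu i h0
    · filter_upwards [Filter.eventually_ge_atTop (lor u (P.normal i) / -lor v.1 (P.normal i))]
        with T hT
      rw [div_le_iff₀ (by linarith)] at hT
      linarith
  obtain ⟨T, hT, hT0⟩ := (h.and (Filter.eventually_gt_atTop 0)).exists
  exact ⟨T, hT0, hT⟩

/-- Adding a multiple of `v` to a vector orthogonal to `v` does not change its square. Since the
form is semidefinite on this complement, the link is bounded. -/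
theorem lor_self_nonpos_of_inc (hvol : P.HasFiniteVolume) {v : Light n} (hv : v.1 ∈ P.cone)
    {u : Mink n} (huv : lor u v.1 = 0) (hu : ∀ i ∈ P.inc v, lor u (P.normal i) ≤ 0) :
    lor u u ≤ 0 := by
  obtain ⟨T, -, hT⟩ := exists_add_mem hv hu
  have := P.lor_self_nonpos hvol hT
  simp only [lor_add_left, lor_add_right, lor_smul_left, lor_smul_right, v.2.1, huv,
    lor_comm v.1 u] at this
  linarith

/-- The sum of the normals is orthogonal to `v`, so its square is nonnegative; it is also at most `2
- 2 = 0`. Hence the sum is a multiple of `v`, and the centre determines the sign. -/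
theorem opposite {v : Light n} {i j : Fin P.m} (hi : i ∈ P.inc v) (hj : j ∈ P.inc v)
    (hle : lor (P.normal i) (P.normal j) ≤ -1) :
    ∃ c : ℝ, 0 < c ∧ P.normal j = -P.normal i + c • v.1 := by
  have hvs : lor (P.normal i + P.normal j) v.1 = 0 := by
    rw [lor_add_left, lor_comm, hi, lor_comm (P.normal j), hj, add_zero]
  have h0 := lor_self_nonneg_of_light v hvs
  have h1 : lor (P.normal i + P.normal j) (P.normal i + P.normal j) =
      2 + 2 * lor (P.normal i) (P.normal j) := by
    simp only [lor_add_left, lor_add_right, P.unit, lor_comm (P.normal j) (P.normal i)]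
    ring
  obtain ⟨c, hc⟩ := eq_smul_of_light v hvs (by linarith)
  refine ⟨c, ?_, by rw [← hc]; abel⟩
  have h2 : lor P.center.1 (P.normal i + P.normal j) < 0 := by
    rw [lor_add_right]; linarith [P.center_lt i, P.center_lt j]
  have h3 := v.isCausal.lor_hyp_neg P.center
  rw [hc, lor_smul_right, lor_comm] at h2
  by_contra! hc0
  nlinarith

/-- The facets at an ideal vertex come in opposite pairs. -/
theorem exists_opposite (hP : P.IsRightAngled) (hvol : P.HasFiniteVolume) {v : Light n}
    (hv : v.1 ∈ P.cone) {i : Fin P.m} (hi : i ∈ P.inc v) :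
    ∃ j ∈ P.inc v, ∃ c : ℝ, 0 < c ∧ P.normal j = -P.normal i + c • v.1 := by
  by_contra! hc
  -- Without an opposite facet, `-normal i` would be a spacelike vector satisfying all incident
  -- inequalities.
  have := lor_self_nonpos_of_inc hvol hv (u := -P.normal i)
    (by rw [lor_neg_left, lor_comm, hi, neg_zero]) (fun j hj => by
      rw [lor_neg_left]
      by_cases hij : j = i
      · rw [hij, P.unit]; norm_num
      · rcases P.lor_normal_cases hP (Ne.symm hij) with h | h
        · rw [h, neg_zero]
        · obtain ⟨c, hc0, hce⟩ := opposite hi hj h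
          exact absurd hce (hc j hj c hc0))
  rw [lor_neg_left, lor_neg_right, P.unit] at this
  norm_num at this

theorem exists_inc (hvol : P.HasFiniteVolume) {v : Light n} (hv : v.1 ∈ P.cone) :
    (P.inc v).Nonempty := by
  obtain ⟨i, hi⟩ := P.exists_lor_nonneg_of_light hvol v
  exact ⟨i, le_antisymm (hv.2 i) hi⟩

/-- The link of an ideal vertex is compact. -/
theorem exists_link_bound (hvol : P.HasFiniteVolume) {v : Light n} (hv : v.1 ∈ P.cone) :
    ∃ δ : ℝ, 0 < δ ∧ ∀ u : Mink n, u.1 = 0 → (∀ i ∈ P.inc v, lor u (P.normal i) ≤ 0) →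
      δ * ‖u‖ ≤ -lor u v.1 := by
  set S := {u : Mink n | ‖u‖ = 1 ∧ u.1 = 0 ∧ ∀ i ∈ P.inc v, lor u (P.normal i) ≤ 0} with hS
  have hcl : IsClosed S := by
    simp only [hS, Set.ofPred_and, Set.ofPred_forall]
    refine (isClosed_eq continuous_norm continuous_const).inter
      ((isClosed_eq continuous_fst continuous_const).inter ?_)
    exact isClosed_iInter fun i => isClosed_iInter fun _ =>
      isClosed_le (continuous_id.lor continuous_const) continuous_const
  have hcpt : IsCompact S := (isCompact_closedBall (0 : Mink n) 1).of_isClosed_subset hcl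
    fun u hu => by rw [mem_closedBall_zero_iff]; exact hu.1.le
  have hpos : ∀ u ∈ S, 0 < -lor u v.1 := by
    rintro u ⟨h1, h2, h3⟩
    -- Vectors with time coordinate 0 represent Minkowski space modulo `v` and are spacelike. As `T
    -- • v + u` is not spacelike, its cross term `2 T (lor u v)` must be negative.
    obtain ⟨T, hT0, hT⟩ := exists_add_mem hv h3
    have h4 := P.lor_self_nonpos hvol hT
    simp only [lor_add_left, lor_add_right, lor_smul_left, lor_smul_right, v.2.1,
      lor_comm v.1 u] at h4
    have h5 : 0 < lor u u := by
      simp only [lor, h2, real_inner_self_eq_norm_sq]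
      have : u.2 ≠ 0 := by
        rintro h
        have : u = 0 := Prod.ext h2 h
        rw [this, norm_zero] at h1
        exact zero_ne_one h1
      have := pow_pos (norm_pos_iff.2 this) 2
      linarith
    by_contra! hc
    nlinarith [mul_nonneg hT0.le (show 0 ≤ lor u v.1 by linarith)]
  have hδ : ∃ δ : ℝ, 0 < δ ∧ ∀ u ∈ S, δ ≤ -lor u v.1 := by
    rcases S.eq_empty_or_nonempty with he | hne
    · exact ⟨1, one_pos, fun u hu => absurd hu (by rw [he]; exact Set.notMem_empty u)⟩
    · obtain ⟨u₀, hu₀, hmin⟩ := hcpt.exists_isMinOn hne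
        (f := fun u => -lor u v.1) (continuous_id.lor continuous_const).neg.continuousOn
      exact ⟨_, hpos u₀ hu₀, fun u hu => hmin hu⟩
  obtain ⟨δ, hδ0, hδ⟩ := hδ
  refine ⟨δ, hδ0, fun u h1 h2 => ?_⟩
  by_cases hu : u = 0
  · simp [hu]
  have hn : 0 < ‖u‖ := norm_pos_iff.2 hu
  have := hδ ((‖u‖)⁻¹ • u) ⟨by rw [norm_smul, norm_inv, norm_norm, inv_mul_cancel₀ hn.ne'],
    by simp [h1], fun i hi => by
      rw [lor_smul_left]
      exact mul_nonpos_of_nonneg_of_nonpos (inv_nonneg.2 hn.le) (h2 i hi)⟩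
  rw [lor_smul_left, ← mul_neg, inv_mul_eq_div, le_div_iff₀ hn] at this
  exact this

/-- The decomposition of a point along a lightlike vector. -/
theorem exists_decomp {v : Light n} (y : Hyp n) :
    ∃ u : Mink n, u.1 = 0 ∧ y.1 = (y.1.1 / v.1.1) • v.1 + u ∧ lor u v.1 = lor y.1 v.1 ∧
      ∀ i ∈ P.inc v, lor u (P.normal i) = lor y.1 (P.normal i) := by
  refine ⟨y.1 - (y.1.1 / v.1.1) • v.1, ?_, by abel, ?_, fun i hi => ?_⟩
  · simp [v.2.2.ne']
  · rw [lor_sub_left, lor_smul_left, v.2.1]; ring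
  · rw [lor_sub_left, lor_smul_left, hi]; ring

theorem _root_.HypCusp.Hyp.one_le_time (y : Hyp n) : 1 ≤ y.1.1 := by
  have h := one_le_neg_lor y (Hyp.base n)
  simpa [lor, Hyp.base] using h

/-- A sufficiently small horoball at an ideal vertex meets only the incident facets. -/
theorem exists_horoball_lt (hvol : P.HasFiniteVolume) {v : Light n} (hv : v.1 ∈ P.cone) :
    ∃ τ : ℝ, 0 < τ ∧ ∀ y : Hyp n, (∀ i ∈ P.inc v, lor y.1 (P.normal i) ≤ 0) →
      -lor y.1 v.1 ≤ τ → ∀ k ∉ P.inc v, lor y.1 (P.normal k) < 0 := by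
  obtain ⟨δ, hδ, hb⟩ := exists_link_bound hvol hv
  have hv0 := v.2.2
  -- For `y = (y₀ / v₀) v + u` the link bound gives `‖u‖ ≤ τ / δ`, and `y₀ ≥ 1`; this expression
  -- bounds the product of `y` with normal `k`.
  have h : ∀ᶠ τ : ℝ in nhdsWithin 0 (Set.Ioi 0), ∀ k, k ∉ P.inc v →
      ‖(P.normal k).2‖ * (τ / δ) + lor v.1 (P.normal k) / v.1.1 < 0 := by
    rw [Filter.eventually_all]
    intro k
    by_cases hk : k ∈ P.inc v
    · exact Filter.Eventually.of_forall fun _ h => absurd hk h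
    have hlt : lor v.1 (P.normal k) < 0 := lt_of_le_of_ne (hv.2 k) hk
    have hc : Continuous fun τ : ℝ =>
        ‖(P.normal k).2‖ * (τ / δ) + lor v.1 (P.normal k) / v.1.1 := by fun_prop
    have := (hc.tendsto 0).eventually_lt_const
      (show ‖(P.normal k).2‖ * (0 / δ) + lor v.1 (P.normal k) / v.1.1 < 0 by
        rw [zero_div, mul_zero, zero_add]; exact div_neg_of_neg_of_pos hlt hv0)
    exact (this.filter_mono nhdsWithin_le_nhds).mono fun τ h _ => h
  obtain ⟨τ, hτ, hτ0⟩ := (h.and self_mem_nhdsWithin).exists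
  refine ⟨τ, hτ0, fun y hy hyτ k hk => ?_⟩
  obtain ⟨u, hu0, hyu, huv, hui⟩ := exists_decomp (P := P) (v := v) y
  have h1 := hb u hu0 fun i hi => (hui i hi).trans_le (hy i hi)
  rw [huv] at h1
  have h2 : ‖u‖ ≤ τ / δ := by rw [le_div_iff₀ hδ]; linarith
  have h3 : lor u (P.normal k) ≤ ‖(P.normal k).2‖ * (τ / δ) := by
    have := real_inner_le_norm u.2 (P.normal k).2
    have h4 : ‖u.2‖ ≤ ‖u‖ := norm_snd_le u
    simp only [lor, hu0]
    nlinarith [norm_nonneg (P.normal k).2]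
  have h5 : y.1.1 / v.1.1 * lor v.1 (P.normal k) ≤ lor v.1 (P.normal k) / v.1.1 := by
    rw [div_mul_eq_mul_div, div_le_div_iff_of_pos_right hv0]
    nlinarith [y.one_le_time, hv.2 k]
  rw [hyu, lor_add_left, lor_smul_left]
  linarith [hτ k hk]

theorem subRefl_apply {v : Light n} {g : Isom n} (hg : g ∈ P.subRefl (P.inc v)) :
    g.1 v.1 = v.1 := by
  refine P.subRefl_induction (p := fun g => g.1 v.1 = v.1) rfl (fun i hi g _ h => ?_) hg
  rw [Isom.mul_apply, h, s_apply, hi]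
  module

/-- Precisely invariant horoballs at the ideal vertices. -/
theorem exists_horoball (hP : P.IsRightAngled) (hvol : P.HasFiniteVolume) {v : Light n}
    (hv : v.1 ∈ P.cone) : ∃ τ : ℝ, 0 < τ ∧ ∀ g ∈ P.reflectionGroup, ∀ x : Hyp n,
      -lor x.1 v.1 ≤ τ → -lor (g • x).1 v.1 ≤ τ → g.1 v.1 = v.1 := by
  obtain ⟨τ, hτ, hH⟩ := exists_horoball_lt hvol hv
  refine ⟨τ, hτ, fun g hg x hx hgx => ?_⟩
  -- Reflections in the incident walls preserve the horoball and bring its points into `P`, off all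
  -- other walls.
  have key : ∀ x : Hyp n, -lor x.1 v.1 ≤ τ → ∃ h ∈ P.subRefl (P.inc v), (h • x) ∈ P.carrier ∧
      ∀ k ∉ P.inc v, lor (h • x).1 (P.normal k) < 0 := by
    intro x hx
    obtain ⟨h, hh, hxI⟩ := P.exists_subRefl_smul hP (P.inc v) x
    have hlt := hH (h • x) hxI (by
      rw [Isom.coe_smul_hyp]
      nth_rw 1 [← subRefl_apply hh]
      rwa [h.lor_map])
    refine ⟨h, hh, fun i => ?_, hlt⟩
    by_cases hi : i ∈ P.inc v
    · exact hxI i hi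
    · exact (hlt i hi).le
  obtain ⟨h, hh, hxP, hxl⟩ := key x hx
  obtain ⟨h', hh', hxP', -⟩ := key (g • x) hgx
  have hm : h' * g * h⁻¹ ∈ P.reflectionGroup :=
    mul_mem (mul_mem (P.subRefl_le _ hh') hg) (inv_mem (P.subRefl_le _ hh))
  have he : (h' * g * h⁻¹).1 (h • x).1 = (h' • g • x).1 := by
    rw [← Isom.coe_smul_hyp, mul_smul, mul_smul, inv_smul_smul]
  have h2 := (P.eq_of_mem_cone hP (P.mem_cone_of_hyp hxP) hm
    (by rw [he]; exact P.mem_cone_of_hyp hxP')).2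
  -- The element carries a point of `P` to a point of `P`, so it is a product of reflections in
  -- walls through that point, all incident to `v`.
  have h3 : h' * g * h⁻¹ ∈ P.subRefl (P.inc v) :=
    Subgroup.closure_mono (Set.image_mono fun k hk => by
      by_contra hc
      exact (hxl k hc).ne hk) h2
  have h4 : g ∈ P.subRefl (P.inc v) := by
    have := mul_mem (mul_mem (inv_mem hh') h3) hh
    simpa [mul_assoc] using this
  exact subRefl_apply h4

/-- A sequence in the polytope which leaves all bounded sets enters every horoball at some ideal
vertex. -/
theorem exists_cusp_of_unbounded (hvol : P.HasFiniteVolume) {y : ℕ → Hyp n}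
    (hy : ∀ k, y k ∈ P.carrier)
    (hlim : Filter.Tendsto (fun k => (y k).1.1) Filter.atTop Filter.atTop) :
    ∃ v : Light n, v.1 ∈ P.cone ∧ ∀ τ > 0, ∀ N : ℕ, ∃ k ≥ N, -lor (y k).1 v.1 ≤ τ := by
  have hball : ∀ k, ((y k).1.1)⁻¹ • (y k).1 ∈ Metric.closedBall (0 : Mink n) 1 := by
    intro k
    have h0 := (y k).2.2
    have : ‖(y k).1‖ ≤ (y k).1.1 := by
      rw [Prod.norm_def, max_le_iff]
      exact ⟨(Real.norm_of_nonneg h0.le).le, (y k).isCausal.norm_le⟩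
    rw [mem_closedBall_zero_iff, norm_smul, norm_inv, Real.norm_of_nonneg h0.le,
      inv_mul_le_iff₀ h0, mul_one]
    exact this
  obtain ⟨w, -, σ, hσ, hw⟩ := (isCompact_closedBall (0 : Mink n) 1).tendsto_subseq hball
  have hσlim := hlim.comp hσ.tendsto_atTop
  have hinv : Filter.Tendsto (fun k => ((y (σ k)).1.1)⁻¹) Filter.atTop (nhds 0) :=
    tendsto_inv_atTop_zero.comp hσlim
  have hw1 : w.1 = 1 := by
    refine tendsto_nhds_unique hw.fst_nhds ?_
    refine tendsto_const_nhds.congr fun k => ?_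
    exact (inv_mul_cancel₀ (y (σ k)).2.2.ne').symm
  have hww : lor w w = 0 := by
    refine tendsto_nhds_unique (tendsto_lor hw hw) ?_
    have h := (hinv.mul hinv).neg
    rw [mul_zero, neg_zero] at h
    refine h.congr fun k => ?_
    rw [Function.comp_apply, lor_smul_left, lor_smul_right, (y (σ k)).2.1]
    ring
  have hwP : ∀ i, lor w (P.normal i) ≤ 0 := fun i =>
    le_of_tendsto' (tendsto_lor hw tendsto_const_nhds) fun k => by
      rw [Function.comp_apply, lor_smul_left]
      exact mul_nonpos_of_nonneg_of_nonpos (inv_nonneg.2 (y (σ k)).2.2.le) (hy _ i)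
  let v : Light n := ⟨w, hww, by rw [hw1]; exact one_pos⟩
  have hv : v.1 ∈ P.cone := ⟨v.isCausal, hwP⟩
  refine ⟨v, hv, fun τ hτ N => ?_⟩
  obtain ⟨δ, hδ, hb⟩ := exists_link_bound hvol hv
  have h1 : ∀ᶠ k in Filter.atTop, ‖((y (σ k)).1.1)⁻¹ • (y (σ k)).1 - w‖ < δ :=
    (tendsto_iff_norm_sub_tendsto_zero.1 hw).eventually_lt_const hδ
  have h2 : ∀ᶠ k in Filter.atTop, ((y (σ k)).1.1)⁻¹ < τ := hinv.eventually_lt_const hτ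
  obtain ⟨k, hk1, hk2, hkN⟩ := (h1.and (h2.and (Filter.eventually_ge_atTop N))).exists
  refine ⟨σ k, hkN.trans hσ.le_apply, ?_⟩
  set z := y (σ k)
  obtain ⟨u, hu0, hyu, huv, hui⟩ := exists_decomp (P := P) (v := v) z
  have hz0 := z.2.2
  have hv1 : v.1.1 = 1 := hw1
  rw [hv1, div_one] at hyu
  have hbu := hb u hu0 fun i hi => (hui i hi).trans_le (hy _ i)
  have hun : ‖u‖ < δ * z.1.1 := by
    have e : ((z.1.1)⁻¹ • z.1 - w) = (z.1.1)⁻¹ • u := by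
      nth_rw 2 [hyu]
      rw [smul_add, smul_smul, inv_mul_cancel₀ hz0.ne', one_smul]
      change w + _ - w = _
      abel
    rw [e, norm_smul, norm_inv, Real.norm_of_nonneg hz0.le, inv_mul_lt_iff₀ hz0] at hk1
    linarith
  have huu : lor u u ≤ ‖u‖ ^ 2 := by
    have h4 : ‖u.2‖ ≤ ‖u‖ := norm_snd_le u
    simp only [lor, hu0, real_inner_self_eq_norm_sq]
    nlinarith [norm_nonneg u.2]
  have hzz := z.2.1
  nth_rw 1 [hyu] at hzz
  nth_rw 2 [hyu] at hzz
  simp only [lor_add_left, lor_add_right, lor_smul_left, lor_smul_right, v.2.1,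
    lor_comm v.1 u] at hzz
  rw [← huv]
  -- Write `t` for the time of `z`. From `lor z z = -1`, `2 t (-lor u v) = 1 + lor u u`, and `lor u
  -- u ≤ ‖u‖² ≤ δ t ‖u‖ ≤ t (-lor u v)`, so half of the left side is absorbed.
  have h5 : z.1.1 * (-lor u v.1) ≤ 1 := by
    nlinarith [norm_nonneg u, mul_le_mul_of_nonneg_left hbu hz0.le,
      mul_le_mul_of_nonneg_left hun.le (norm_nonneg u)]
  have h6 : -lor u v.1 ≤ (z.1.1)⁻¹ := by
    rw [← one_div, le_div_iff₀ hz0]; linarith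
  exact h6.trans hk2.le

end Polytope

/-! ### Parabolic isometries -/

section parabolic
variable {n : ℕ}

theorem Light.ideal_eq_iff {v w : Light n} :
    v.ideal = w.ideal ↔ ∃ t : ℝ, 0 < t ∧ w.1 = t • v.1 := Quotient.eq

theorem eq_zero_of_light_time {u : Mink n} (h : lor u u = 0) (h0 : u.1 = 0) : u = 0 := by
  simp only [lor, real_inner_self_eq_norm_sq, h0] at h
  refine Prod.ext h0 (norm_eq_zero.1 ?_)
  have : ‖u.2‖ ^ 2 = 0 := by linarith
  simpa using this

/-- An isometry which scales a lightlike vector also scales another one by the inverse factor. -/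
theorem exists_light_eigenvector {g : Isom n} {w : Light n} {t : ℝ} (ht : 0 < t) (ht1 : t ≠ 1)
    (hg : w.1 = t • g.1 w.1) : ∃ u : Light n, g.1 u.1 = t • u.1 := by
  let f : Mink n →ₗ[ℝ] Mink n := (g.1 : Mink n →ₗ[ℝ] Mink n) - t • LinearMap.id
  have hf : ∀ x, f x = g.1 x - t • x := fun x => rfl
  -- The image of `g - t` lies in the complement of `w`, so `t` is an eigenvalue; being different
  -- from `±1`, it has lightlike eigenvectors.
  have horth : ∀ x, lor (f x) w.1 = 0 := by
    intro x
    rw [hf, lor_sub_left, lor_smul_left]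
    nth_rw 1 [hg]
    rw [lor_smul_right, g.lor_map, sub_self]
  have hinj : ¬ Function.Injective f := by
    intro h
    obtain ⟨x, hx⟩ := LinearMap.injective_iff_surjective.1 h (Hyp.base n).1
    have h1 := horth x
    rw [hx, lor_comm] at h1
    exact (w.isCausal.lor_hyp_neg (Hyp.base n)).ne h1
  rw [← LinearMap.ker_eq_bot, Submodule.eq_bot_iff] at hinj
  push Not at hinj
  obtain ⟨u, hu, hu0⟩ := hinj
  rw [LinearMap.mem_ker, hf, sub_eq_zero] at hu
  have huu : lor u u = 0 := by
    have h := g.lor_map u u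
    rw [hu, lor_smul_left, lor_smul_right] at h
    have h1 : (t - 1) * ((t + 1) * lor u u) = 0 := by linarith
    have h2 := (mul_eq_zero.1 h1).resolve_left (sub_ne_zero.2 ht1)
    exact (mul_eq_zero.1 h2).resolve_left (by positivity)
  rcases lt_trichotomy u.1 0 with h | h | h
  · refine ⟨⟨-u, by rw [lor_neg_left, lor_neg_right, huu]; simp, by simpa using h⟩, ?_⟩
    change g.1 (-u) = t • -u
    rw [map_neg, hu, smul_neg]
  · exact absurd (eq_zero_of_light_time huu h) hu0
  · exact ⟨⟨u, huu, h⟩, hu⟩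

/-- If the fixed ray were rescaled, there would be a light eigenvector for the inverse factor.
Uniqueness of the fixed ideal point puts it on the same ray, so the factor equals its inverse. -/
theorem IsParabolicAt.apply_light {g : Isom n} {w : Light n} (hg : IsParabolicAt g w.ideal) :
    g.1 w.1 = w.1 := by
  have h := (hg.2 w.ideal).2 rfl
  rw [Isom.smul_ideal, Light.ideal_eq_iff] at h
  obtain ⟨t, ht, hw⟩ := h
  rw [Isom.coe_smul_light] at hw
  by_cases ht1 : t = 1
  · rw [ht1, one_smul] at hw; exact hw.symm
  exfalso
  obtain ⟨u, hu⟩ := exists_light_eigenvector ht ht1 hw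
  have h1 : g • u.ideal = u.ideal := by
    rw [Isom.smul_ideal, eq_comm, Light.ideal_eq_iff]
    exact ⟨t, ht, hu⟩
  have h2 := ((hg.2 _).1 h1).symm
  rw [Light.ideal_eq_iff] at h2
  obtain ⟨r, hr, hur⟩ := h2
  rw [hur, map_smul, smul_comm] at hu
  have h3 : g.1 w.1 = t • w.1 := smul_right_injective _ hr.ne' hu
  rw [h3, smul_smul] at hw
  have h4 := congrArg Prod.fst hw
  simp only [Prod.smul_fst, smul_eq_mul] at h4
  have h5 := w.2.2
  have h6 : t * t = 1 := by
    have : (t * t - 1) * w.1.1 = 0 := by linarith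
    linarith [(mul_eq_zero.1 this).resolve_right h5.ne']
  have : (t - 1) * (t + 1) = 0 := by linarith
  rcases mul_eq_zero.1 this with h | h
  · exact ht1 (by linarith)
  · linarith

/-- The displacement of an isometry which fixes a lightlike vector tends to `0` along a ray. -/
theorem exists_tendsto_displacement {g : Isom n} {w : Light n} (hg : g.1 w.1 = w.1) :
    ∃ x : ℕ → Hyp n, Filter.Tendsto (fun k => dist (x k) (g • x k)) Filter.atTop (nhds 0) := by
  let x₀ := Hyp.base n
  have hL := w.isCausal.lor_hyp_neg x₀
  set L := -lor w.1 x₀.1 with hLd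
  have hL0 : 0 < L := by linarith
  have hwx : lor w.1 x₀.1 = -L := by linarith
  let s : ℕ → ℝ := fun k => 1 / ((k : ℝ) + 1)
  have hs0 : ∀ k, 0 < s k := fun k => Nat.one_div_pos_of_nat
  have hs1 : ∀ k, s k ≤ 1 := fun k => by
    rw [div_le_one (by positivity)]; linarith [Nat.cast_nonneg (α := ℝ) k]
  -- The coefficient for which `s • x₀ + b • w` has square -1. Since `g` fixes `w`, only the terms
  -- with `s ^ 2` contribute to the displacement.
  let b : ℕ → ℝ := fun k => (1 - s k ^ 2) / (2 * s k * L)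
  have hb : ∀ k, s k * b k * L = (1 - s k ^ 2) / 2 := fun k => by
    have := (hs0 k).ne'
    simp only [b]
    field_simp
  have hb0 : ∀ k, 0 ≤ b k := fun k =>
    div_nonneg (by nlinarith [hs0 k, hs1 k]) (by have := hs0 k; positivity)
  let x : ℕ → Hyp n := fun k => ⟨s k • x₀.1 + b k • w.1, by
    simp only [lor_add_left, lor_add_right, lor_smul_left, lor_smul_right, x₀.2.1, w.2.1,
      lor_comm x₀.1 w.1, hwx]
    linarith [hb k], add_pos_of_pos_of_nonneg (mul_pos (hs0 k) x₀.2.2)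
      (mul_nonneg (hb0 k) w.2.2.le)⟩
  refine ⟨x, ?_⟩
  have hlor : ∀ k, -lor (x k).1 (g • x k).1 = 1 - s k ^ 2 * (1 + lor x₀.1 (g.1 x₀.1)) := by
    intro k
    have e : (g • x k).1 = s k • g.1 x₀.1 + b k • w.1 := by
      rw [Isom.coe_smul_hyp]
      change g.1 (s k • x₀.1 + b k • w.1) = _
      rw [map_add, map_smul, map_smul, hg]
    rw [e]
    change -lor (s k • x₀.1 + b k • w.1) _ = _
    have h1 : lor w.1 (g.1 x₀.1) = -L := by
      rw [← hg, g.lor_map, hwx]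
    simp only [lor_add_left, lor_add_right, lor_smul_left, lor_smul_right, w.2.1,
      lor_comm x₀.1 w.1, hwx, h1]
    linarith [hb k]
  have hslim : Filter.Tendsto s Filter.atTop (nhds 0) := tendsto_one_div_add_atTop_nhds_zero_nat
  have hlim : Filter.Tendsto (fun k => -lor (x k).1 (g • x k).1) Filter.atTop
      (nhdsWithin 1 (Set.Ici 1)) := by
    rw [tendsto_nhdsWithin_iff]
    refine ⟨?_, Filter.Eventually.of_forall fun k => one_le_neg_lor _ _⟩
    simp only [hlor]
    have := ((hslim.pow 2).mul_const (1 + lor x₀.1 (g.1 x₀.1))).const_sub 1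
    simpa using this
  have := (Real.continuousOn_arcosh 1 (Set.mem_Ici.2 le_rfl)).tendsto.comp hlim
  rwa [Real.arcosh_zero] at this

end parabolic

/-! ### Parabolic fixed points and stabilizers of ideal vertices -/

namespace Polytope
variable {n : ℕ} {P : Polytope n}

/-- The parabolic fixed points of the reflection group are equivalent to ideal vertices. -/
theorem exists_ideal_vertex_of_parabolic (hP : P.IsRightAngled) (hvol : P.HasFiniteVolume)
    {g : Isom n} (hg : g ∈ P.reflectionGroup) {ξ : IdealPoint n} (hξ : IsParabolicAt g ξ) :
    ∃ γ ∈ P.reflectionGroup, ∃ v : Light n, v.1 ∈ P.cone ∧ ξ = γ • v.ideal := by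
  obtain ⟨w, rfl⟩ : ∃ w : Light n, w.ideal = ξ := Quotient.exists_rep ξ
  obtain ⟨x, hx⟩ := exists_tendsto_displacement hξ.apply_light
  choose h hh hxP using fun k => P.exists_smul_mem_carrier hP (x k)
  let y : ℕ → Hyp n := fun k => h k • x k
  let γ : ℕ → Isom n := fun k => h k * g * (h k)⁻¹
  have hγ : ∀ k, γ k ∈ P.reflectionGroup := fun k =>
    mul_mem (mul_mem (hh k) hg) (inv_mem (hh k))
  have hd : Filter.Tendsto (fun k => dist (y k) (γ k • y k)) Filter.atTop (nhds 0) := by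
    refine hx.congr fun k => ?_
    simp only [y, γ, mul_smul, inv_smul_smul, dist_smul]
  -- If the translates in `P` escape, they enter the invariant horoball of an ideal vertex, which
  -- the conjugates of `g` must then fix. Otherwise they accumulate, and discreteness gives `g` a
  -- fixed point in hyperbolic space.
  by_cases hlim : Filter.Tendsto (fun k => (y k).1.1) Filter.atTop Filter.atTop
  · obtain ⟨v, hv, hsmall⟩ := exists_cusp_of_unbounded hvol hxP hlim
    obtain ⟨τ, hτ, hinv⟩ := exists_horoball hP hvol hv
    have hcosh : Filter.Tendsto (fun k => Real.cosh (dist (y k) (γ k • y k))) Filter.atTop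
        (nhds 1) := by
      have := (Real.continuous_cosh.tendsto 0).comp hd
      rwa [Real.cosh_zero] at this
    obtain ⟨N, hN⟩ := Filter.eventually_atTop.1
      (hcosh.eventually_le_const (show (1 : ℝ) < 2 by norm_num))
    -- By `neg_lor_light_le` a displacement with `cosh ≤ 2` changes the height by a factor of at
    -- most 4.
    obtain ⟨k, hk, hkτ⟩ := hsmall (τ / 4) (by positivity) N
    have h2 := hN k hk
    rw [Hyp.cosh_dist, lor_comm] at h2
    have h3 := Hyp.neg_lor_light_le (γ k • y k) (y k) v
    have hkτ' : -lor (y k).1 v.1 ≤ τ / 4 := hkτ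
    have h4 : 0 ≤ -lor (y k).1 v.1 := by
      rw [lor_comm]; linarith [v.isCausal.lor_hyp_neg (y k)]
    have h5 : (γ k).1 v.1 = v.1 := by
      refine hinv _ (hγ k) (y k) (by linarith) ?_
      nlinarith
    refine ⟨(h k)⁻¹, inv_mem (hh k), v, hv, eq_comm.1 ((hξ.2 _).1 ?_)⟩
    have h6 : γ k • v.ideal = v.ideal := by
      rw [Isom.smul_ideal]; exact congrArg Light.ideal (Subtype.ext h5)
    rw [← smul_left_cancel_iff (h k), ← mul_smul, ← mul_smul, smul_inv_smul]
    exact h6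
  · exfalso
    rw [Filter.tendsto_atTop] at hlim
    push Not at hlim
    obtain ⟨C, hC⟩ := hlim
    obtain ⟨σ, hσ, hσC⟩ := Filter.extraction_of_frequently_atTop hC
    have hcpt : IsCompact {z : Hyp n | z.1.1 ≤ C} :=
      Hyp.isCompact_of_time_le (isClosed_le Hyp.continuous_time continuous_const) fun z hz => hz
    obtain ⟨z, -, ρ, hρ, hz⟩ := hcpt.tendsto_subseq fun k =>
      (show y (σ k) ∈ {z : Hyp n | z.1.1 ≤ C} from (hσC k).le)
    obtain ⟨ε, hε, hfix⟩ := P.exists_fixed_of_dist_lt hP z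
    have e1 := (tendsto_iff_dist_tendsto_zero.1 hz).eventually_lt_const
      (show (0 : ℝ) < ε / 3 by positivity)
    have e2 := (hd.comp (hσ.tendsto_atTop.comp hρ.tendsto_atTop)).eventually_lt_const
      (show (0 : ℝ) < ε / 3 by positivity)
    obtain ⟨k, hk1, hk2⟩ := (e1.and e2).exists
    set j := σ (ρ k) with hj
    simp only [Function.comp_apply, ← hj] at hk1 hk2
    have h3 : γ j • z = z := by
      refine hfix _ (hγ j) ?_
      have := dist_triangle4 z (y j) (γ j • y j) (γ j • z)
      rw [dist_smul] at this
      linarith [dist_comm z (y j)]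
    refine hξ.1 ((h j)⁻¹ • z) ?_
    rw [← smul_left_cancel_iff (h j), ← mul_smul, ← mul_smul, smul_inv_smul]
    exact h3

/-- The sign, determined by the colours, by which an element of the stabilizer of an ideal vertex
acts on the direction orthogonal to a pair of opposite facets. -/
def colSign {c : ℕ} (col : Fin P.m → Fin c) (i o : Fin P.m) (g : Isom n) : ℝ :=
  -- Opposite facets may share a colour; the finite set then has one element and that coordinate
  -- counts once.
  if ∑ x ∈ ({col i, col o} : Finset (Fin c)), P.colVec col g x = 0 then 1 else -1

/-- A facet has only one opposite: the normals of two of them would agree modulo `v`, hence have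
product 1, which `lor_normal_lt_one` excludes. -/
theorem lor_normal_eq_zero_of_opposite (hP : P.IsRightAngled) {v : Light n} {i o j : Fin P.m}
    (hi : i ∈ P.inc v) (hj : j ∈ P.inc v) {a : ℝ} (ho : P.normal o = -P.normal i + a • v.1)
    (hji : j ≠ i) (hjo : j ≠ o) : lor (P.normal i) (P.normal j) = 0 := by
  refine (P.lor_normal_cases hP hji.symm).resolve_right fun hle => ?_
  obtain ⟨b, -, hb⟩ := opposite hi hj hle
  have h := P.lor_normal_lt_one hjo
  have hiv : lor (P.normal i) v.1 = 0 := (lor_comm _ _).trans hi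
  rw [hb, ho] at h
  simp only [lor_add_left, lor_add_right, lor_neg_left, lor_neg_right, lor_smul_left,
    lor_smul_right, P.unit, v.2.1, lor_comm v.1 (P.normal i), hiv] at h
  norm_num at h

theorem s_apply_normal_opposite {v : Light n} {i o : Fin P.m} (hi : i ∈ P.inc v) {a : ℝ}
    (ho : P.normal o = -P.normal i + a • v.1) :
    (P.s o).1 (P.normal i) = -P.normal i + (2 * a) • v.1 := by
  have hiv : lor (P.normal i) v.1 = 0 := (lor_comm _ _).trans hi
  rw [s_apply, ho, lor_add_right, lor_neg_right, lor_smul_right, hiv, P.unit]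
  module

theorem s_apply_normal_self (i : Fin P.m) : (P.s i).1 (P.normal i) = -P.normal i := by
  rw [s_apply, P.unit]
  module

theorem s_apply_normal_orth {i j : Fin P.m} (h : lor (P.normal i) (P.normal j) = 0) :
    (P.s j).1 (P.normal i) = P.normal i := by
  rw [s_apply, h]
  module

/-- The action of the stabilizer of an ideal vertex on the normals of the incident facets. -/
theorem stab_apply_normal {c : ℕ} {col : Fin P.m → Fin c} (hP : P.IsRightAngled)
    (hcol : P.IsColouring col) {v : Light n} {i o : Fin P.m} (hi : i ∈ P.inc v)
    (hoi : o ∈ P.inc v) {a : ℝ} (ho : P.normal o = -P.normal i + a • v.1) {g : Isom n}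
    (hg : g ∈ P.subRefl (P.inc v)) :
    ∃ k : ℤ, g.1 (P.normal i) = colSign col i o g • P.normal i + (2 * a * k) • v.1 := by
  have hsgn : ∀ j, ∀ g ∈ P.reflectionGroup, colSign col i o (P.s j * g) =
      if col j ∈ ({col i, col o} : Finset (Fin c)) then -colSign col i o g
      else colSign col i o g := by
    intro j g hg
    have h2 : ∀ z : ZMod 2, (1 + z = 0) ↔ ¬ z = 0 := by decide
    rw [colSign, P.colVec_s_mul col hP hg]
    simp only [Pi.add_apply, Finset.sum_add_distrib, Finset.sum_pi_single']
    by_cases hm : col j ∈ ({col i, col o} : Finset (Fin c))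
    · rw [if_pos hm, if_pos hm, colSign]
      simp only [h2]
      split_ifs <;> simp_all
    · rw [if_neg hm, if_neg hm, zero_add, colSign]
  refine P.subRefl_induction (p := fun g => ∃ k : ℤ, g.1 (P.normal i) =
    colSign col i o g • P.normal i + (2 * a * k) • v.1) ?_ ?_ hg
  · refine ⟨0, ?_⟩
    simp [colSign, P.colVec_one col hP]
  · rintro j hj g hg ⟨k, hk⟩
    rw [Isom.mul_apply, hk, map_add, map_smul, map_smul,
      subRefl_apply (P.s_mem_subRefl hj), hsgn j g (P.subRefl_le _ hg)]
    by_cases hji : j = i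
    · subst hji
      refine ⟨k, ?_⟩
      rw [s_apply_normal_self, if_pos (by simp)]
      module
    by_cases hjo : j = o
    · subst hjo
      rw [s_apply_normal_opposite hi ho, if_pos (by simp)]
      by_cases h1 : colSign col i j g = 1
      · refine ⟨k + 1, ?_⟩
        rw [h1]
        push_cast
        module
      · have h1 : colSign col i j g = -1 := by
          rw [colSign] at h1 ⊢
          split_ifs at h1 ⊢ with h
          · exact absurd rfl h1
          · rfl
        refine ⟨k - 1, ?_⟩
        rw [h1]
        push_cast
        module
    -- Any other incident facet is orthogonal to both, so it meets both and its colour differs from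
    -- theirs: neither the normal nor the sign changes.
    · have horth := lor_normal_eq_zero_of_opposite hP hi hj ho hji hjo
      have horth' : lor (P.normal o) (P.normal j) = 0 := by
        rw [ho, lor_add_left, lor_neg_left, lor_smul_left, horth, hj]; ring
      have hne1 := hcol.ne_of_meet j i hji ((P.meet_iff hP hji).2 ((lor_comm _ _).trans horth))
      have hne2 := hcol.ne_of_meet j o hjo ((P.meet_iff hP hjo).2 ((lor_comm _ _).trans horth'))
      refine ⟨k, ?_⟩
      rw [s_apply_normal_orth horth, if_neg (by simp [hne1, hne2])]

theorem mem_subRefl_of_fixed (hP : P.IsRightAngled) {v : Light n} (hv : v.1 ∈ P.cone)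
    {g : Isom n} (hg : g ∈ P.reflectionGroup) (hgv : g.1 v.1 = v.1) :
    g ∈ P.subRefl (P.inc v) :=
  (P.eq_of_mem_cone hP hv hg (by rw [hgv]; exact hv)).2

/-- The zero colour vector makes the sign positive. This is why the cusps are tori rather than other
flat quotients. -/
theorem ker_apply_normal {c : ℕ} {col : Fin P.m → Fin c} (hP : P.IsRightAngled)
    (hcol : P.IsColouring col) {v : Light n} (hv : v.1 ∈ P.cone) {i o : Fin P.m}
    (hi : i ∈ P.inc v) (hoi : o ∈ P.inc v) {a : ℝ} (ho : P.normal o = -P.normal i + a • v.1)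
    {g : Isom n} (hg : g ∈ P.colKer col hP) (hgv : g.1 v.1 = v.1) :
    ∃ k : ℤ, g.1 (P.normal i) = P.normal i + (2 * a * k) • v.1 := by
  rw [mem_colKer] at hg
  obtain ⟨k, hk⟩ := stab_apply_normal hP hcol hi hoi ho (mem_subRefl_of_fixed hP hv hg.1 hgv)
  refine ⟨k, ?_⟩
  rw [hk, colSign, hg.2]
  simp

/-- The square of the product of two opposite reflections at an ideal vertex. -/
def transl (P : Polytope n) (i o : Fin P.m) : Isom n := (P.s o * P.s i) * (P.s o * P.s i)

theorem transl_mem {c : ℕ} (col : Fin P.m → Fin c) (hP : P.IsRightAngled) (i o : Fin P.m) :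
    P.transl i o ∈ P.colKer col hP := by
  have h := mul_mem (P.s_mem o) (P.s_mem i)
  rw [mem_colKer, transl, P.colVec_mul col hP h h, two_torsion]
  exact ⟨mul_mem h h, rfl⟩

theorem transl_apply_light {v : Light n} {i o : Fin P.m} (hi : i ∈ P.inc v) (ho : o ∈ P.inc v) :
    (P.transl i o).1 v.1 = v.1 := by
  have h := mul_mem (P.s_mem_subRefl ho) (P.s_mem_subRefl hi)
  exact subRefl_apply (mul_mem h h)

theorem transl_apply_normal {v : Light n} {i o : Fin P.m} (hi : i ∈ P.inc v)
    (hoi : o ∈ P.inc v) {a : ℝ} (ho : P.normal o = -P.normal i + a • v.1) :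
    (P.transl i o).1 (P.normal i) = P.normal i - (4 * a) • v.1 := by
  have hv := subRefl_apply (mul_mem (P.s_mem_subRefl hoi) (P.s_mem_subRefl hi))
  have h1 : (P.s o * P.s i).1 (P.normal i) = P.normal i - (2 * a) • v.1 := by
    rw [Isom.mul_apply, s_apply_normal_self, map_neg, s_apply_normal_opposite hi ho]
    module
  rw [transl, Isom.mul_apply, h1, map_sub, map_smul, hv, h1]
  module

theorem transl_apply_normal_orth {v : Light n} {i o j : Fin P.m} (hj : j ∈ P.inc v) {a : ℝ} (ho : P.normal o = -P.normal i + a • v.1)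
    (hij : lor (P.normal i) (P.normal j) = 0) : (P.transl i o).1 (P.normal j) = P.normal j := by
  have h1 : lor (P.normal j) (P.normal i) = 0 := (lor_comm _ _).trans hij
  have h2 : lor (P.normal j) (P.normal o) = 0 := by
    rw [ho, lor_add_right, lor_neg_right, lor_smul_right, h1, lor_comm, hj]; ring
  simp only [transl, Isom.mul_apply, s_apply_normal_orth h1, s_apply_normal_orth h2]

/-- The ideal vertices are fixed by parabolic elements of the kernel. -/
theorem exists_parabolic {c : ℕ} (col : Fin P.m → Fin c) (hP : P.IsRightAngled)
    (hvol : P.HasFiniteVolume) {v : Light n} (hv : v.1 ∈ P.cone) :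
    ∃ g ∈ P.colKer col hP, IsParabolicAt g v.ideal := by
  obtain ⟨i, hi⟩ := exists_inc hvol hv
  obtain ⟨o, ho, a, ha, he⟩ := exists_opposite hP hvol hv hi
  have hgv := transl_apply_light hi ho
  have hge := transl_apply_normal hi ho he
  -- The shift of normal `i` by a multiple of `v` confines fixed vectors to the complement of `v`,
  -- which contains no timelike vector and only one light ray.
  have key : ∀ x : Mink n, (P.transl i o).1 x = x → lor x v.1 = 0 := by
    intro x hx
    have h := (P.transl i o).lor_map x (P.normal i)
    rw [hx, hge, lor_sub_right, lor_smul_right] at h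
    have h2 : (4 * a) * lor x v.1 = 0 := by linarith
    exact (mul_eq_zero.1 h2).resolve_left (by positivity)
  refine ⟨_, transl_mem col hP i o, fun x hx => ?_, fun η => ⟨fun h => ?_, fun h => ?_⟩⟩
  · have h := key x.1 (congrArg Subtype.val hx)
    rw [lor_comm] at h
    exact (v.isCausal.lor_hyp_neg x).ne h
  · obtain ⟨w, rfl⟩ : ∃ w : Light n, w.ideal = η := Quotient.exists_rep η
    rw [Isom.smul_ideal, eq_comm, Light.ideal_eq_iff] at h
    obtain ⟨t, ht, hw⟩ := h
    rw [Isom.coe_smul_light] at hw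
    have h0 : lor w.1 v.1 = 0 := by
      have h1 := (P.transl i o).lor_map w.1 v.1
      rw [hgv, hw, lor_smul_left] at h1
      by_contra hne
      have ht1 : t = 1 := mul_right_cancel₀ hne (h1.trans (one_mul _).symm)
      rw [ht1, one_smul] at hw
      exact hne (key _ hw)
    obtain ⟨r, hr⟩ := eq_smul_of_light v h0 w.2.1
    have hr0 : 0 < r := by
      have h1 := w.2.2
      rw [hr] at h1
      exact pos_of_mul_pos_left h1 v.2.2.le
    exact (Light.ideal_eq_iff.2 ⟨r, hr0, hr⟩).symm
  · rw [h, Isom.smul_ideal]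
    exact congrArg Light.ideal (Subtype.ext hgv)

end Polytope

/-! ### Horospherical coordinates and the flat torus -/

theorem time_pos_of_light {n : ℕ} (v : Light n) {x : Mink n} (hx : lor x x < 0)
    (h : lor x v.1 < 0) : 0 < x.1 := by
  rcases lt_trichotomy x.1 0 with h0 | h0 | h0
  · have hc : IsCausal (-x) := ⟨by rw [lor_neg_left, lor_neg_right]; linarith, by simpa using h0⟩
    have := hc.lor_nonpos v.isCausal
    rw [lor_neg_left] at this
    linarith
  · simp only [lor, real_inner_self_eq_norm_sq, h0] at hx
    nlinarith [sq_nonneg ‖x.2‖]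
  · exact h0

theorem mem_horosphere {n : ℕ} {v : Light n} {x : Hyp n} :
    x ∈ horosphere v ↔ lor x.1 v.1 = -1 := by
  rw [horosphere, Set.mem_ofPred_eq, neg_eq_iff_eq_neg]

theorem smul_mem_horosphere {n : ℕ} {v : Light n} {x : Hyp n} (hx : x ∈ horosphere v)
    {g : Isom n} (hg : g • v = v) : g • x ∈ horosphere v := by
  rw [mem_horosphere] at hx ⊢
  have h : g.1 v.1 = v.1 := congrArg Subtype.val hg
  rw [Isom.coe_smul_hyp]
  nth_rw 1 [← h]
  rwa [g.lor_map]

theorem eq_of_horoDist {n : ℕ} {v : Light n} {x y : Hyp n} (hx : x ∈ horosphere v)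
    (hy : y ∈ horosphere v) (h : lor (x.1 - y.1) (x.1 - y.1) = 0) : x = y := by
  rw [mem_horosphere] at hx hy
  obtain ⟨t, ht⟩ := eq_smul_of_light v (by rw [lor_sub_left, hx, hy, sub_self]) h
  have h1 : x.1 = y.1 + t • v.1 := by rw [← ht]; abel
  have h2 := x.2.1
  rw [h1] at h2
  simp only [lor_add_left, lor_add_right, lor_smul_left, lor_smul_right, y.2.1, v.2.1,
    lor_comm v.1 y.1, hy] at h2
  have h3 : t = 0 := by linarith
  refine Subtype.ext ?_
  rw [h1, h3, zero_smul, add_zero]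

namespace Polytope
variable {n : ℕ} {P : Polytope n}

/-- A family of maximal cardinality; at an ideal vertex it selects one facet from each opposite
pair. -/
theorem exists_orthogonal_facets (P : Polytope n) (v : Light n) :
    ∃ J : Finset (Fin P.m), (∀ j ∈ J, j ∈ P.inc v) ∧
      (∀ i ∈ J, ∀ j ∈ J, i ≠ j → lor (P.normal i) (P.normal j) = 0) ∧
      ∀ k ∈ P.inc v, k ∉ J → ∃ j ∈ J, lor (P.normal j) (P.normal k) ≠ 0 := by
  classical
  let A : Finset (Finset (Fin P.m)) := Finset.univ.filter fun J => (∀ j ∈ J, j ∈ P.inc v) ∧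
    ∀ i ∈ J, ∀ j ∈ J, i ≠ j → lor (P.normal i) (P.normal j) = 0
  obtain ⟨J, hJ, hmax⟩ := Finset.exists_max_image A Finset.card ⟨∅, by simp [A]⟩
  have hJ' := (Finset.mem_filter.1 hJ).2
  refine ⟨J, hJ'.1, hJ'.2, fun k hk hkJ => ?_⟩
  by_contra! hc
  have hm : insert k J ∈ A := by
    refine Finset.mem_filter.2 ⟨Finset.mem_univ _, fun j hj => ?_, fun i hi j hj hij => ?_⟩
    · rcases Finset.mem_insert.1 hj with rfl | hj
      · exact hk
      · exact hJ'.1 j hj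
    · rcases Finset.mem_insert.1 hi with hi' | hi' <;>
        rcases Finset.mem_insert.1 hj with hj' | hj'
      · exact absurd (hi'.trans hj'.symm) hij
      · rw [hi', lor_comm]; exact hc j hj'
      · rw [hj']; exact hc i hi'
      · exact hJ'.2 i hi' j hj' hij
  have := hmax _ hm
  rw [Finset.card_insert_of_notMem hkJ] at this
  omega

/-- The link of an ideal vertex is a box: there are `n - 1` pairwise orthogonal incident facets,
and the orthogonal complement of the ideal vertex is spanned by their normals. -/
theorem exists_frame (hP : P.IsRightAngled) (hvol : P.HasFiniteVolume) {v : Light n}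
    (hv : v.1 ∈ P.cone) : ∃ ι : Fin (n - 1) → Fin P.m, (∀ a, ι a ∈ P.inc v) ∧
      (∀ a b, a ≠ b → lor (P.normal (ι a)) (P.normal (ι b)) = 0) ∧
      ∀ u, lor u v.1 = 0 → lor u u = ∑ a, lor u (P.normal (ι a)) ^ 2 := by
  obtain ⟨J, hJ, horth, hmax⟩ := exists_orthogonal_facets P v
  have hev : ∀ j ∈ J, lor (P.normal j) v.1 = 0 := fun j hj => (lor_comm _ _).trans (hJ j hj)
  let S : (J → ℝ) →ₗ[ℝ] Mink n := ∑ j : J, (LinearMap.proj j).smulRight (P.normal j)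
  have hS : ∀ α : J → ℝ, S α = ∑ j : J, α j • P.normal j := fun α => by
    simp only [S, LinearMap.sum_apply, LinearMap.smulRight_apply, LinearMap.proj_apply]
  have hlor : ∀ (α : J → ℝ) (y : Mink n), lor (S α) y = ∑ j : J, α j * lor (P.normal j) y := by
    intro α y
    let L : Mink n →ₗ[ℝ] ℝ :=
      { toFun := fun x => lor x y
        map_add' := fun a b => lor_add_left a b y
        map_smul' := fun r a => lor_smul_left r a y }
    change L (S α) = ∑ j : J, α j * L (P.normal j)
    rw [hS, map_sum]
    simp
  have hSe : ∀ (α : J → ℝ) (i : J), lor (S α) (P.normal i) = α i := by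
    intro α i
    rw [hlor, Finset.sum_eq_single i]
    · rw [P.unit, mul_one]
    · intro j _ hji
      rw [horth j j.2 i i.2 (fun h => hji (Subtype.ext h)), mul_zero]
    · simp
  have hSv : ∀ α : J → ℝ, lor (S α) v.1 = 0 := fun α => by
    rw [hlor]
    exact Finset.sum_eq_zero fun j _ => by rw [hev j j.2, mul_zero]
  have hproj : ∀ u, lor u v.1 = 0 → lor (u - S fun j => lor u (P.normal j))
      (u - S fun j => lor u (P.normal j)) = 0 := by
    intro u hu
    set w := u - S fun j => lor u (P.normal j) with hw
    have hwv : lor w v.1 = 0 := by rw [hw, lor_sub_left, hu, hSv, sub_zero]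
    have hwJ : ∀ j ∈ J, lor w (P.normal j) = 0 := fun j hj => by
      rw [hw, lor_sub_left, hSe _ ⟨j, hj⟩, sub_self]
    -- Facets outside `J` are opposite to members of `J`, so the residual `w` is orthogonal to every
    -- incident normal. Finite volume and semidefiniteness then pinch its square to 0.
    refine le_antisymm (lor_self_nonpos_of_inc hvol hv hwv fun k hk => ?_)
      (lor_self_nonneg_of_light v hwv)
    by_cases hkJ : k ∈ J
    · exact (hwJ k hkJ).le
    · obtain ⟨j, hj, hne⟩ := hmax k hk hkJ
      have hjk : j ≠ k := by rintro rfl; exact hkJ hj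
      obtain ⟨c, -, hc⟩ := opposite (hJ j hj) hk ((P.lor_normal_cases hP hjk).resolve_left hne)
      rw [hc, lor_add_right, lor_neg_right, lor_smul_right, hwJ j hj, hwv]
      simp
  have hsq : ∀ u, lor u v.1 = 0 → lor u u = ∑ j : J, lor u (P.normal j) ^ 2 := by
    intro u hu
    have h := hproj u hu
    set α : J → ℝ := fun j => lor u (P.normal j) with hα
    have h1 : lor (S α) u = ∑ j : J, α j ^ 2 := by
      rw [hlor]
      exact Finset.sum_congr rfl fun j _ => by rw [lor_comm, hα]; ring
    have h2 : lor (S α) (S α) = ∑ j : J, α j ^ 2 := by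
      rw [hlor]
      exact Finset.sum_congr rfl fun j _ => by rw [lor_comm, hSe]; ring
    simp only [lor_sub_left, lor_sub_right, lor_comm u (S α), h1, h2] at h
    linarith
  have hxv : lor P.center.1 v.1 < 0 := by
    rw [lor_comm]; exact v.isCausal.lor_hyp_neg P.center
  -- The normals, `v` and the centre form a basis, so the family has `(n + 1) - 2` members.
  let F : (J → ℝ) × ℝ × ℝ →ₗ[ℝ] Mink n :=
    S.coprod ((LinearMap.toSpanSingleton ℝ _ v.1).coprod
      (LinearMap.toSpanSingleton ℝ _ P.center.1))
  have hF : ∀ p, F p = S p.1 + (p.2.1 • v.1 + p.2.2 • P.center.1) := fun p => rfl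
  have hFinj : Function.Injective F := by
    rw [← LinearMap.ker_eq_bot, Submodule.eq_bot_iff]
    rintro ⟨α, β, γ⟩ h
    rw [LinearMap.mem_ker, hF] at h
    have h1 := congrArg (lor · v.1) h
    simp only [lor_add_left, lor_smul_left, hSv, v.2.1, lor_zero_left] at h1
    have hγ : γ = 0 := by
      have : γ * lor P.center.1 v.1 = 0 := by linarith
      exact (mul_eq_zero.1 this).resolve_right hxv.ne
    subst hγ
    have hα : α = 0 := by
      funext i
      have h2 := congrArg (lor · (P.normal i)) h
      have hvi : lor v.1 (P.normal i) = 0 := hJ i i.2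
      simp only [lor_add_left, lor_smul_left, hSe, hvi, lor_zero_left] at h2
      simpa using h2
    subst hα
    have h3 := congrArg Prod.fst h
    simp only [map_zero, zero_smul, add_zero, zero_add, Prod.smul_fst, smul_eq_mul,
      Prod.fst_zero] at h3
    have hβ : β = 0 := (mul_eq_zero.1 h3).resolve_right v.2.2.ne'
    rw [hβ]
    rfl
  have hFsurj : Function.Surjective F := by
    intro x
    set γ := lor x v.1 / lor P.center.1 v.1 with hγ
    have hγ' : γ * lor P.center.1 v.1 = lor x v.1 := div_mul_cancel₀ _ hxv.ne
    have hu : lor (x - γ • P.center.1) v.1 = 0 := by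
      rw [lor_sub_left, lor_smul_left, hγ', sub_self]
    set u := x - γ • P.center.1 with hud
    obtain ⟨β, hβ⟩ := eq_smul_of_light v
      (by rw [lor_sub_left, hu, hSv, sub_zero]) (hproj u hu)
    refine ⟨⟨fun j => lor u (P.normal j), β, γ⟩, ?_⟩
    rw [hF]
    change S (fun j : J => lor u (P.normal j)) + (β • v.1 + γ • P.center.1) = x
    rw [← hβ, hud]
    abel
  have hcard : J.card = n - 1 := by
    have h := (LinearEquiv.ofBijective F ⟨hFinj, hFsurj⟩).finrank_eq
    simp only [Module.finrank_prod, Module.finrank_fintype_fun_eq_card, Fintype.card_coe,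
      Module.finrank_self, finrank_euclideanSpace_fin] at h
    omega
  let e : Fin (n - 1) ≃ J := (J.equivFinOfCardEq hcard).symm
  refine ⟨fun a => e a, fun a => hJ _ (e a).2, fun a b hab => ?_, fun u hu => ?_⟩
  · exact horth _ (e a).2 _ (e b).2 fun h => hab (e.injective (Subtype.ext h))
  · rw [hsq u hu]
    exact (e.sum_comp fun j : J => lor u (P.normal j) ^ 2).symm

/-- Horospherical coordinates: the Lorentzian products with the normals of a frame. -/
def coords (P : Polytope n) (ι : Fin (n - 1) → Fin P.m) (x : Mink n) :
    EuclideanSpace ℝ (Fin (n - 1)) := WithLp.toLp 2 fun a => lor x (P.normal (ι a))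

theorem exists_coords {v : Light n} {ι : Fin (n - 1) → Fin P.m} (hι : ∀ a, ι a ∈ P.inc v)
    (horth : ∀ a b, a ≠ b → lor (P.normal (ι a)) (P.normal (ι b)) = 0)
    (t : EuclideanSpace ℝ (Fin (n - 1))) : ∃ x ∈ horosphere v, P.coords ι x.1 = t := by
  have hxv : lor P.center.1 v.1 < 0 := by
    rw [lor_comm]; exact v.isCausal.lor_hyp_neg P.center
  set γ := -(lor P.center.1 v.1)⁻¹ with hγ
  let α : Fin (n - 1) → ℝ := fun a => t a - γ * lor P.center.1 (P.normal (ι a))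
  set z := ∑ a, α a • P.normal (ι a) + γ • P.center.1 with hz
  have hlor : ∀ y, lor z y = ∑ a, α a * lor (P.normal (ι a)) y + γ * lor P.center.1 y := by
    intro y
    let L : Mink n →ₗ[ℝ] ℝ :=
      { toFun := fun x => lor x y
        map_add' := fun a b => lor_add_left a b y
        map_smul' := fun r a => lor_smul_left r a y }
    change L z = ∑ a, α a * L (P.normal (ι a)) + γ * L P.center.1
    rw [hz, map_add, map_sum, map_smul]
    simp
  have hzv : lor z v.1 = -1 := by
    rw [hlor, Finset.sum_eq_zero, zero_add, hγ, neg_mul, inv_mul_cancel₀ hxv.ne]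
    intro a _
    rw [lor_comm, hι a, mul_zero]
  have hze : ∀ b, lor z (P.normal (ι b)) = t b := by
    intro b
    rw [hlor, Finset.sum_eq_single b]
    · rw [P.unit]; simp only [α]; ring
    · intro a _ hab
      rw [horth a b hab, mul_zero]
    · simp
  -- Moving along `v` keeps the coordinates and the height, and this amount makes the square equal
  -- to -1.
  set β := (lor z z + 1) / 2 with hβ
  have hxx : lor (z + β • v.1) (z + β • v.1) = -1 := by
    simp only [lor_add_left, lor_add_right, lor_smul_left, lor_smul_right, v.2.1,
      lor_comm v.1 z, hzv]
    rw [hβ]; ring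
  have hxv' : lor (z + β • v.1) v.1 = -1 := by
    rw [lor_add_left, lor_smul_left, v.2.1, hzv]; ring
  refine ⟨⟨z + β • v.1, hxx, time_pos_of_light v (by rw [hxx]; norm_num)
    (by rw [hxv']; norm_num)⟩, mem_horosphere.2 hxv', ?_⟩
  ext b
  change lor (z + β • v.1) (P.normal (ι b)) = t b
  rw [lor_add_left, lor_smul_left, hι b, hze]
  ring

/-- The difference of two points of a horosphere is orthogonal to `v`, where the frame diagonalizes
the form. -/
theorem horoDist_eq {v : Light n} {ι : Fin (n - 1) → Fin P.m}
    (hsq : ∀ u, lor u v.1 = 0 → lor u u = ∑ a, lor u (P.normal (ι a)) ^ 2) {x y : Hyp n}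
    (hx : x ∈ horosphere v) (hy : y ∈ horosphere v) :
    horoDist x y = ‖P.coords ι x.1 - P.coords ι y.1‖ := by
  rw [mem_horosphere] at hx hy
  rw [horoDist, hsq _ (by rw [lor_sub_left, hx, hy, sub_self]), EuclideanSpace.norm_eq]
  congr 1
  refine Finset.sum_congr rfl fun a _ => ?_
  rw [lor_sub_left, Real.norm_eq_abs, sq_abs]
  rfl

/-- The subgroup of translations of the horosphere coming from `G`. -/
def translations (P : Polytope n) (G : Subgroup (Isom n)) (v : Light n)
    (ι : Fin (n - 1) → Fin P.m) : AddSubgroup (EuclideanSpace ℝ (Fin (n - 1))) where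
  carrier := {t | ∃ g ∈ G, g • v = v ∧
    ∀ x ∈ horosphere v, P.coords ι (g • x).1 = P.coords ι x.1 + t}
  zero_mem' := ⟨1, one_mem _, one_smul _ _, fun x _ => by rw [one_smul, add_zero]⟩
  add_mem' := by
    rintro s t ⟨g, hg, hgv, hgs⟩ ⟨h, hh, hhv, hht⟩
    refine ⟨g * h, mul_mem hg hh, by rw [mul_smul, hhv, hgv], fun x hx => ?_⟩
    rw [mul_smul, hgs _ (smul_mem_horosphere hx hhv), hht x hx]
    abel
  neg_mem' := by
    rintro t ⟨g, hg, hgv, hgt⟩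
    have hgv' : g⁻¹ • v = v := by rw [inv_smul_eq_iff, hgv]
    refine ⟨g⁻¹, inv_mem hg, hgv', fun x hx => ?_⟩
    have := hgt _ (smul_mem_horosphere hx hgv')
    rw [smul_inv_smul] at this
    rw [this]
    abel

theorem mem_translations {G : Subgroup (Isom n)} {v : Light n} {ι : Fin (n - 1) → Fin P.m}
    {t : EuclideanSpace ℝ (Fin (n - 1))} : t ∈ P.translations G v ι ↔ ∃ g ∈ G, g • v = v ∧
      ∀ x ∈ horosphere v, P.coords ι (g • x).1 = P.coords ι x.1 + t := Iff.rfl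

/-- If the action on the horosphere is by a lattice of translations, the quotient is a torus. -/
theorem isToricAt_of_lattice {G : Subgroup (Isom n)} {v : Light n} {ι : Fin (n - 1) → Fin P.m}
    (hι : ∀ a, ι a ∈ P.inc v)
    (horth : ∀ a b, a ≠ b → lor (P.normal (ι a)) (P.normal (ι b)) = 0)
    (hsq : ∀ u, lor u v.1 = 0 → lor u u = ∑ a, lor u (P.normal (ι a)) ^ 2)
    (hinv : ∀ g ∈ G, (∃ x ∈ horoball v, g • x ∈ horoball v) → g • v = v)
    (htr : ∀ g ∈ G, g • v = v → ∃ t : EuclideanSpace ℝ (Fin (n - 1)),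
      ∀ x ∈ horosphere v, P.coords ι (g • x).1 = P.coords ι x.1 + t)
    (hdisc : DiscreteTopology (AddSubgroup.toIntSubmodule (P.translations G v ι)))
    (hspan : Submodule.span ℝ (P.translations G v ι : Set (EuclideanSpace ℝ (Fin (n - 1)))) = ⊤) :
    IsToricAt G v.ideal := by
  refine ⟨v, rfl, hinv, AddSubgroup.toIntSubmodule (P.translations G v ι), hdisc, ⟨hspan⟩, ?_⟩
  let Λ := (AddSubgroup.toIntSubmodule (P.translations G v ι)).toAddSubgroup
  have hΛ : ∀ t, t ∈ Λ ↔ t ∈ P.translations G v ι := fun t => Iff.rfl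
  refine ⟨fun x => (P.coords ι x.1.1 : EuclideanSpace ℝ (Fin (n - 1)) ⧸ Λ), ?_, ?_, ?_⟩
  · intro q
    obtain ⟨t, rfl⟩ := QuotientAddGroup.mk_surjective q
    obtain ⟨x, hx, rfl⟩ := exists_coords hι horth t
    exact ⟨⟨x, hx⟩, rfl⟩
  · rintro ⟨x, hx⟩ ⟨y, hy⟩
    rw [QuotientAddGroup.eq, hΛ, mem_translations]
    refine exists_congr fun g => and_congr_right fun hg => and_congr_right fun hgv =>
      ⟨fun h => ?_, fun h => ?_⟩
    · have h1 := h x hx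
      have hgx := smul_mem_horosphere hx hgv
      have h2 := horoDist_eq hsq hgx hy
      rw [h1, show P.coords ι x.1 + (-P.coords ι x.1 + P.coords ι y.1) - P.coords ι y.1 = 0 by
        abel, norm_zero, horoDist, Real.sqrt_eq_zero'] at h2
      refine eq_of_horoDist hgx hy (le_antisymm h2 (lor_self_nonneg_of_light v ?_))
      rw [lor_sub_left, mem_horosphere.1 hgx, mem_horosphere.1 hy, sub_self]
    · obtain ⟨t, ht⟩ := htr g hg hgv
      have h1 := ht x hx
      rw [h] at h1
      intro z hz
      rw [ht z hz, h1]
      abel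
  · rintro ⟨x, hx⟩ ⟨y, hy⟩
    choose! T hT using htr
    change dist (QuotientAddGroup.mk (P.coords ι x.1) : EuclideanSpace ℝ (Fin (n - 1)) ⧸ Λ)
      (QuotientAddGroup.mk (P.coords ι y.1)) = _
    rw [dist_eq_norm, ← QuotientAddGroup.mk_sub, QuotientAddGroup.norm_mk,
      Metric.infDist_eq_iInf]
    -- The quotient norm is the distance to the lattice; sending `g` to its translation vector
    -- matches the two infima.
    refine (Function.Surjective.iInf_congr
      (fun g : {g : Isom n // g ∈ G ∧ g • v = v} =>
        (⟨T g.1, show T g.1 ∈ P.translations G v ι from ⟨g.1, g.2.1, g.2.2, hT g.1 g.2.1 g.2.2⟩⟩ :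
          ((Λ : Set (EuclideanSpace ℝ (Fin (n - 1)))) : Type))) ?_ ?_).symm
    · rintro ⟨t, g, hg, hgv, ht⟩
      refine ⟨⟨g, hg, hgv⟩, Subtype.ext ?_⟩
      have h1 := hT g hg hgv x hx
      rw [ht x hx] at h1
      exact (add_left_cancel h1).symm
    · rintro ⟨g, hg, hgv⟩
      rw [horoDist_eq hsq hx (smul_mem_horosphere hy hgv), hT g hg hgv y hy, dist_eq_norm]
      congr 1
      change _ - _ - T g = _
      abel

/-- Rescaling the lightlike vector by `τ⁻¹` turns the horoball of height `τ` into the one of height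
1. -/
theorem exists_invariant_horoball (hP : P.IsRightAngled) (hvol : P.HasFiniteVolume) {v : Light n}
    (hv : v.1 ∈ P.cone) : ∃ w : Light n, w.ideal = v.ideal ∧ w.1 ∈ P.cone ∧
      ∀ g ∈ P.reflectionGroup, (∃ x ∈ horoball w, g • x ∈ horoball w) → g • w = w := by
  obtain ⟨τ, hτ, hH⟩ := exists_horoball hP hvol hv
  have hτ' := inv_pos.2 hτ
  let w : Light n := ⟨τ⁻¹ • v.1, by rw [lor_smul_left, lor_smul_right, v.2.1]; simp,
    mul_pos hτ' v.2.2⟩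
  have hw : ∀ x : Hyp n, x ∈ horoball w → -lor x.1 v.1 ≤ τ := by
    intro x hx
    have h : -lor x.1 (τ⁻¹ • v.1) ≤ 1 := hx
    rwa [lor_smul_right, ← mul_neg, inv_mul_le_iff₀ hτ, mul_one] at h
  refine ⟨w, (Light.ideal_eq_iff.2 ⟨τ⁻¹, hτ', rfl⟩).symm, ⟨w.isCausal, fun i => ?_⟩, ?_⟩
  · change lor (τ⁻¹ • v.1) _ ≤ 0
    rw [lor_smul_left]
    exact mul_nonpos_of_nonneg_of_nonpos hτ'.le (hv.2 i)
  · rintro g hg ⟨x, hx, hgx⟩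
    refine Subtype.ext ?_
    change g.1 (τ⁻¹ • v.1) = τ⁻¹ • v.1
    rw [map_smul, hH g hg x (hw x hx) (hw _ hgx)]

/-- The cusps at the ideal vertices of the polytope are toric. -/
theorem isToricAt_of_cone {c : ℕ} {col : Fin P.m → Fin c} (hP : P.IsRightAngled)
    (hcol : P.IsColouring col) (hvol : P.HasFiniteVolume) {v : Light n} (hv : v.1 ∈ P.cone) :
    IsToricAt (P.colKer col hP) v.ideal := by
  obtain ⟨w, hwv, hw, hinv⟩ := exists_invariant_horoball hP hvol hv
  rw [← hwv]
  clear! v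
  obtain ⟨ι, hι, horth, hsq⟩ := exists_frame hP hvol hw
  choose o ho a ha hoa using fun b => exists_opposite hP hvol hw (hι b)
  have hKΓ : ∀ g ∈ P.colKer col hP, g ∈ P.reflectionGroup := fun g hg =>
    ((P.mem_colKer col hP).1 hg).1
  have hact : ∀ g ∈ P.colKer col hP, g • w = w → ∃ k : Fin (n - 1) → ℤ,
      ∀ x ∈ horosphere w, P.coords ι (g • x).1 =
        P.coords ι x.1 + WithLp.toLp 2 fun b => 2 * a b * (k b : ℝ) := by
    intro g hg hgw
    have hgw' : g⁻¹ • w = w := by rw [inv_smul_eq_iff, hgw]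
    -- Coordinates of `g • x` are products of `x` with `g⁻¹` applied to the normals, so the inverse
    -- is used; the value -1 on the horosphere flips the sign of `k`.
    choose k hk using fun b => ker_apply_normal hP hcol hw (hι b) (ho b) (hoa b)
      (inv_mem hg) (congrArg Subtype.val hgw')
    refine ⟨fun b => -k b, fun x hx => ?_⟩
    ext b
    change lor (g.1 x.1) (P.normal (ι b)) = lor x.1 (P.normal (ι b)) + 2 * a b * ((-k b : ℤ) : ℝ)
    rw [lor_comm, ← g.lor_inv, hk b, lor_add_left, lor_smul_left, lor_comm w.1,
      mem_horosphere.1 hx, lor_comm]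
    push_cast
    ring
  refine isToricAt_of_lattice hι horth hsq (fun g hg => hinv g (hKΓ g hg))
    (fun g hg hgw => ?_) ?_ ?_
  · obtain ⟨k, hk⟩ := hact g hg hgw
    exact ⟨_, hk⟩
  · obtain ⟨r, hr, hr0⟩ : ∃ r : ℝ, (∀ b, r ≤ 2 * a b) ∧ 0 < r := by
      have h : ∀ᶠ r : ℝ in nhdsWithin 0 (Set.Ioi 0), ∀ b, r ≤ 2 * a b := by
        rw [Filter.eventually_all]
        intro b
        have h0 : (0 : ℝ) < 2 * a b := mul_pos two_pos (ha b)
        exact nhdsWithin_le_nhds (Iic_mem_nhds h0)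
      exact (h.and self_mem_nhdsWithin).exists
    refine DiscreteTopology.of_forall_le_norm hr0 ?_
    rintro ⟨t, g, hg, hgw, ht⟩ hne
    obtain ⟨k, hk⟩ := hact g hg hgw
    obtain ⟨x, hx, -⟩ := exists_coords hι horth 0
    have htk : t = WithLp.toLp 2 fun b => 2 * a b * (k b : ℝ) :=
      add_left_cancel ((ht x hx).symm.trans (hk x hx))
    have hkb : ∃ b, k b ≠ 0 := by
      by_contra! h0
      refine hne (Subtype.ext ?_)
      change t = 0
      rw [htk]
      ext b
      simp [h0 b]
    obtain ⟨b, hb⟩ := hkb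
    change r ≤ ‖t‖
    refine le_trans ?_ (PiLp.norm_apply_le t b)
    rw [htk]
    change r ≤ ‖2 * a b * (k b : ℝ)‖
    have h1 : (1 : ℝ) ≤ |(k b : ℝ)| := by exact_mod_cast Int.one_le_abs hb
    rw [norm_mul, Real.norm_eq_abs, Real.norm_eq_abs, abs_of_pos (mul_pos two_pos (ha b))]
    nlinarith [hr b, ha b]
  · rw [eq_top_iff, ← (EuclideanSpace.basisFun (Fin (n - 1)) ℝ).toBasis.span_eq,
      Submodule.span_le]
    rintro _ ⟨b, rfl⟩
    -- The inverse of `transl` shifts one coordinate and fixes the others, so the translation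
    -- vectors span.
    have hmem : (4 * a b) • EuclideanSpace.single b (1 : ℝ) ∈
        P.translations (P.colKer col hP) w ι := by
      have hg := transl_mem col hP (ι b) (o b)
      have hgw : P.transl (ι b) (o b) • w = w := Subtype.ext (transl_apply_light (hι b) (ho b))
      have hgw' : (P.transl (ι b) (o b))⁻¹ • w = w := by rw [inv_smul_eq_iff, hgw]
      refine ⟨_, inv_mem hg, hgw', fun x hx => ?_⟩
      ext d
      change lor ((P.transl (ι b) (o b))⁻¹.1 x.1) (P.normal (ι d)) =
        lor x.1 (P.normal (ι d)) + 4 * a b * (EuclideanSpace.single b (1 : ℝ)) d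
      rw [Isom.lor_inv]
      by_cases hbd : b = d
      · subst hbd
        rw [transl_apply_normal (hι b) (ho b) (hoa b), lor_sub_right, lor_smul_right,
          mem_horosphere.1 hx, PiLp.single_apply, if_pos rfl]
        ring
      · rw [transl_apply_normal_orth (hι d) (hoa b) (horth b d hbd),
          PiLp.single_apply, if_neg (Ne.symm hbd)]
        ring
    have h4 : (4 * a b) ≠ 0 := by have := ha b; positivity
    have := Submodule.smul_mem (Submodule.span ℝ
      (P.translations (P.colKer col hP) w ι : Set (EuclideanSpace ℝ (Fin (n - 1)))))
      (4 * a b)⁻¹ (Submodule.subset_span hmem)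
    rw [smul_smul, inv_mul_cancel₀ h4, one_smul] at this
    simpa using this

end Polytope

/-! ### Transport of cusps by isometries normalizing the group -/

theorem IsParabolicAt.conj {n : ℕ} {g : Isom n} {ξ : IdealPoint n} (h : IsParabolicAt g ξ)
    (γ : Isom n) : IsParabolicAt (γ * g * γ⁻¹) (γ • ξ) := by
  refine ⟨fun x hx => h.1 (γ⁻¹ • x) ?_, fun η => ?_⟩
  · rwa [mul_smul, mul_smul, smul_eq_iff_eq_inv_smul] at hx
  · rw [mul_smul, mul_smul, smul_eq_iff_eq_inv_smul, h.2, inv_smul_eq_iff]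

theorem horoDist_smul {n : ℕ} (γ : Isom n) (x y : Hyp n) :
    horoDist (γ • x) (γ • y) = horoDist x y := by
  rw [horoDist, horoDist, Isom.coe_smul_hyp, Isom.coe_smul_hyp, ← map_sub, γ.lor_map]

theorem lor_smul_light {n : ℕ} (γ : Isom n) (x : Hyp n) (v : Light n) :
    lor x.1 (γ • v).1 = lor (γ⁻¹ • x).1 v.1 := by
  rw [Isom.coe_smul_light, Isom.coe_smul_hyp, Isom.lor_inv]

/-- Toric cusps are preserved by isometries which normalize the group. -/
theorem IsToricAt.smul {n : ℕ} {G : Subgroup (Isom n)} {ξ : IdealPoint n} (h : IsToricAt G ξ)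
    (γ : Isom n) (hγ : ∀ g ∈ G, γ * g * γ⁻¹ ∈ G) (hγ' : ∀ g ∈ G, γ⁻¹ * g * γ ∈ G) :
    IsToricAt G (γ • ξ) := by
  obtain ⟨v, rfl, hinv, Λ, hΛ, hZ, f, hsurj, hfib, hdist⟩ := h
  have hball : ∀ x : Hyp n, x ∈ horoball (γ • v) → γ⁻¹ • x ∈ horoball v := fun x hx => by
    change -lor (γ⁻¹ • x).1 v.1 ≤ 1
    rw [← lor_smul_light]
    exact hx
  have hsph : ∀ x : Hyp n, x ∈ horosphere (γ • v) ↔ γ⁻¹ • x ∈ horosphere v := fun x => by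
    rw [mem_horosphere, mem_horosphere, lor_smul_light]
  have hconj : ∀ g : Isom n, g • γ • v = γ • v ↔ (γ⁻¹ * g * γ) • v = v := fun g => by
    rw [mul_smul, mul_smul, inv_smul_eq_iff]
  refine ⟨γ • v, rfl, ?_, Λ, hΛ, hZ, fun x => f ⟨γ⁻¹ • x.1, (hsph x.1).1 x.2⟩, ?_, ?_, ?_⟩
  · rintro g hg ⟨x, hx, hgx⟩
    rw [hconj]
    refine hinv _ (hγ' g hg) ⟨γ⁻¹ • x, hball x hx, ?_⟩
    rw [mul_smul, smul_inv_smul, mul_smul]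
    exact hball _ hgx
  · intro q
    obtain ⟨⟨x, hx⟩, rfl⟩ := hsurj q
    exact ⟨⟨γ • x, (hsph _).2 (by rwa [inv_smul_smul])⟩,
      congrArg f (Subtype.ext (inv_smul_smul γ x))⟩
  · rintro ⟨x, hx⟩ ⟨y, hy⟩
    rw [hfib]
    constructor
    · rintro ⟨g, hg, hgv, hgx⟩
      refine ⟨γ * g * γ⁻¹, hγ g hg, ?_, ?_⟩
      · rw [mul_smul, inv_smul_smul, mul_smul, hgv]
      · rw [mul_smul, mul_smul]
        exact smul_eq_iff_eq_inv_smul γ |>.2 hgx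
    · rintro ⟨g, hg, hgv, hgx⟩
      refine ⟨γ⁻¹ * g * γ, hγ' g hg, (hconj g).1 hgv, ?_⟩
      change (γ⁻¹ * g * γ) • γ⁻¹ • x = γ⁻¹ • y
      rw [mul_smul, smul_inv_smul, mul_smul]
      exact congrArg _ hgx
  · rintro ⟨x, hx⟩ ⟨y, hy⟩
    rw [hdist]
    refine Function.Surjective.iInf_congr
      (fun g : {g : Isom n // g ∈ G ∧ g • v = v} =>
        (⟨γ * g.1 * γ⁻¹, hγ _ g.2.1, by rw [mul_smul, inv_smul_smul, mul_smul, g.2.2]⟩ :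
          {g : Isom n // g ∈ G ∧ g • γ • v = γ • v})) ?_ ?_
    · rintro ⟨g, hg, hgv⟩
      exact ⟨⟨γ⁻¹ * g * γ, hγ' g hg, (hconj g).1 hgv⟩, Subtype.ext (by
        change γ * (γ⁻¹ * g * γ) * γ⁻¹ = g
        group)⟩
    · rintro ⟨g, hg, hgv⟩
      change horoDist x ((γ * g * γ⁻¹) • y) = horoDist (γ⁻¹ • x) (g • γ⁻¹ • y)
      rw [← horoDist_smul γ (γ⁻¹ • x), smul_inv_smul, mul_smul, mul_smul]

theorem idealClass_eq_iff {n : ℕ} {G : Subgroup (Isom n)} {ξ η : IdealPoint n} :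
    idealClass G ξ = idealClass G η ↔ ∃ g ∈ G, g • η = ξ := by
  refine ⟨fun h => ?_, fun ⟨g, hg, h⟩ => Quotient.sound (MulAction.orbitRel_apply.2 ⟨⟨g, hg⟩, h⟩)⟩
  obtain ⟨g, hg⟩ := MulAction.orbitRel_apply.1 (Quotient.exact h)
  exact ⟨g.1, g.2, hg⟩

/-! ### Toric cusps and their number -/

namespace Polytope
variable {n : ℕ} {P : Polytope n} {c : ℕ} {col : Fin P.m → Fin c}

/-- Every representative of a cusp is a `Γ`-translate of an ideal vertex of `P`, and `Γ` normalizes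
the kernel. -/
theorem isToricCusp (hP : P.IsRightAngled) (hcol : P.IsColouring col) (hvol : P.HasFiniteVolume)
    {q : MulAction.orbitRel.Quotient (P.colKer col hP) (IdealPoint n)}
    (hq : q ∈ cusps (P.colKer col hP)) : IsToricCusp (P.colKer col hP) q := by
  obtain ⟨ξ, ⟨g, hg, hgξ⟩, rfl⟩ := hq
  intro η hη
  obtain ⟨h, hh, rfl⟩ := idealClass_eq_iff.1 hη
  obtain ⟨γ, hγ, v, hv, rfl⟩ := exists_ideal_vertex_of_parabolic hP hvol
    ((P.mem_colKer col hP).1 hg).1 hgξ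
  have hhγ : h * γ ∈ P.reflectionGroup := mul_mem ((P.mem_colKer col hP).1 hh).1 hγ
  rw [← mul_smul]
  refine (isToricAt_of_cone hP hcol hvol hv).smul _
    (fun k hk => P.conj_mem_colKer col hP hk hhγ) fun k hk => ?_
  simpa using P.conj_mem_colKer col hP hk (inv_mem hhγ)

theorem colVec_eq_zero_of_subRefl (hP : P.IsRightAngled) {I : Set (Fin P.m)} {g : Isom n}
    (hg : g ∈ P.subRefl I) {k : Fin c} (hk : k ∉ col '' I) : P.colVec col g k = 0 := by
  refine P.subRefl_induction (p := fun g => P.colVec col g k = 0)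
    (by rw [P.colVec_one col hP]; rfl) (fun i hi g hg h => ?_) hg
  have hne : k ≠ col i := by rintro rfl; exact hk ⟨i, hi, rfl⟩
  rw [P.colVec_s_mul col hP (P.subRefl_le _ hg), Pi.add_apply, h, Pi.single_eq_of_ne hne, add_zero]

/-- With `colVec_eq_zero_of_subRefl`, this identifies the image of the subgroup with the vectors
supported on the colours of `I`. -/
theorem exists_colVec_eq (hP : P.IsRightAngled) {I : Set (Fin P.m)} {u : Fin c → ZMod 2}
    (hu : ∀ k ∉ col '' I, u k = 0) : ∃ g ∈ P.subRefl I, P.colVec col g = u := by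
  let A : AddSubmonoid (Fin c → ZMod 2) :=
    { carrier := {u | ∃ g ∈ P.subRefl I, P.colVec col g = u}
      zero_mem' := ⟨1, one_mem _, P.colVec_one col hP⟩
      add_mem' := by
        rintro _ _ ⟨g, hg, rfl⟩ ⟨h, hh, rfl⟩
        exact ⟨g * h, mul_mem hg hh, P.colVec_mul col hP (P.subRefl_le _ hg) (P.subRefl_le _ hh)⟩ }
  change u ∈ A
  rw [← Finset.univ_sum_single u]
  refine sum_mem fun k _ => ?_
  have h01 : ∀ z : ZMod 2, z = 0 ∨ z = 1 := by decide
  rcases h01 (u k) with h | h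
  · rw [h, Pi.single_zero]; exact zero_mem A
  · have hk : k ∈ col '' I := by
      by_contra hc
      rw [hu k hc] at h
      exact zero_ne_one h
    obtain ⟨i, hi, rfl⟩ := hk
    rw [h]
    exact ⟨P.s i, P.s_mem_subRefl hi, P.colVec_s col hP i⟩

/-- Positive multiples of `v` stay in the cone, so the strict fundamental domain already excludes a
rescaling of `v`. -/
theorem mem_subRefl_of_fixed_ideal (hP : P.IsRightAngled) {v : Light n} (hv : v.1 ∈ P.cone)
    {g : Isom n} (hg : g ∈ P.reflectionGroup) (hgv : g • v.ideal = v.ideal) :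
    g ∈ P.subRefl (P.inc v) := by
  rw [Isom.smul_ideal, eq_comm, Light.ideal_eq_iff] at hgv
  obtain ⟨t, ht, h⟩ := hgv
  rw [Isom.coe_smul_light] at h
  refine (P.eq_of_mem_cone hP hv hg ?_).2
  rw [h]
  refine ⟨hv.1.smul ht, fun i => ?_⟩
  rw [lor_smul_left]
  exact mul_nonpos_of_nonneg_of_nonpos ht.le (hv.2 i)

theorem smul_ideal_of_subRefl {v : Light n} {g : Isom n} (hg : g ∈ P.subRefl (P.inc v)) :
    g • v.ideal = v.ideal := by
  rw [Isom.smul_ideal]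
  exact congrArg Light.ideal (Subtype.ext (subRefl_apply hg))

/-- Two translates of an ideal vertex define the same cusp if and only if the colour vectors agree
away from the colours of the incident facets. -/
theorem idealClass_smul_eq_iff (hP : P.IsRightAngled) {v : Light n} (hv : v.1 ∈ P.cone)
    {γ γ' : Isom n} (hγ : γ ∈ P.reflectionGroup) (hγ' : γ' ∈ P.reflectionGroup) :
    idealClass (P.colKer col hP) (γ • v.ideal) = idealClass (P.colKer col hP) (γ' • v.ideal) ↔
      ∀ k ∉ col '' P.inc v, P.colVec col γ k = P.colVec col γ' k := by
  rw [idealClass_eq_iff]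
  constructor
  · rintro ⟨g, hg, h⟩ k hk
    rw [mem_colKer] at hg
    have hm := mul_mem (mul_mem (inv_mem hγ) hg.1) hγ'
    have hs := mem_subRefl_of_fixed_ideal hP hv hm
      (by rw [mul_smul, mul_smul, h, inv_smul_smul])
    have h0 := colVec_eq_zero_of_subRefl hP hs hk
    rw [P.colVec_mul col hP (mul_mem (inv_mem hγ) hg.1) hγ',
      P.colVec_mul col hP (inv_mem hγ) hg.1, hg.2, add_zero, P.colVec_inv col hP hγ,
      Pi.add_apply, CharTwo.add_eq_zero] at h0
    exact h0
  · intro h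
    obtain ⟨s, hs, hsv⟩ := exists_colVec_eq (col := col) hP (I := P.inc v)
      (u := P.colVec col γ + P.colVec col γ') (fun k hk => by
        rw [Pi.add_apply, h k hk, CharTwo.add_self_eq_zero])
    have hsΓ := P.subRefl_le _ hs
    refine ⟨γ * s * γ'⁻¹, (P.mem_colKer col hP).2
      ⟨mul_mem (mul_mem hγ hsΓ) (inv_mem hγ'), ?_⟩, ?_⟩
    · rw [P.colVec_mul col hP (mul_mem hγ hsΓ) (inv_mem hγ'), P.colVec_mul col hP hγ hsΓ, hsv,
        P.colVec_inv col hP hγ', ← add_assoc, two_torsion, zero_add, two_torsion]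
    · rw [mul_smul, inv_smul_smul, mul_smul, smul_ideal_of_subRefl hs]

theorem facetsAt_ideal (v : Light n) : P.facetsAt v.ideal = P.inc v := by
  ext i
  constructor
  · rintro ⟨w, hw, hi⟩
    obtain ⟨t, -, h⟩ := Light.ideal_eq_iff.1 hw
    change lor v.1 _ = 0
    rw [h, lor_smul_left, hi, mul_zero]
  · exact fun hi => ⟨v, rfl, hi⟩

/-- Restricting colour vectors to the colours absent at the vertex gives a bijection from the cusps
above it to the functions from those colours to `ZMod 2`; surjectivity of the colouring realizes
every such function. -/
theorem ncard_cuspsAbove (hP : P.IsRightAngled) (hcol : P.IsColouring col)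
    (hvol : P.HasFiniteVolume) {ξ : IdealPoint n} (hξ : P.IsIdealVertex ξ) :
    (cuspsAbove P.reflectionGroup (P.colKer col hP) ξ).ncard =
      2 ^ (c - (col '' P.facetsAt ξ).ncard) := by
  obtain ⟨v, rfl, hv⟩ := hξ
  replace hv : v.1 ∈ P.cone := ⟨v.isCausal, hv⟩
  rw [facetsAt_ideal]
  set C := col '' P.inc v with hC
  have hall : ∀ u : Fin c → ZMod 2, ∃ γ ∈ P.reflectionGroup, P.colVec col γ = u := by
    intro u
    obtain ⟨g, hg, hgu⟩ := exists_colVec_eq (col := col) hP (I := Set.univ) (u := u)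
      (fun k hk => by
        rw [Set.image_univ, hcol.surjective.range_eq] at hk
        exact absurd trivial hk)
    exact ⟨g, P.subRefl_le _ hg, hgu⟩
  classical
  choose γ hγ hγu using fun f : (Cᶜ : Set (Fin c)) → ZMod 2 =>
    hall fun k => if h : k ∈ Cᶜ then f ⟨k, h⟩ else 0
  let F : ((Cᶜ : Set (Fin c)) → ZMod 2) →
      MulAction.orbitRel.Quotient (P.colKer col hP) (IdealPoint n) :=
    fun f => idealClass (P.colKer col hP) (γ f • v.ideal)
  have hval : ∀ f k (h : k ∈ Cᶜ), P.colVec col (γ f) k = f ⟨k, h⟩ := fun f k h => by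
    rw [hγu]
    exact dif_pos h
  have hFinj : Function.Injective F := by
    intro f f' hff'
    funext ⟨k, hk⟩
    rw [← hval f k hk, ← hval f' k hk]
    exact (idealClass_smul_eq_iff hP hv (hγ f) (hγ f')).1 hff' k hk
  have hrange : cuspsAbove P.reflectionGroup (P.colKer col hP) v.ideal = Set.range F := by
    ext q
    constructor
    · rintro ⟨-, g, hg, rfl⟩
      refine ⟨fun k => P.colVec col g k, ?_⟩
      exact (idealClass_smul_eq_iff hP hv (hγ _) hg).2 fun k hk => hval _ k hk
    · rintro ⟨f, rfl⟩
      refine ⟨?_, γ f, hγ f, rfl⟩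
      obtain ⟨g, hg, hgv⟩ := exists_parabolic col hP hvol hv
      -- Conjugating a parabolic element of the kernel at `v` shows that each of these classes is a
      -- cusp.
      exact ⟨_, ⟨_, P.conj_mem_colKer col hP hg (hγ f), hgv.conj (γ f)⟩, rfl⟩
  have hcard : (Cᶜ : Set (Fin c)).ncard = c - C.ncard := by
    have := Set.ncard_add_ncard_compl C
    rw [Nat.card_fin] at this
    omega
  rw [hrange, ← Set.image_univ, Set.ncard_image_of_injective _ hFinj, Set.ncard_univ, Nat.card_fun,
    Nat.card_zmod, Nat.card_coe_set_eq, hcard]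

end Polytope
end HypCusp

end

theorem mainTheorem8 {n c : ℕ} (P : HypCusp.Polytope n)
    (hright : P.IsRightAngled) (hvol : P.HasFiniteVolume)
    (hideal : ∃ ξ, P.IsIdealVertex ξ)
    (col : Fin P.m → Fin c) (hcol : P.IsColouring col) :
    ∃ φ : P.reflectionGroup →* Multiplicative (Fin c → ZMod 2),
      (∀ i, φ (P.refl i) = Multiplicative.ofAdd (Pi.single (col i) 1)) ∧
      HypCusp.QuotIsHyperbolicManifold (φ.ker.map P.reflectionGroup.subtype) ∧
      (∀ q ∈ HypCusp.cusps (φ.ker.map P.reflectionGroup.subtype),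
        HypCusp.IsToricCusp (φ.ker.map P.reflectionGroup.subtype) q) ∧
      ∀ ξ, P.IsIdealVertex ξ →
        (HypCusp.cuspsAbove P.reflectionGroup (φ.ker.map P.reflectionGroup.subtype) ξ).ncard =
          2 ^ (c - (col '' P.facetsAt ξ).ncard) := by
  exact ⟨P.colHom col hright,
    fun i => congrArg Multiplicative.ofAdd (P.colVec_s col hright i),
    P.quotIsHyperbolicManifold hright hcol,
    fun _ hq => HypCusp.Polytope.isToricCusp hright hcol hvol hq,
    fun _ hξ => HypCusp.Polytope.ncard_cuspsAbove hright hcol hvol hξ⟩
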